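/- Fix an even integer $\mathfrak q\ge 4$. For an odd positive integer $L$ put $\varepsilon_j=L^{-j}$. Let $n\ge 1$ and let $T,S$ be positive integers (set $L_{\rm tp}=L^{2n}T$, $L_{\rm sp}=L^{n}S$). For $0\le j\le n$ let $$\mathcal X_j=\big(\varepsilon_j^2\mathbb Z/T\mathbb Z\big)\times\big(\varepsilon_j\mathbb Z^3/S\mathbb Z^3\big),$$ and let $\mathcal H_j$ be the space of functions $\alpha:\mathcal X_j\to\mathbb C$, with the integral $\int_{\mathcal X_j}du=\varepsilon_j^5\sum_{u\in\mathcal X_j}$ and the real inner product $\langle\alpha_1,\alpha_2\rangle_j=\int_{\mathcal X_j}\alpha_1(u)\alpha_2(u)\,du$; adjoints ($^*$) are taken with respect to these inner products. An operator $A:\mathcal H_j\to\mathcal H_k$ has the kernel $A(u,u')$ given by $(A\alpha)(u)=\int_{\mathcal X_j}A(u,u')\alpha(u')\,du'$, and for $m\ge0$ $$\|A\|_m=\max\Big\{\sup_{u\in\mathcal X_k}\int_{\mathcal X_j}du'\,e^{m|u-u'|}|A(u,u')|,\ \sup_{u'\in\mathcal X_j}\int_{\mathcal X_k}du\,e^{m|u-u'|}|A(u,u')|\Big\},$$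 where $|u-u'|$ is the Euclidean distance in the torus $(\mathbb R/T\mathbb Z)\times(\mathbb R^3/S\mathbb Z^3)$. Averaging operators. Let $q=L^{-5\mathfrak q}\,1_\square*\cdots*1_\square$ ($\mathfrak q$ factors, convolution on $\mathbb Z\times\mathbb Z^3$), where $1_\square$ is the characteristic function of $\big[-\frac{L^2-1}2,\frac{L^2-1}2\big]\times\big[-\frac{L-1}2,\frac{L-1}2\big]^3$. For $1\le j\le n$ let $Q^{(j)}:\mathcal H_j\to\mathcal H_{j-1}$, $$(Q^{(j)}\psi)(y)=\sum_{x\in\mathbb Z\times\mathbb Z^3}q(x)\,\psi\big(y+[(\varepsilon_j^2x_0,\varepsilon_j\mathbf x)]\big),$$ and $Q_j=Q^{(1)}\cdots Q^{(j)}:\mathcal H_j\to\mathcal H_0$. For $a>0$ let $$\mathfrak Q_n=a\Big(1+\sum_{j=1}^{n-1}L^{-2j}Q_jQ_j^*\Big)^{-1}:\mathcal H_0\to\mathcal H_0 .$$ Differential operator. Let $\mathbf h_0$ be a translation invariant operator on $L^2(\mathbb Z^3)$, with kernel $h(\mathbf x-\mathbf y)$, whose Fourier transform $\hat{\mathbf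 h}_0(\mathbf p)=\sum_{\mathbf x}h(\mathbf x)e^{-i\mathbf p\cdot\mathbf x}$ extends to an entire function on $\mathbb C^3$ that is invariant under $\mathbf p_\nu\to-\mathbf p_\nu$ for each $\nu=1,2,3$, is real and nonnegative for real $\mathbf p$ and strictly positive for $\mathbf p\in\mathbb R^3\setminus2\pi\mathbb Z^3$, vanishes together with its first derivatives at $\mathbf p=0$, and has a strictly positive definite matrix of second derivatives at $\mathbf p=0$. Let $h_0$ be its periodization to $\mathbb Z^3/L_{\rm sp}\mathbb Z^3$ and $$D_n=L^{2n}\,\mathbb L_*^{-n}\big(1-e^{-h_0}-e^{-h_0}\partial_0\big)\mathbb L_*^{n}:\mathcal H_n\to\mathcal H_n ,$$ where $(\partial_0\alpha)(x)=\alpha(x+e_0)-\alpha(x)$ on functions on $(\mathbb Z/L_{\rm tp}\mathbb Z)\times(\mathbb Z^3/L_{\rm sp}\mathbb Z^3)$, $h_0$ acts on the spatial variables, and $\mathbb L_*^n$ maps $\alpha\in\mathcal H_n$ to the function $(L^{2n}u_0,L^n\mathbf u)\mapsto\alpha(u_0,\mathbf u)$ on that lattice. Finally let $$S_n=\big(D_n+Q_n^*\mathfrak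 Q_nQ_n\big)^{-1}.$$ Statement. There is a constant $\Gamma_2$, depending only on $\mathfrak q$, and for all $a>0$ and $\mathbf h_0$ as above there are constants $m_6>0$ and $\Gamma_{14}$, depending only on $\mathfrak q$, $a$ and $\mathbf h_0$, such that for all odd $L>\Gamma_2$, all $n\ge1$ and all positive integers $T,S$: the operators $1+\sum_{j=1}^{n-1}L^{-2j}Q_jQ_j^*$ and $D_n+Q_n^*\mathfrak Q_nQ_n$ are invertible (so that $\mathfrak Q_n$ and $S_n$ are defined), $$\big|(S_nQ_n^*)(y,x)\big|\le\Gamma_{14}\,e^{-2m_6|x-y|}\quad\text{for all }y\in\mathcal X_n,\ x\in\mathcal X_0,\qquad\text{and}\qquad \|S_nQ_n^*\|_{m_6}\le\Gamma_{14}.$$ -/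

import Mathlib

open scoped Kronecker

noncomputable section

namespace ParabolicBlockSpin

/-! ### Lattices

The number `n` of block spin steps is fixed, and the periods of the torus are
`L_tp = L ^ (2 * n) * T` in time and `L_sp = L ^ n * S` in space. All the lattices
`X_0^{(n)} ⊂ X_1^{(n-1)} ⊂ ... ⊂ X_n^{(0)} = X_n` then lie in the torus
`(ℝ / T ℤ) × (ℝ / S ℤ) ^ 3`. -/

/-- The lattice `X_j^{(n-j)} = (ε_j² ℤ / T ℤ) × (ε_j ℤ / S ℤ)³`, with `ε_j = L ^ (-j)`.
The label `(t, s)` stands for the point `(ε_j² t, ε_j s)`.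
In terms of labels the scaling map `(u₀, u) ↦ (L² u₀, L u)` is the identity, so that conjugating
an operator with powers of the scaling map does not change its matrix. -/
abbrev Lattice (L T S j : ℕ) : Type :=
  ZMod (L ^ (2 * j) * T) × (Fin 3 → ZMod (L ^ j * S))

/-- The time coordinate of a lattice point, in `ℝ / T ℤ`. -/
def timePos (L T S j : ℕ) (u : Lattice L T S j) : AddCircle (T : ℝ) :=
  (((u.1.val : ℝ) / (L : ℝ) ^ (2 * j) : ℝ) : AddCircle (T : ℝ))

/-- The space coordinates of a lattice point, in `ℝ / S ℤ`. -/
def spacePos (L T S j : ℕ) (u : Lattice L T S j) (i : Fin 3) : AddCircle (S : ℝ) :=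
  ((((u.2 i).val : ℝ) / (L : ℝ) ^ j : ℝ) : AddCircle (S : ℝ))

/-- The Euclidean distance `|u - v|` in the torus between a point of the `j`-th lattice and a
point of the `k`-th lattice (the length of the smallest representative of `u - v`). -/
def torusDist (L T S j k : ℕ) (u : Lattice L T S j) (v : Lattice L T S k) : ℝ :=
  Real.sqrt (‖timePos L T S j u - timePos L T S k v‖ ^ 2 +
    ∑ i, ‖spacePos L T S j u i - spacePos L T S k v i‖ ^ 2)

/-- The inclusion of the `j`-th lattice in the next finer one: `ε_j² t = ε_{j+1}² (L² t)` and
`ε_j s = ε_{j+1} (L s)`. -/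
def embed (L T S j : ℕ) (u : Lattice L T S j) : Lattice L T S (j + 1) :=
  (((L ^ 2 * u.1.val : ℕ) : ZMod (L ^ (2 * (j + 1)) * T)),
    fun i => ((L * (u.2 i).val : ℕ) : ZMod (L ^ (j + 1) * S)))

/-- The class `[x]` of `x ∈ ℤ × ℤ³`, scaled down to the `j`-th lattice. -/
def latClass (L T S j : ℕ) (x : ℤ × (Fin 3 → ℤ)) : Lattice L T S j :=
  ((x.1 : ZMod (L ^ (2 * j) * T)), fun i => (x.2 i : ZMod (L ^ j * S)))

/-! ### Operators between the spaces of functions on the lattices -/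

/-- Linear operators from functions on the `j`-th lattice to functions on the `k`-th lattice,
as matrices: `(A α)(u) = ∑ u', A u u' * α u'`. -/
abbrev Operator (L T S j k : ℕ) : Type := Matrix (Lattice L T S k) (Lattice L T S j) ℂ

/-- The real inner product `⟨α, β⟩_j = ε_j⁵ ∑_u α(u) β(u)`. -/
def realInner (L T S j : ℕ) [NeZero L] [NeZero T] [NeZero S]
    (α β : Lattice L T S j → ℂ) : ℂ :=
  ((L : ℂ) ^ (5 * j))⁻¹ * ∑ u, α u * β u

/-- The adjoint of an operator with respect to the real inner products. -/
def adjoint (L T S j k : ℕ) (A : Operator L T S j k) : Operator L T S k j :=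
  ((L : ℂ) ^ (5 * j) / (L : ℂ) ^ (5 * k)) • A.transpose

theorem realInner_adjoint (L T S j k : ℕ) [NeZero L] [NeZero T] [NeZero S]
    (A : Operator L T S j k) (α : Lattice L T S j → ℂ) (β : Lattice L T S k → ℂ) :
    realInner L T S k (A.mulVec α) β = realInner L T S j α ((adjoint L T S j k A).mulVec β) := by
  have hL : (L : ℂ) ≠ 0 := Nat.cast_ne_zero.mpr (NeZero.ne L)
  simp only [realInner, adjoint, Matrix.mulVec, dotProduct, Matrix.smul_apply,
    Matrix.transpose_apply, smul_eq_mul, Finset.sum_mul, Finset.mul_sum]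
  rw [Finset.sum_comm]
  refine Finset.sum_congr rfl fun u _ => Finset.sum_congr rfl fun v _ => ?_
  field_simp

/-- The kernel `A(u, u')` of an operator, defined by `(A α)(u) = ε_j⁵ ∑_{u'} A(u, u') α(u')`. -/
def kernel (L T S j k : ℕ) (A : Operator L T S j k) (u : Lattice L T S k)
    (u' : Lattice L T S j) : ℂ :=
  (L : ℂ) ^ (5 * j) * A u u'

/-- The norm `‖A‖_m`: the larger of `sup_u ε_j⁵ ∑_{u'} e^{m|u-u'|} |A(u,u')|` and
`sup_{u'} ε_k⁵ ∑_u e^{m|u-u'|} |A(u,u')|`. -/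
def massNorm (L T S j k : ℕ) [NeZero L] [NeZero T] [NeZero S] (m : ℝ)
    (A : Operator L T S j k) : ℝ :=
  max
    (⨆ u : Lattice L T S k, ((L : ℝ) ^ (5 * j))⁻¹ *
      ∑ u' : Lattice L T S j, Real.exp (m * torusDist L T S k j u u') *
        ‖kernel L T S j k A u u'‖)
    (⨆ u' : Lattice L T S j, ((L : ℝ) ^ (5 * k))⁻¹ *
      ∑ u : Lattice L T S k, Real.exp (m * torusDist L T S k j u u') *
        ‖kernel L T S j k A u u'‖)

/-! ### Block spin averaging -/

/-- The integer points of
`[-(L²-1)/2, (L²-1)/2] × [-(L-1)/2, (L-1)/2]³` (for odd `L`). -/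
def box (L : ℕ) : Finset (ℤ × (Fin 3 → ℤ)) :=
  Finset.Icc (-(((L : ℤ) ^ 2 - 1) / 2)) (((L : ℤ) ^ 2 - 1) / 2) ×ˢ
    Fintype.piFinset fun _ => Finset.Icc (-(((L : ℤ) - 1) / 2)) (((L : ℤ) - 1) / 2)

/-- The `k`-fold convolution on `ℤ × ℤ³` of the characteristic function of the box with itself;
the `0`-fold convolution is the unit mass at the origin. -/
def boxConv (L : ℕ) : ℕ → (ℤ × (Fin 3 → ℤ)) → ℝ
  | 0 => Pi.single 0 1
  | k + 1 => fun x => ∑ y ∈ box L, boxConv L k (x - y)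

/-- The averaging profile `q = L^{-5𝔮} 1_□ * ... * 1_□` (`𝔮` factors). -/
def profile (𝔮 L : ℕ) (x : ℤ × (Fin 3 → ℤ)) : ℝ :=
  ((L : ℝ) ^ (5 * 𝔮))⁻¹ * boxConv L 𝔮 x

/-- The averaging operator `Q^{(j+1)}` from functions on the `(j+1)`-st lattice to functions on
the `j`-th lattice, `(Q^{(j+1)} ψ)(y) = ∑_{x ∈ ℤ × ℤ³} q(x) ψ(y + [x])`, where `[x]` is the class
of the lattice vector with label `x`. -/
def avgStep (𝔮 L T S j : ℕ) : Operator L T S (j + 1) j :=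
  fun y w => ∑' x : ℤ × (Fin 3 → ℤ),
    if embed L T S j y + latClass L T S (j + 1) x = w then ((profile 𝔮 L x : ℝ) : ℂ) else 0

/-- `Q_n = Q^{(1)} ⋯ Q^{(n)}`. -/
def avg (𝔮 L T S : ℕ) [NeZero L] [NeZero T] [NeZero S] : (n : ℕ) → Operator L T S n 0
  | 0 => 1
  | n + 1 => avg 𝔮 L T S n * avgStep 𝔮 L T S n

/-- `1 + ∑_{j=1}^{n-1} L^{-2j} Q_j Q_j^*`. -/
def avgGram (𝔮 L T S : ℕ) [NeZero L] [NeZero T] [NeZero S] (n : ℕ) : Operator L T S 0 0 :=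
  1 + ∑ j ∈ Finset.Icc 1 (n - 1), ((L : ℂ) ^ (2 * j))⁻¹ •
    (avg 𝔮 L T S j * adjoint L T S j 0 (avg 𝔮 L T S j))

/-- `𝔔_n = a (1 + ∑_{j=1}^{n-1} L^{-2j} Q_j Q_j^*)^{-1}`. -/
def frakQ (𝔮 L T S : ℕ) [NeZero L] [NeZero T] [NeZero S] (a : ℝ) (n : ℕ) :
    Operator L T S 0 0 :=
  (a : ℂ) • (avgGram 𝔮 L T S n)⁻¹

/-! ### The differential operator -/

/-- `h` is the kernel `𝐡₀(x, y) = h (x - y)` of a translation invariant operator on functions on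
`ℤ³`, its Fourier transform `∑_x h(x) e^{-i p·x}` is the restriction to real `p` of the
entire function `hhat`, and `hhat` has the properties of a (scaled) single particle
Hamiltonian. -/
structure IsHamiltonian (h : (Fin 3 → ℤ) → ℂ) (hhat : (Fin 3 → ℂ) → ℂ) : Prop where
  fourier : ∀ p : Fin 3 → ℝ,
    HasSum (fun x : Fin 3 → ℤ => h x * Complex.exp (-Complex.I * ∑ i, (p i : ℂ) * (x i : ℂ)))
      (hhat fun i => (p i : ℂ))
  entire : Differentiable ℂ hhat
  even : ∀ (ν : Fin 3) (p : Fin 3 → ℂ), hhat (Function.update p ν (-p ν)) = hhat p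
  nonneg : ∀ p : Fin 3 → ℝ, (hhat fun i => (p i : ℂ)).im = 0 ∧ 0 ≤ (hhat fun i => (p i : ℂ)).re
  pos : ∀ p : Fin 3 → ℝ, (¬ ∃ z : Fin 3 → ℤ, ∀ i, p i = 2 * Real.pi * z i) →
    0 < (hhat fun i => (p i : ℂ)).re
  zero : hhat 0 = 0
  gradient : ∀ ν : Fin 3, fderiv ℂ hhat 0 (Pi.single ν 1) = 0
  hessian : (Matrix.of fun μ ν : Fin 3 =>
    (fderiv ℂ (fun p => fderiv ℂ hhat p (Pi.single ν 1)) 0 (Pi.single μ 1)).re).PosDef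

/-- The periodization `h₀` to `(ℤ / N ℤ)³` of the translation invariant operator with
kernel `h (x - y)`: its kernel is `h₀([x], [y]) = ∑_{z ∈ N ℤ³} h (x - y + z)`. -/
def periodization (N : ℕ) (h : (Fin 3 → ℤ) → ℂ) :
    Matrix (Fin 3 → ZMod N) (Fin 3 → ZMod N) ℂ :=
  fun x y => ∑' z : Fin 3 → ℤ, if (fun i => (z i : ZMod N)) = x - y then h z else 0

/-- The forward time derivative in units of the lattice spacing,
`(∂₀ α)(t, s) = α(t + 1, s) - α(t, s)` in terms of labels. -/
def forwardDiff (L T S n : ℕ) : Operator L T S n n :=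
  fun u v => (if ((u.1 + 1, u.2) : Lattice L T S n) = v then 1 else 0) - (if u = v then 1 else 0)

/-- `e^{-h₀}`, acting on functions on the `n`-th lattice through their dependence on the space
labels, which run over `ℤ³ / L_sp ℤ³` with `L_sp = L ^ n * S`. -/
def expNegH (L T S n : ℕ) [NeZero L] [NeZero T] [NeZero S] (h : (Fin 3 → ℤ) → ℂ) :
    Operator L T S n n :=
  (1 : Matrix (ZMod (L ^ (2 * n) * T)) (ZMod (L ^ (2 * n) * T)) ℂ) ⊗ₖ
    NormedSpace.exp (-periodization (L ^ n * S) h)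

/-- `D_n = L^{2n} 𝕃_*^{-n} (1 - e^{-h₀} - e^{-h₀} ∂₀) 𝕃_*^n` on functions on `X_n`. -/
def diffOp (L T S n : ℕ) [NeZero L] [NeZero T] [NeZero S] (h : (Fin 3 → ℤ) → ℂ) :
    Operator L T S n n :=
  ((L : ℂ) ^ (2 * n)) •
    (1 - expNegH L T S n h - expNegH L T S n h * forwardDiff L T S n)

/-! ### The Green's function -/

/-- `D_n + Q_n^* 𝔔_n Q_n`. -/
def greenInv (𝔮 L T S : ℕ) [NeZero L] [NeZero T] [NeZero S] (a : ℝ) (h : (Fin 3 → ℤ) → ℂ)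
    (n : ℕ) : Operator L T S n n :=
  diffOp L T S n h +
    adjoint L T S n 0 (avg 𝔮 L T S n) * frakQ 𝔮 L T S a n * avg 𝔮 L T S n

/-- `S_n = (D_n + Q_n^* 𝔔_n Q_n)^{-1}`. -/
def green (𝔮 L T S : ℕ) [NeZero L] [NeZero T] [NeZero S] (a : ℝ) (h : (Fin 3 → ℤ) → ℂ)
    (n : ℕ) : Operator L T S n n :=
  (greenInv 𝔮 L T S a h n)⁻¹

/-- `S_n Q_n^*`, from functions on `X_0^{(n)}` to functions on `X_n`. -/
def greenAvgAdj (𝔮 L T S : ℕ) [NeZero L] [NeZero T] [NeZero S] (a : ℝ) (h : (Fin 3 → ℤ) → ℂ)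
    (n : ℕ) : Operator L T S 0 n :=
  green 𝔮 L T S a h n * adjoint L T S n 0 (avg 𝔮 L T S n)

end ParabolicBlockSpin

end

noncomputable section

namespace ParabolicBlockSpin

/-! ### Bounds for `1 - e^{-w}` -/

/-! All operators commute with translations by the unit lattice, so the problem decouples into
fibers indexed by the momenta `k` of the unit lattice; the fiber over `k` is spanned by the plane
waves with momenta `k + 2πℓ`, `ℓ ∈ shifts (scale L n)`. On these, `D_n` acts by a scalar D
(`diffSymbol`), `Q_n` multiplies by a scalar u (`avgSymbol`) and identifies all waves of the fiber,
and `𝔔_n` is the scalar a/g with g = `gramSymbol`. Hence `D_n + Q_n^* 𝔔_n Q_n` is, fiber by fiber, a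
diagonal matrix plus one of rank one, and the Sherman–Morrison formula gives the coefficient of `S_n
Q_n^* e_k` at `k + 2πℓ` as (g/a) u(k+2πℓ) D(k+2πℓ)⁻¹ / (g/a + ∑_ℓ' u(k+2πℓ')² D(k+2πℓ')⁻¹). Since
D(0) = 0, numerator and denominator are both multiplied by D(k); the results are `greenSymbol` and
`greenDenom`, which are regular at k = 0.

The analytic core is `exists_greenSymbol_bounds`: in a complex neighbourhood of the zone |k_ν| ≤ π,
of a size independent of L, n, T and S, the denominator stays away from 0 and the coefficients are
absolutely summable over ℓ. It rests on three facts. First, u decays like a negative power of 1 +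
|ℓ_ν| in every direction and is bounded below near ℓ = 0 (`exists_norm_dirichlet_le`,
`half_le_dirichletReal`). Second, D has nonnegative real part at real momenta, and is bounded below
in a complex neighbourhood of every real momentum outside the central zone
(`exists_diffSymbol_bounds`). Third, u is real at real momenta, so the sum in the denominator has
nonnegative real part there.

The kernel of `S_n Q_n^*` is then the average over the discrete momenta k of `greenFiber`, a
function that is analytic and bounded in a strip in each variable and 2π-periodic when the other
variables are real. Shifting the contour and Poisson summation (`norm_discrete_fourier_le`) give
exponential decay in each coordinate of the displacement, measured on the torus and uniformly in its
periods. Using the largest coordinate gives decay in the full distance, and giving up half of the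
rate makes the weighted integrals converge. -/

theorem exists_mul_norm_le_norm_one_sub_exp_neg (R : ℝ) :
    ∃ c : ℝ, 0 < c ∧ ∀ w : ℂ, ‖w‖ ≤ R → |w.im| ≤ Real.pi + 1 →
      c * ‖w‖ ≤ ‖1 - Complex.exp (-w)‖ := by
  set f : ℂ → ℂ := fun w => 1 - Complex.exp (-w) with hf
  have hfd : Differentiable ℂ f := by fun_prop
  -- The quotient (1 - e^{-w})/w, with value 1 at 0, is entire. Its zeros are the nonzero multiples
  -- of 2πi, which the condition |Im w| ≤ π + 1 < 2π excludes, so compactness yields the constant.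
  set g : ℂ → ℂ := dslope f 0 with hg
  have hgc : Continuous g := by
    rw [continuous_iff_continuousAt]
    intro w
    have := ((Complex.differentiableOn_dslope (f := f) (s := Set.univ) (c := 0)
      Filter.univ_mem).mpr hfd.differentiableOn).differentiableAt (x := w) Filter.univ_mem
    exact this.continuousAt
  have hd0 : deriv f 0 = 1 := by
    have : HasDerivAt f (-(Complex.exp (-(0:ℂ)) * (-1))) 0 := by
      have h1 : HasDerivAt (fun w : ℂ => -w) (-1) 0 := (hasDerivAt_id (0:ℂ)).neg
      exact (h1.cexp).const_sub 1
    rw [this.deriv]; simp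
  have hgne : ∀ w : ℂ, |w.im| ≤ Real.pi + 1 → g w ≠ 0 := by
    intro w hw h0
    by_cases hw0 : w = 0
    · subst hw0
      simp [hg, dslope_same, hd0] at h0
    · rw [hg, dslope_of_ne _ hw0, slope_def_field] at h0
      have h1 : f w = 0 := by
        have h2 : f 0 = 0 := by simp [hf]
        rw [h2] at h0
        simpa [hw0] using h0
      have h2 : Complex.exp (-w) = 1 := by
        simp only [hf] at h1
        linear_combination -h1
      rw [Complex.exp_eq_one_iff] at h2
      obtain ⟨n, hn⟩ := h2
      have h3 : w = ((-n * (2 * Real.pi) : ℝ) : ℂ) * Complex.I := by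
        push_cast; linear_combination -hn
      have h4 : w.im = -n * (2 * Real.pi) := by rw [h3]; simp
      have hn0 : n ≠ 0 := by
        rintro rfl; apply hw0; rw [h3]; simp
      have h5 : (1:ℝ) ≤ |(n:ℝ)| := by exact_mod_cast Int.one_le_abs hn0
      rw [h4, abs_mul, abs_neg, abs_of_pos Real.two_pi_pos] at hw
      nlinarith [Real.pi_gt_three]
  have hK : IsCompact (Metric.closedBall (0:ℂ) R ∩ {w : ℂ | |w.im| ≤ Real.pi + 1}) :=
    (isCompact_closedBall 0 R).inter_right
      (isClosed_le (by fun_prop) continuous_const)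
  obtain ⟨c, hc, hcb⟩ := hK.exists_forall_le' (f := fun w => ‖g w‖) (a := 0)
    hgc.norm.continuousOn (fun w hw => norm_pos_iff.mpr (hgne w hw.2))
  refine ⟨c, hc, fun w hwR hwi => ?_⟩
  have h1 := hcb w ⟨by simpa using hwR, hwi⟩
  have h2 : f w = w * g w := by
    have := sub_smul_dslope f 0 w
    simp [hf] at this
    simp [hf, hg, this]
  have h3 : ‖1 - Complex.exp (-w)‖ = ‖w‖ * ‖g w‖ := by
    rw [← norm_mul, ← h2]
  rw [h3, mul_comm]
  gcongr

theorem norm_one_sub_exp_neg_le (R : ℝ) (w : ℂ) (hw : ‖w‖ ≤ R) :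
    ‖1 - Complex.exp (-w)‖ ≤ Real.exp R * ‖w‖ := by
  have h : ∀ z ∈ Metric.closedBall (0:ℂ) R,
      HasDerivWithinAt (fun z : ℂ => 1 - Complex.exp (-z)) (Complex.exp (-z))
        (Metric.closedBall (0:ℂ) R) z := by
    intro z _
    have h1 : HasDerivAt (fun w : ℂ => -w) (-1) z := (hasDerivAt_id z).neg
    have h2 := (h1.cexp).const_sub 1
    simp only [mul_neg, mul_one, neg_neg] at h2
    exact h2.hasDerivWithinAt
  have hR : 0 ≤ R := (norm_nonneg _).trans hw
  have := (convex_closedBall (0:ℂ) R).norm_image_sub_le_of_norm_hasDerivWithin_le (C := Real.exp R)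
    h (fun z hz => by
      rw [Complex.norm_exp]
      apply Real.exp_le_exp.mpr
      have : ‖z‖ ≤ R := by simpa using hz
      exact (Complex.re_le_norm _).trans (by simpa using this))
    (x := 0) (y := w) (by simpa using hR) (by simpa using hw)
  simpa using this

/-! ### Bounds for the single particle Hamiltonian -/

namespace IsHamiltonian

variable {h : (Fin 3 → ℤ) → ℂ} {hhat : (Fin 3 → ℂ) → ℂ}

theorem fderiv_zero (H : IsHamiltonian h hhat) : fderiv ℂ hhat 0 = 0 := by
  apply ContinuousLinearMap.coe_injective
  apply LinearMap.pi_ext'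
  intro ν
  ext
  simpa using H.gradient ν

/-- Schwarz lemma of second order: value and derivative vanish at 0, and compactness bounds the
function on a slightly larger ball. The summand 1 in the constant only ensures that it is positive.
-/
theorem exists_norm_le_sq (H : IsHamiltonian h hhat) (R : ℝ) :
    ∃ C : ℝ, 0 < C ∧ ∀ q : Fin 3 → ℂ, ‖q‖ ≤ R → ‖hhat q‖ ≤ C * ‖q‖ ^ 2 := by
  obtain ⟨B, hB⟩ := (isCompact_closedBall (0 : Fin 3 → ℂ) (|R| + 1)).exists_bound_of_continuousOn
    H.entire.continuous.continuousOn
  have hr : (0:ℝ) < |R| + 1 := by positivity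
  have hB0 : 0 ≤ B := (norm_nonneg _).trans (hB 0 (by simpa using hr.le))
  refine ⟨B / (|R| + 1) ^ 2 + 1, by positivity, fun q hq => ?_⟩
  have h0 : (fun w => hhat w - hhat 0) =o[nhds 0] fun w : Fin 3 → ℂ => ‖w - 0‖ ^ 1 := by
    have := (H.entire 0).hasFDerivAt.isLittleO
    rw [H.fderiv_zero] at this
    simpa using this.norm_right
  have := Complex.dist_le_mul_div_pow_of_mapsTo_ball_of_isLittleO (f := hhat) (c := 0)
    (R₁ := |R| + 1) (R₂ := B) (n := 1) (z := q) H.entire.differentiableOn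
    (fun z hz => by
      rw [H.zero]
      simpa using hB z (Metric.ball_subset_closedBall hz)) h0
    (by simpa using lt_of_le_of_lt (hq.trans (le_abs_self R)) (lt_add_one _))
  rw [H.zero] at this
  simp only [dist_zero_right, Nat.reduceAdd] at this
  calc ‖hhat q‖ ≤ B * (‖q‖ / (|R| + 1)) ^ 2 := this
    _ = B / (|R| + 1) ^ 2 * ‖q‖ ^ 2 := by rw [div_pow]; ring
    _ ≤ _ := by gcongr; linarith

/-- The factor ‖q‖ + ‖w‖ is the point. For `q = p / M` and a displacement `w` of order 1/M,
multiplication by M² leaves a change that grows only linearly in p, whereas the Hamiltonian itself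
grows quadratically. -/
theorem exists_norm_sub_le (H : IsHamiltonian h hhat) (R : ℝ) :
    ∃ C : ℝ, 0 < C ∧ ∀ q w : Fin 3 → ℂ, ‖q‖ ≤ R → ‖w‖ ≤ 1 →
      ‖hhat (q + w) - hhat q‖ ≤ C * ‖w‖ * (‖q‖ + ‖w‖) := by
  obtain ⟨C, hC, hb⟩ := H.exists_norm_le_sq (2 * R + 2)
  refine ⟨8 * C, by positivity, fun q w hq hw => ?_⟩
  rcases eq_or_ne w 0 with rfl | hw0
  · simp
  have hwp : 0 < ‖w‖ := norm_pos_iff.mpr hw0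
  -- A ball whose radius is comparable to ‖q‖ + ‖w‖: the quadratic bound on it, divided by this
  -- radius, leaves exactly one power of ‖q‖ + ‖w‖.
  set ρ := ‖q‖ + 2 * ‖w‖ with hρ
  have hρ0 : 0 < ρ := by positivity
  have hbd : ∀ z ∈ Metric.ball q ρ, ‖hhat z‖ ≤ C * (2 * (‖q‖ + ‖w‖)) ^ 2 := by
    intro z hz
    have h1 : ‖z‖ ≤ 2 * (‖q‖ + ‖w‖) := by
      have h2 : ‖z - q‖ < ρ := by simpa [dist_eq_norm] using hz
      have h3 : ‖z‖ ≤ ‖z - q‖ + ‖q‖ := by simpa using norm_add_le (z - q) q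
      linarith
    refine (hb z (by linarith)).trans ?_
    gcongr
  have := Complex.dist_le_div_mul_dist_of_mapsTo_ball (f := hhat) (c := q) (z := q + w)
    (R₁ := ρ) (R₂ := 2 * (C * (2 * (‖q‖ + ‖w‖)) ^ 2)) H.entire.differentiableOn
    (fun z hz => by
      rw [Metric.mem_closedBall, dist_eq_norm]
      have h1 := hbd z hz
      have h2 := hbd q (by simpa using hρ0)
      linarith [norm_sub_le (hhat z) (hhat q)])
    (by simp [hρ]; linarith [norm_nonneg q])
  rw [dist_eq_norm, dist_eq_norm] at this
  simp only [add_sub_cancel_left] at this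
  refine this.trans ?_
  rw [div_mul_eq_mul_div, div_le_iff₀ hρ0]
  have : 0 ≤ C * ‖w‖ * (‖q‖ + ‖w‖) * ‖w‖ := by positivity
  nlinarith

theorem re_hessian_lower {A : Matrix (Fin 3) (Fin 3) ℝ} (hA : A.PosDef) :
    ∃ c : ℝ, 0 < c ∧ ∀ q : Fin 3 → ℝ, c * ‖q‖ ^ 2 ≤ ∑ ν, ∑ μ, q ν * q μ * A μ ν := by
  set Q : (Fin 3 → ℝ) → ℝ := fun q => ∑ ν, ∑ μ, q ν * q μ * A μ ν with hQ
  have hpos : ∀ q ≠ 0, 0 < Q q := by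
    intro q hq
    have := hA.dotProduct_mulVec_pos hq
    simp only [star_trivial, dotProduct, Matrix.mulVec] at this
    rw [hQ]
    have h2 : ∑ ν, ∑ μ, q ν * q μ * A μ ν = ∑ x, q x * ∑ y, A x y * q y := by
      rw [Finset.sum_comm]
      refine Finset.sum_congr rfl fun i _ => ?_
      rw [Finset.mul_sum]
      exact Finset.sum_congr rfl fun j _ => by ring
    exact lt_of_lt_of_eq this h2.symm
  obtain ⟨c, hc, hcb⟩ := (isCompact_sphere (0 : Fin 3 → ℝ) 1).exists_forall_le' (f := Q) (a := 0)
    (by simp only [hQ]; fun_prop)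
    (fun q hq => hpos q (by rintro rfl; simp at hq))
  refine ⟨c, hc, fun q => ?_⟩
  rcases eq_or_ne q 0 with rfl | hq
  · simp
  have hn : 0 < ‖q‖ := norm_pos_iff.mpr hq
  have h1 := hcb (‖q‖⁻¹ • q) (by simp [norm_smul, hn.ne'])
  have h2 : Q (‖q‖⁻¹ • q) = (‖q‖ ^ 2)⁻¹ * Q q := by
    simp only [hQ, Pi.smul_apply, smul_eq_mul, Finset.mul_sum]
    refine Finset.sum_congr rfl fun i _ => Finset.sum_congr rfl fun j _ => ?_
    field_simp
  rw [h2, inv_mul_eq_div, le_div_iff₀ (by positivity)] at h1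
  exact h1

end IsHamiltonian

namespace IsHamiltonian

variable {h : (Fin 3 → ℤ) → ℂ} {hhat : (Fin 3 → ℂ) → ℂ}

theorem norm_ofReal_pi (q : Fin 3 → ℝ) : ‖(fun i => (q i : ℂ))‖ = ‖q‖ := by
  apply le_antisymm
  · refine (pi_norm_le_iff_of_nonneg (norm_nonneg _)).mpr fun i => ?_
    simpa using norm_le_pi_norm q i
  · refine (pi_norm_le_iff_of_nonneg (norm_nonneg _)).mpr fun i => ?_
    simpa using norm_le_pi_norm (fun i => (q i : ℂ)) i

/-- Taylor expansion along the ray t ↦ t q: the derivative of the real part is at least (c/2) t ‖q‖²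
close to the origin, by positivity of the Hessian, and integrating from 0 to 1 gives c/4. -/
theorem exists_local_lower (H : IsHamiltonian h hhat) :
    ∃ c : ℝ, 0 < c ∧ ∃ r : ℝ, 0 < r ∧ ∀ q : Fin 3 → ℝ, ‖q‖ < r →
      c * ‖q‖ ^ 2 ≤ (hhat fun i => (q i : ℂ)).re := by
  set A : Matrix (Fin 3) (Fin 3) ℝ := Matrix.of fun μ ν : Fin 3 =>
    (fderiv ℂ (fun p => fderiv ℂ hhat p (Pi.single ν 1)) 0 (Pi.single μ 1)).re with hA
  obtain ⟨c, hc, hcA⟩ := re_hessian_lower H.hessian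
  set D : Fin 3 → (Fin 3 → ℂ) → ℂ := fun ν p => fderiv ℂ hhat p (Pi.single ν 1) with hD
  -- If `D ν` were not differentiable, `fderiv` would take its default value 0, contradicting
  -- positivity of the diagonal entry of the Hessian.
  have hdiff : ∀ ν, DifferentiableAt ℂ (D ν) 0 := by
    intro ν
    by_contra hcon
    have h1 : 0 < A ν ν := H.hessian.diag_pos
    have h2 : fderiv ℂ (D ν) 0 = 0 := fderiv_zero_of_not_differentiableAt hcon
    have h3 : A ν ν = (fderiv ℂ (D ν) 0 (Pi.single ν 1)).re := rfl
    rw [h3, h2] at h1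
    simp at h1
  -- An error c/6 for each of the three components uses up half of the Hessian bound c.
  have hlo : ∀ᶠ p in nhds (0 : Fin 3 → ℂ), ∀ ν,
      ‖D ν p - fderiv ℂ (D ν) 0 p‖ ≤ c / 6 * ‖p‖ := by
    rw [Filter.eventually_all]
    intro ν
    have h1 := (hdiff ν).hasFDerivAt.isLittleO
    have h2 := h1.def (show (0:ℝ) < c / 6 by positivity)
    filter_upwards [h2] with p hp
    have h0 : D ν 0 = 0 := H.gradient ν
    simpa [h0] using hp
  obtain ⟨r, hr, hball⟩ := Metric.eventually_nhds_iff_ball.mp hlo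
  refine ⟨c / 4, by positivity, r, hr, fun q hq => ?_⟩
  set qc : Fin 3 → ℂ := fun i => (q i : ℂ) with hqc
  have hqn : ‖qc‖ = ‖q‖ := norm_ofReal_pi q
  set ψ : ℝ → ℝ := fun t => (hhat ((t : ℂ) • qc)).re with hψ
  set ψ' : ℝ → ℝ := fun t => (fderiv ℂ hhat ((t : ℂ) • qc) qc).re with hψ'
  have hder : ∀ t : ℝ, HasDerivAt ψ (ψ' t) t := by
    intro t
    have h1 : HasDerivAt (fun z : ℂ => z • qc) qc (t : ℂ) := by
      simpa using (hasDerivAt_id (t : ℂ)).smul_const qc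
    have h2 := (H.entire ((t : ℂ) • qc)).hasFDerivAt.comp_hasDerivAt (t : ℂ) h1
    exact h2.real_of_complex
  have hψlow : ∀ t : ℝ, 0 ≤ t → t ≤ 1 → c / 2 * t * ‖q‖ ^ 2 ≤ ψ' t := by
    intro t ht0 ht1
    have hexp : qc = ∑ ν, (q ν : ℂ) • (Pi.single ν 1 : Fin 3 → ℂ) := by
      ext i
      simp [hqc, Pi.single_apply]
    have hlin : ∀ B : (Fin 3 → ℂ) →L[ℂ] ℂ, B qc = ∑ ν, (q ν : ℂ) * B (Pi.single ν 1) := by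
      intro B
      conv_lhs => rw [hexp, map_sum]
      simp
    have h1 : fderiv ℂ hhat ((t : ℂ) • qc) qc = ∑ ν, (q ν : ℂ) * D ν ((t : ℂ) • qc) := by
      exact hlin _
    have h2 : ∀ ν, fderiv ℂ (D ν) 0 ((t : ℂ) • qc)
        = (t : ℂ) * ∑ μ, (q μ : ℂ) * fderiv ℂ (D ν) 0 (Pi.single μ 1) := by
      intro ν
      rw [map_smul, hlin, smul_eq_mul]
    have htq : ‖(t : ℂ) • qc‖ ≤ t * ‖q‖ := by
      rw [norm_smul, hqn]; simp [abs_of_nonneg ht0]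
    have hin : (t : ℂ) • qc ∈ Metric.ball (0 : Fin 3 → ℂ) r := by
      simp only [Metric.mem_ball, dist_zero_right]
      nlinarith [norm_nonneg q]
    have h3 := hball _ hin
    have h4 : ∀ ν, q ν * (t * ∑ μ, q μ * A μ ν) - ‖q‖ * (c / 6 * (t * ‖q‖)) ≤
        ((q ν : ℂ) * D ν ((t : ℂ) • qc)).re := by
      intro ν
      have h5 : ((q ν : ℂ) * fderiv ℂ (D ν) 0 ((t : ℂ) • qc)).re
          = q ν * (t * ∑ μ, q μ * A μ ν) := by
        rw [h2 ν, Complex.re_ofReal_mul, Complex.re_ofReal_mul, Complex.re_sum]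
        simp [hA, hD]
      have h6 : ‖(q ν : ℂ) * D ν ((t : ℂ) • qc) - (q ν : ℂ) * fderiv ℂ (D ν) 0 ((t : ℂ) • qc)‖
          ≤ ‖q‖ * (c / 6 * (t * ‖q‖)) := by
        rw [← mul_sub, norm_mul]
        have := norm_le_pi_norm q ν
        refine mul_le_mul (by simpa using this) ((h3 ν).trans ?_) (norm_nonneg _) (norm_nonneg _)
        gcongr
      have h7 := (Complex.abs_re_le_norm _).trans h6
      rw [Complex.sub_re, h5] at h7
      linarith [(abs_le.mp h7).1]
    have h8 : ψ' t = ∑ ν, ((q ν : ℂ) * D ν ((t : ℂ) • qc)).re := by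
      simp only [hψ']; rw [h1, Complex.re_sum]
    rw [h8]
    have h9 := Finset.sum_le_sum fun ν (_ : ν ∈ Finset.univ) => h4 ν
    refine le_trans ?_ h9
    rw [Finset.sum_sub_distrib]
    have h10 : ∑ ν, q ν * (t * ∑ μ, q μ * A μ ν) = t * ∑ ν, ∑ μ, q ν * q μ * A μ ν := by
      simp only [Finset.mul_sum]
      exact Finset.sum_congr rfl fun i _ => Finset.sum_congr rfl fun j _ => by ring
    rw [h10]
    have h11 := mul_le_mul_of_nonneg_left (hcA q) ht0
    simp only [Finset.sum_const, Finset.card_univ, Fintype.card_fin, nsmul_eq_mul]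
    push_cast
    change _ ≤ t * ∑ ν, ∑ μ, q ν * q μ * A μ ν - _
    have h12 : t * (c * ‖q‖ ^ 2) ≤ t * ∑ ν, ∑ μ, q ν * q μ * A μ ν := h11
    nlinarith
  have hmono : MonotoneOn (fun t : ℝ => ψ t - c / 4 * ‖q‖ ^ 2 * t ^ 2) (Set.Icc 0 1) := by
    have hd : ∀ t : ℝ, HasDerivAt (fun t : ℝ => ψ t - c / 4 * ‖q‖ ^ 2 * t ^ 2)
        (ψ' t - c / 4 * ‖q‖ ^ 2 * (2 * t)) t := by
      intro t
      have := (hder t).sub (((hasDerivAt_pow 2 t)).const_mul (c / 4 * ‖q‖ ^ 2))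
      refine this.congr_deriv ?_
      norm_num
    refine monotoneOn_of_deriv_nonneg (convex_Icc 0 1)
      (fun t _ => (hd t).continuousAt.continuousWithinAt)
      (fun t _ => (hd t).differentiableAt.differentiableWithinAt) fun t ht => ?_
    rw [interior_Icc] at ht
    rw [(hd t).deriv]
    have := hψlow t ht.1.le ht.2.le
    linarith
  have := hmono (Set.left_mem_Icc.mpr zero_le_one) (Set.right_mem_Icc.mpr zero_le_one) zero_le_one
  simp only [hψ, Complex.ofReal_zero, zero_smul, H.zero, Complex.ofReal_one, one_smul] at this
  simp at this
  linarith

/-- In the supremum norm the ball of radius π is the Brillouin zone, and 0 is its only point of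
2πℤ³. Near 0 the Hessian gives the bound; on the remaining compact set positivity does. -/
theorem exists_re_lower (H : IsHamiltonian h hhat) :
    ∃ c : ℝ, 0 < c ∧ ∀ q : Fin 3 → ℝ, ‖q‖ ≤ Real.pi →
      c * ‖q‖ ^ 2 ≤ (hhat fun i => (q i : ℂ)).re := by
  obtain ⟨c₁, hc₁, r, hr, h1⟩ := H.exists_local_lower
  have hK : IsCompact (Metric.closedBall (0 : Fin 3 → ℝ) Real.pi ∩ {q | r ≤ ‖q‖}) :=
    (isCompact_closedBall 0 _).inter_right (isClosed_le continuous_const continuous_norm)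
  have hcont : Continuous fun q : Fin 3 → ℝ => (hhat fun i => (q i : ℂ)).re :=
    Complex.continuous_re.comp (H.entire.continuous.comp (by fun_prop))
  obtain ⟨c₂, hc₂, h2⟩ := hK.exists_forall_le' hcont.continuousOn (a := 0) (by
    rintro q ⟨hq1, hq2⟩
    apply H.pos
    rintro ⟨z, hz⟩
    have hz0 : ∀ i, z i = 0 := by
      intro i
      by_contra hne
      have h3 : (1:ℝ) ≤ |(z i:ℝ)| := by exact_mod_cast Int.one_le_abs hne
      have h4 : |q i| ≤ Real.pi := by
        have := norm_le_pi_norm q i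
        rw [Real.norm_eq_abs] at this
        exact this.trans (by simpa using hq1)
      rw [hz i, abs_mul, abs_of_pos Real.two_pi_pos] at h4
      nlinarith [Real.pi_pos]
    have h5 : q = 0 := by ext i; simp [hz i, hz0 i]
    rw [h5] at hq2
    simp at hq2
    linarith)
  have hpi := Real.pi_pos
  refine ⟨min c₁ (c₂ / Real.pi ^ 2), by positivity, fun q hq => ?_⟩
  by_cases hqr : ‖q‖ < r
  · refine le_trans ?_ (h1 q hqr)
    gcongr
    exact min_le_left _ _
  · have h3 := h2 q ⟨by simpa using hq, not_lt.mp hqr⟩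
    refine le_trans ?_ h3
    calc min c₁ (c₂ / Real.pi ^ 2) * ‖q‖ ^ 2 ≤ c₂ / Real.pi ^ 2 * Real.pi ^ 2 := by
          gcongr; exact min_le_right _ _
      _ = c₂ := by field_simp

/-! ### Periodicity of the Hamiltonian's symbol -/

theorem apply_real_add_two_pi (H : IsHamiltonian h hhat) (q : Fin 3 → ℝ) (i : Fin 3) :
    hhat (fun j => ((Function.update q i (q i + 2 * Real.pi) j : ℝ) : ℂ)) =
      hhat (fun j => (q j : ℂ)) := by
  refine (H.fourier _).unique ?_
  convert H.fourier q using 1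
  funext x
  congr 1
  rw [Complex.exp_eq_exp_iff_exists_int]
  refine ⟨-x i, ?_⟩
  have : ∑ j, ((Function.update q i (q i + 2 * Real.pi) j : ℝ) : ℂ) * (x j : ℂ)
      = ∑ j, ((q j : ℝ) : ℂ) * (x j : ℂ) + 2 * Real.pi * x i := by
    rw [← Finset.add_sum_erase _ _ (Finset.mem_univ i),
      ← Finset.add_sum_erase (Finset.univ) (fun j => ((q j : ℝ) : ℂ) * (x j : ℂ))
        (Finset.mem_univ i)]
    rw [Finset.sum_congr rfl (g := fun j => ((q j : ℝ) : ℂ) * (x j : ℂ)) (fun j hj => by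
      rw [Function.update_of_ne (Finset.ne_of_mem_erase hj)])]
    rw [Function.update_self]
    push_cast
    ring
  rw [this]
  push_cast
  ring

/-- Periodicity at real momenta is visible in the Fourier series; the identity theorem in one
variable carries it to complex values of that component. The other components stay real, which is
all that the contour shifts, made in one direction at a time, require. -/
theorem apply_update_add_two_pi (H : IsHamiltonian h hhat) (q : Fin 3 → ℝ) (i : Fin 3) (z : ℂ) :
    hhat (Function.update (fun j => (q j : ℂ)) i (z + 2 * Real.pi)) =
      hhat (Function.update (fun j => (q j : ℂ)) i z) := by
  have hu : ∀ w : ℂ, Differentiable ℂ fun z : ℂ =>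
      hhat (Function.update (fun j => (q j : ℂ)) i (z + w)) := by
    intro w
    apply H.entire.comp
    rw [differentiable_pi]
    intro j
    by_cases hj : j = i
    · subst hj; simp
    · simp [Function.update_of_ne hj]
  have h1 : (fun z : ℂ => hhat (Function.update (fun j => (q j : ℂ)) i (z + 2 * Real.pi))) =
      fun z : ℂ => hhat (Function.update (fun j => (q j : ℂ)) i (z + 0)) := by
    refine AnalyticOnNhd.eq_of_frequently_eq (𝕜 := ℂ) (z₀ := 0)
      (fun z _ => (hu (2 * Real.pi)).analyticAt z) (fun z _ => (hu 0).analyticAt z) ?_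
    have hreal : ∀ t : ℝ, hhat (Function.update (fun j => (q j : ℂ)) i ((t:ℂ) + 2 * Real.pi)) =
        hhat (Function.update (fun j => (q j : ℂ)) i ((t:ℂ) + 0)) := by
      intro t
      have := H.apply_real_add_two_pi (Function.update q i t) i
      convert this using 2
      · funext j
        by_cases hj : j = i
        · subst hj; simp
        · simp [Function.update_of_ne hj]
      · funext j
        by_cases hj : j = i
        · subst hj; simp
        · simp [Function.update_of_ne hj]
    -- Nonzero real points accumulating at 0, as the identity theorem demands.
    have ht : Filter.Tendsto (fun n : ℕ => (((1 / ((n:ℝ) + 1) : ℝ)) : ℂ)) Filter.atTop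
        (nhdsWithin 0 {0}ᶜ) := by
      rw [tendsto_nhdsWithin_iff]
      constructor
      · have := (Complex.continuous_ofReal.tendsto 0).comp
          (tendsto_one_div_add_atTop_nhds_zero_nat (𝕜 := ℝ))
        rw [Complex.ofReal_zero] at this
        exact this
      · refine Filter.Eventually.of_forall fun n => ?_
        simp only [Set.mem_compl_iff, Set.mem_singleton_iff, Complex.ofReal_eq_zero]
        positivity
    exact ht.frequently (Filter.Frequently.of_forall fun n => hreal _)
  have := congrFun h1 z
  simpa using this

end IsHamiltonian

/-! ### Residues and Dirichlet kernels -/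

/-- A complete system of residues modulo `N`, symmetric around `0` for odd `N`. -/
def residues (N : ℕ) : Finset ℤ :=
  Finset.Ico (-((N / 2 : ℕ) : ℤ)) ((N : ℤ) - ((N / 2 : ℕ) : ℤ))

theorem mem_residues {N : ℕ} {x : ℤ} :
    x ∈ residues N ↔ -((N / 2 : ℕ) : ℤ) ≤ x ∧ x < (N : ℤ) - ((N / 2 : ℕ) : ℤ) := by
  simp [residues]

theorem card_residues (N : ℕ) : (residues N).card = N := by
  simp only [residues, Int.card_Ico]; omega

theorem two_mul_abs_le_of_mem_residues {N : ℕ} {x : ℤ} (hx : x ∈ residues N) :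
    2 * |(x : ℝ)| ≤ N := by
  rw [mem_residues] at hx
  have : 2 * |x| ≤ N := by
    rcases abs_cases x with h | h <;> omega
  exact_mod_cast this

theorem two_mul_abs_le_of_mem_residues_odd {N : ℕ} (hN : Odd N) {x : ℤ} (hx : x ∈ residues N) :
    2 * |(x : ℝ)| ≤ N - 1 := by
  rw [mem_residues] at hx
  obtain ⟨m, rfl⟩ := hN
  have : 2 * |x| ≤ ((2 * m + 1 : ℕ) : ℤ) - 1 := by
    rcases abs_cases x with h | h <;> omega
  exact_mod_cast this

theorem neg_mem_residues {N : ℕ} (hN : Odd N) {x : ℤ} (hx : x ∈ residues N) :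
    -x ∈ residues N := by
  rw [mem_residues] at *
  obtain ⟨m, rfl⟩ := hN
  omega

theorem sum_residues_eq_sum_range {β : Type*} [AddCommMonoid β] (N : ℕ) (f : ℤ → β) :
    ∑ x ∈ residues N, f x = ∑ i ∈ Finset.range N, f ((i : ℤ) - ((N / 2 : ℕ) : ℤ)) := by
  symm
  refine Finset.sum_bij (fun i _ => (i : ℤ) - ((N / 2 : ℕ) : ℤ)) ?_ ?_ ?_ ?_
  · intro i hi
    rw [Finset.mem_range] at hi
    rw [mem_residues]; omega
  · intro i _ j _ hij
    omega
  · intro x hx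
    rw [mem_residues] at hx
    exact ⟨(x + ((N / 2 : ℕ) : ℤ)).toNat, by rw [Finset.mem_range]; omega, by omega⟩
  · intro i _; rfl

theorem zero_mem_residues {N : ℕ} (hN : N ≠ 0) : (0 : ℤ) ∈ residues N := by
  rw [mem_residues]; omega

/-- The normalized Dirichlet kernel, the Fourier transform of the uniform distribution on
`N⁻¹ • residues N`. -/
def dirichlet (N : ℕ) (p : ℂ) : ℂ :=
  (N : ℂ)⁻¹ * ∑ x ∈ residues N, Complex.exp (Complex.I * p * ((x : ℂ) / N))

theorem differentiable_dirichlet (N : ℕ) : Differentiable ℂ (dirichlet N) := by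
  unfold dirichlet; fun_prop

theorem dirichlet_add_two_pi_mul (N : ℕ) (p : ℂ) :
    dirichlet N (p + 2 * Real.pi * N) = dirichlet N p := by
  rcases eq_or_ne N 0 with rfl | hN
  · simp [dirichlet]
  have hN' : (N : ℂ) ≠ 0 := Nat.cast_ne_zero.mpr hN
  simp only [dirichlet]
  congr 1
  refine Finset.sum_congr rfl fun x _ => ?_
  rw [Complex.exp_eq_exp_iff_exists_int]
  exact ⟨x, by field_simp⟩

theorem dirichlet_eq_range (N : ℕ) (p : ℂ) :
    dirichlet N p = (N : ℂ)⁻¹ * (Complex.exp (-(Complex.I * p * (((N / 2 : ℕ) : ℂ) / N))) *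
      ∑ i ∈ Finset.range N, Complex.exp (Complex.I * p / N) ^ i) := by
  rw [dirichlet, sum_residues_eq_sum_range, Finset.mul_sum (Finset.range N) _
    (Complex.exp (-(Complex.I * p * (((N / 2 : ℕ) : ℂ) / N))))]
  refine congrArg _ (Finset.sum_congr rfl fun i _ => ?_)
  rw [← Complex.exp_nat_mul, ← Complex.exp_add, Int.cast_sub, Int.cast_natCast, Int.cast_natCast]
  congr 1
  ring

theorem norm_exp_I_mul_le (p : ℂ) (hp : |p.im| ≤ 1) (t : ℝ) (ht : |t| ≤ 1) :
    ‖Complex.exp (Complex.I * p * (t : ℂ))‖ ≤ Real.exp 1 := by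
  rw [Complex.norm_exp]
  apply Real.exp_le_exp.mpr
  have : (Complex.I * p * (t : ℂ)).re = -(p.im * t) := by simp
  rw [this]
  calc -(p.im * t) ≤ |p.im * t| := neg_le_abs _
    _ = |p.im| * |t| := abs_mul _ _
    _ ≤ 1 * 1 := by gcongr
    _ = 1 := one_mul 1

theorem norm_dirichlet_le (N : ℕ) (p : ℂ) (hp : |p.im| ≤ 1) :
    ‖dirichlet N p‖ ≤ Real.exp 1 := by
  rcases eq_or_ne N 0 with rfl | hN
  · simp [dirichlet]; positivity
  have hN' : (0 : ℝ) < N := by positivity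
  rw [dirichlet, norm_mul, norm_inv, Complex.norm_natCast, inv_mul_le_iff₀ hN']
  calc _ ≤ ∑ x ∈ residues N, Real.exp 1 := by
        refine norm_sum_le_of_le _ fun x hx => ?_
        have h1 := norm_exp_I_mul_le p hp ((x : ℝ) / N) (by
          rw [abs_div, Nat.abs_cast, div_le_one hN']
          linarith [two_mul_abs_le_of_mem_residues hx, abs_nonneg (x : ℝ)])
        simpa using h1
    _ = _ := by rw [Finset.sum_const, card_residues, nsmul_eq_mul]

/-- Summing the geometric series, the numerator `e^{ip} - 1` is bounded in the strip, while
`e^{ip/N} - 1` is at least of order |p|/N: because N is odd, |κ + 2πℓ| ≤ πN, so p/N keeps its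
distance from the nonzero multiples of 2π. This gives a bound of order 1/|p|, and |p| ≥ (1 + |ℓ|)/2
for ℓ ≠ 0. For ℓ = 0 the trivial bound suffices. -/
theorem exists_norm_dirichlet_le :
    ∃ C : ℝ, 0 < C ∧ ∀ (N : ℕ), Odd N → ∀ (κ : ℝ), |κ| ≤ Real.pi → ∀ k : ℂ, ‖k - κ‖ ≤ 1 →
      ∀ ℓ ∈ residues N, ‖dirichlet N (k + 2 * Real.pi * ℓ)‖ ≤ C / (1 + |(ℓ : ℝ)|) := by
  obtain ⟨c, hc, hcb⟩ := exists_mul_norm_le_norm_one_sub_exp_neg (Real.pi + 1)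
  have he : 0 < Real.exp 1 := Real.exp_pos _
  refine ⟨Real.exp 1 + 2 * (Real.exp 1 * (Real.exp 1 + 1) / c), by positivity,
    fun N hN κ hκ k hk ℓ hℓ => ?_⟩
  have hN0 : N ≠ 0 := hN.pos.ne'
  have hN' : (0 : ℝ) < N := by positivity
  have hNc : (N : ℂ) ≠ 0 := Nat.cast_ne_zero.mpr hN0
  have hN1 : (1 : ℝ) ≤ N := by exact_mod_cast hN.pos
  set p : ℂ := k + 2 * Real.pi * ℓ with hp
  have hpk : p = κ + (2 * Real.pi * ℓ : ℝ) + (k - κ) := by rw [hp]; push_cast; ring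
  have him : |p.im| ≤ 1 := by
    have : p.im = (k - κ).im := by rw [hp]; simp
    rw [this]
    exact (Complex.abs_im_le_norm _).trans hk
  have hℓ' := two_mul_abs_le_of_mem_residues_odd hN hℓ
  have hpi := Real.pi_gt_three
  have hreal : |κ + 2 * Real.pi * ℓ| ≤ Real.pi * N := by
    calc |κ + 2 * Real.pi * ℓ| ≤ |κ| + |2 * Real.pi * ℓ| := abs_add_le _ _
      _ = |κ| + Real.pi * (2 * |(ℓ:ℝ)|) := by
          rw [abs_mul, abs_of_pos Real.two_pi_pos]; ring
      _ ≤ Real.pi + Real.pi * (N - 1) := by gcongr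
      _ = _ := by ring
  by_cases hℓ0 : ℓ = 0
  · have := norm_dirichlet_le N p him
    rw [hℓ0]
    simp only [Int.cast_zero, abs_zero, add_zero, div_one]
    have : 0 ≤ 2 * (Real.exp 1 * (Real.exp 1 + 1) / c) := by positivity
    linarith
  have hℓ1 : (1 : ℝ) ≤ |(ℓ : ℝ)| := by exact_mod_cast Int.one_le_abs hℓ0
  have hpn : (1 + |(ℓ : ℝ)|) / 2 ≤ ‖p‖ := by
    have h1 : ‖((2 * Real.pi * ℓ : ℝ) : ℂ)‖ ≤ ‖p‖ + ‖k‖ := by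
      have : ((2 * Real.pi * ℓ : ℝ) : ℂ) = p - k := by rw [hp]; push_cast; ring
      rw [this]; exact norm_sub_le _ _
    rw [Complex.norm_real, Real.norm_eq_abs, abs_mul, abs_of_pos Real.two_pi_pos] at h1
    have h2 : ‖k‖ ≤ Real.pi + 1 := by
      have : k = (k - κ) + κ := by ring
      rw [this]
      refine (norm_add_le _ _).trans ?_
      rw [Complex.norm_real, Real.norm_eq_abs]
      linarith
    nlinarith
  have hw1 : ‖-(Complex.I * p / N)‖ ≤ Real.pi + 1 := by
    rw [norm_neg, norm_div, norm_mul, Complex.norm_I, one_mul, Complex.norm_natCast,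
      div_le_iff₀ hN', hpk]
    refine (norm_add_le _ _).trans ?_
    rw [← Complex.ofReal_add, Complex.norm_real, Real.norm_eq_abs]
    nlinarith
  have hw2 : |(-(Complex.I * p / N)).im| ≤ Real.pi + 1 :=
    (Complex.abs_im_le_norm _).trans hw1
  have h3 := hcb _ hw1 hw2
  rw [neg_neg, norm_neg, norm_div, norm_mul, Complex.norm_I, one_mul, Complex.norm_natCast,
    norm_sub_rev] at h3
  have h4 : ‖∑ i ∈ Finset.range N, Complex.exp (Complex.I * p / N) ^ i‖ *
      ‖Complex.exp (Complex.I * p / N) - 1‖ ≤ Real.exp 1 + 1 := by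
    rw [← norm_mul, geom_sum_mul, ← Complex.exp_nat_mul]
    refine (norm_sub_le _ _).trans ?_
    have := norm_exp_I_mul_le p him 1 (by simp)
    rw [norm_one]
    have h5 : (N : ℂ) * (Complex.I * p / N) = Complex.I * p * ((1 : ℝ) : ℂ) := by
      push_cast; field_simp
    rw [h5]
    linarith
  have h6 : ‖Complex.exp (-(Complex.I * p * (((N / 2 : ℕ) : ℂ) / N)))‖ ≤ Real.exp 1 := by
    have := norm_exp_I_mul_le p him (-(((N / 2 : ℕ) : ℝ) / N)) (by
      rw [abs_neg, abs_div, Nat.abs_cast, Nat.abs_cast, div_le_one hN']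
      exact_mod_cast Nat.div_le_self _ _)
    convert this using 3
    push_cast
    ring
  set G₀ := ‖∑ i ∈ Finset.range N, Complex.exp (Complex.I * p / N) ^ i‖ with hG
  have h7 : ‖dirichlet N p‖ ≤ (N : ℝ)⁻¹ * (Real.exp 1 * G₀) := by
    rw [dirichlet_eq_range, norm_mul, norm_mul, norm_inv, Complex.norm_natCast]
    gcongr
  have h8 : G₀ * (c * (‖p‖ / N)) ≤ Real.exp 1 + 1 :=
    (mul_le_mul_of_nonneg_left h3 (norm_nonneg _)).trans h4
  have h9 : ‖dirichlet N p‖ * (c * ‖p‖) ≤ Real.exp 1 * (Real.exp 1 + 1) := by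
    calc ‖dirichlet N p‖ * (c * ‖p‖) ≤ (N : ℝ)⁻¹ * (Real.exp 1 * G₀) * (c * ‖p‖) := by gcongr
      _ = Real.exp 1 * (G₀ * (c * (‖p‖ / N))) := by field_simp
      _ ≤ _ := by gcongr
  rw [le_div_iff₀ (by positivity)]
  have h10 : ‖dirichlet N p‖ * ((1 + |(ℓ : ℝ)|) / 2) ≤ ‖dirichlet N p‖ * ‖p‖ := by gcongr
  have h11 : ‖dirichlet N p‖ * ‖p‖ ≤ Real.exp 1 * (Real.exp 1 + 1) / c := by
    rw [le_div_iff₀ hc]; linarith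
  linarith

/-- The real form of the Dirichlet kernel. -/
def dirichletReal (N : ℕ) (p : ℝ) : ℝ := (N : ℝ)⁻¹ * ∑ x ∈ residues N, Real.cos (p * (x / N))

theorem dirichlet_ofReal {N : ℕ} (hN : Odd N) (p : ℝ) :
    dirichlet N p = (dirichletReal N p : ℂ) := by
  have h1 : ∑ x ∈ residues N, Complex.exp (Complex.I * p * ((x : ℂ) / N)) =
      ∑ x ∈ residues N, Complex.exp (-(Complex.I * p * ((x : ℂ) / N))) := by
    refine Finset.sum_nbij' (fun x => -x) (fun x => -x) (fun x hx => neg_mem_residues hN hx)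
      (fun x hx => neg_mem_residues hN hx) (by simp) (by simp) fun x _ => ?_
    congr 1
    push_cast; ring
  have h2 : ∑ x ∈ residues N, Complex.exp (Complex.I * p * ((x : ℂ) / N)) =
      ((∑ x ∈ residues N, Real.cos (p * (x / N)) : ℝ) : ℂ) := by
    have h3 : (2 : ℂ) * ∑ x ∈ residues N, Complex.exp (Complex.I * p * ((x : ℂ) / N)) =
        2 * ((∑ x ∈ residues N, Real.cos (p * (x / N)) : ℝ) : ℂ) := by
      rw [two_mul]
      nth_rewrite 2 [h1]
      rw [← Finset.sum_add_distrib, Complex.ofReal_sum, Finset.mul_sum]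
      refine Finset.sum_congr rfl fun x _ => ?_
      rw [Complex.ofReal_cos, Complex.two_cos]
      push_cast
      congr 2 <;> ring
    exact mul_left_cancel₀ two_ne_zero h3
  rw [dirichlet, dirichletReal, h2]
  push_cast
  rfl

theorem sum_abs_residues (m : ℕ) : ∑ x ∈ residues (2 * m + 1), |x| = m * (m + 1) := by
  induction m with
  | zero => decide
  | succ m ih =>
    have : residues (2 * (m + 1) + 1) =
        insert (-((m : ℤ) + 1)) (insert ((m : ℤ) + 1) (residues (2 * m + 1))) := by
      ext x
      simp only [Finset.mem_insert, mem_residues]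
      omega
    rw [this, Finset.sum_insert, Finset.sum_insert, ih]
    · rw [abs_neg, abs_of_nonneg (by positivity)]
      push_cast; ring
    · simp only [mem_residues]; omega
    · simp only [Finset.mem_insert, mem_residues]; omega

/-- Jordan's inequality cos x ≥ 1 - 2x/π reduces this to the mean of 2|x|/N over the residues, which
for N = 2m + 1 is 2m(m + 1)/N² ≤ 1/2. -/
theorem half_le_dirichletReal {N : ℕ} (hN : Odd N) (p : ℝ) (hp : |p| ≤ Real.pi) :
    1 / 2 ≤ dirichletReal N p := by
  have hN' : (0 : ℝ) < N := by exact_mod_cast hN.pos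
  have hpi := Real.pi_pos
  have h1 : ∀ x ∈ residues N, 1 - 2 * |(x : ℝ)| / N ≤ Real.cos (p * (x / N)) := by
    intro x hx
    have h2 : |p * (x / N)| ≤ Real.pi * (|(x : ℝ)| / N) := by
      rw [abs_mul, abs_div, Nat.abs_cast]; gcongr
    have h3 : |(x : ℝ)| / N ≤ 1 / 2 := by
      rw [div_le_iff₀ hN']; linarith [two_mul_abs_le_of_mem_residues hx]
    have h4 := Real.one_sub_mul_le_cos (x := |p * (x / N)|) (abs_nonneg _) (by nlinarith)
    rw [Real.cos_abs] at h4
    refine le_trans ?_ h4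
    have h5 : 2 / Real.pi * |p * (x / N)| ≤ 2 / Real.pi * (Real.pi * (|(x : ℝ)| / N)) := by
      gcongr
    have h6 : 2 / Real.pi * (Real.pi * (|(x : ℝ)| / N)) = 2 * |(x : ℝ)| / N := by
      field_simp
    linarith
  have h7 := Finset.sum_le_sum h1
  rw [Finset.sum_sub_distrib, Finset.sum_const, card_residues, nsmul_eq_mul, mul_one,
    ← Finset.sum_div, ← Finset.mul_sum] at h7
  obtain ⟨m, rfl⟩ := hN
  have h8 : ∑ x ∈ residues (2 * m + 1), |(x : ℝ)| = m * (m + 1) := by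
    exact_mod_cast sum_abs_residues m
  rw [h8] at h7
  rw [dirichletReal, inv_mul_eq_div, le_div_iff₀ hN']
  refine le_trans ?_ h7
  rw [le_sub_iff_add_le, ← le_sub_iff_add_le', div_le_iff₀ hN']
  push_cast
  nlinarith

/-! ### Symbols -/

/-- The number of points per unit length of the `j`-th lattice, in each direction. -/
def scale (L j : ℕ) : Fin 4 → ℕ := Fin.cons (L ^ (2 * j)) fun _ => L ^ j

/-- The periods of the torus. -/
def period (T S : ℕ) : Fin 4 → ℕ := Fin.cons T fun _ => S

/-- Representatives of the momenta of a lattice with `s ν` points per unit length, modulo the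
momenta of the unit lattice. -/
def shifts (s : Fin 4 → ℕ) : Finset (Fin 4 → ℤ) := Fintype.piFinset fun ν => residues (s ν)

/-- The momentum `k + 2 π ℓ`. -/
def shift (k : Fin 4 → ℂ) (ℓ : Fin 4 → ℤ) : Fin 4 → ℂ := fun ν => k ν + 2 * Real.pi * ℓ ν

/-- The symbol of the averaging operator from a lattice with `s ν` points per unit length to the
unit lattice. -/
def avgSymbol (𝔮 : ℕ) (s : Fin 4 → ℕ) (p : Fin 4 → ℂ) : ℂ := ∏ ν, dirichlet (s ν) (p ν) ^ 𝔮

/-- The symbol of `1 + ∑_j L^{-2j} Q_j Q_j^*`. -/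
def gramSymbol (𝔮 L n : ℕ) (k : Fin 4 → ℂ) : ℂ :=
  1 + ∑ j ∈ Finset.Icc 1 (n - 1), ((L : ℂ) ^ (2 * j))⁻¹ *
    ∑ ℓ ∈ shifts (scale L j), avgSymbol 𝔮 (scale L j) (shift k ℓ) ^ 2

/-- The spatial part of a momentum, in units of the inverse lattice spacing. -/
def spatial (M : ℕ) (p : Fin 4 → ℂ) : Fin 3 → ℂ := fun i => p i.succ / M

/-- The symbol of the differential operator on a lattice with `M` points per unit length in the
space directions and `M ^ 2` points in the time direction. -/
def diffSymbol (M : ℕ) (hhat : (Fin 3 → ℂ) → ℂ) (p : Fin 4 → ℂ) : ℂ :=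
  (M : ℂ) ^ 2 * (1 - Complex.exp (-(hhat (spatial M p) - Complex.I * p 0 / (M : ℂ) ^ 2)))

theorem scale_pos {L : ℕ} (hL : 0 < L) (j : ℕ) (ν : Fin 4) : 0 < scale L j ν := by
  refine Fin.cases ?_ (fun i => ?_) ν <;> simp [scale] <;> positivity

theorem scale_odd {L : ℕ} (hL : Odd L) (j : ℕ) (ν : Fin 4) : Odd (scale L j ν) := by
  refine Fin.cases ?_ (fun i => ?_) ν <;> simp only [scale, Fin.cons_zero, Fin.cons_succ]
  · exact hL.pow
  · exact hL.pow

@[simp] theorem scale_zero (L j : ℕ) : scale L j 0 = (L ^ j) ^ 2 := by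
  simp [scale, ← pow_mul, mul_comm]

@[simp] theorem scale_succ (L j : ℕ) (i : Fin 3) : scale L j i.succ = L ^ j := by
  simp [scale]

theorem zero_mem_shifts {s : Fin 4 → ℕ} (hs : ∀ ν, Odd (s ν)) : (0 : Fin 4 → ℤ) ∈ shifts s := by
  rw [shifts, Fintype.mem_piFinset]
  exact fun ν => zero_mem_residues (hs ν).pos.ne'

theorem shift_zero (k : Fin 4 → ℂ) : shift k 0 = k := by
  ext ν; simp [shift]

/-- The weight `∏_ν (1 + |ℓ_ν|)⁻²`. -/
def weight (ℓ : Fin 4 → ℤ) : ℝ := ∏ ν, ((1 + |(ℓ ν : ℝ)|) ^ 2)⁻¹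

theorem weight_pos (ℓ : Fin 4 → ℤ) : 0 < weight ℓ :=
  Finset.prod_pos fun ν _ => by positivity

theorem weight_le_one (ℓ : Fin 4 → ℤ) : weight ℓ ≤ 1 :=
  Finset.prod_le_one (fun ν _ => by positivity) fun ν _ => inv_le_one_of_one_le₀ (by
    have := abs_nonneg (ℓ ν : ℝ); nlinarith)

theorem summable_one_add_abs_sq : Summable fun x : ℤ => ((1 + |(x : ℝ)|) ^ 2)⁻¹ := by
  have h : Summable fun n : ℕ => ((1 + (n : ℝ)) ^ 2)⁻¹ := by
    have := (summable_nat_add_iff 1).mpr (Real.summable_nat_pow_inv.mpr (one_lt_two))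
    refine this.congr fun n => ?_
    push_cast; rw [add_comm]
  refine Summable.of_nat_of_neg ?_ ?_
  · simpa using h
  · simpa using h

theorem exists_sum_weight_le :
    ∃ W : ℝ, 0 < W ∧ ∀ s : Fin 4 → ℕ, ∑ ℓ ∈ shifts s, weight ℓ ≤ W := by
  set B := ∑' x : ℤ, ((1 + |(x : ℝ)|) ^ 2)⁻¹ with hB
  have hB0 : 0 ≤ B := tsum_nonneg fun x => by positivity
  refine ⟨(B + 1) ^ 4, by positivity, fun s => ?_⟩
  have h1 : ∑ ℓ ∈ shifts s, weight ℓ = ∏ ν, ∑ x ∈ residues (s ν), ((1 + |(x : ℝ)|) ^ 2)⁻¹ := by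
    rw [Finset.prod_univ_sum]; rfl
  rw [h1]
  calc _ ≤ ∏ _ν : Fin 4, (B + 1) := by
        refine Finset.prod_le_prod (fun ν _ => Finset.sum_nonneg fun x _ => by positivity)
          fun ν _ => ?_
        have := summable_one_add_abs_sq.sum_le_tsum (residues (s ν)) fun x _ => by positivity
        linarith
    _ = _ := by simp

theorem exists_norm_avgSymbol_le {𝔮 : ℕ} (h𝔮 : 2 ≤ 𝔮) :
    ∃ C : ℝ, 1 ≤ C ∧ ∀ s : Fin 4 → ℕ, (∀ ν, Odd (s ν)) → ∀ κ : Fin 4 → ℝ,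
      (∀ ν, |κ ν| ≤ Real.pi) → ∀ k : Fin 4 → ℂ, (∀ ν, ‖k ν - κ ν‖ ≤ 1) → ∀ ℓ ∈ shifts s,
      ‖avgSymbol 𝔮 s (shift k ℓ)‖ ≤ C * weight ℓ := by
  obtain ⟨C, hC, hb⟩ := exists_norm_dirichlet_le
  refine ⟨((C + 1) ^ 𝔮) ^ 4, one_le_pow₀ (one_le_pow₀ (by linarith)),
    fun s hs κ hκ k hk ℓ hℓ => ?_⟩
  rw [avgSymbol, norm_prod, weight]
  have h4 : ((C + 1) ^ 𝔮) ^ 4 = ∏ _ν : Fin 4, (C + 1) ^ 𝔮 := by simp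
  rw [h4, ← Finset.prod_mul_distrib]
  refine Finset.prod_le_prod (fun ν _ => norm_nonneg _) fun ν _ => ?_
  rw [norm_pow]
  have h1 := hb (s ν) (hs ν) (κ ν) (hκ ν) (k ν) (hk ν) (ℓ ν) (Fintype.mem_piFinset.mp hℓ ν)
  have h2 : (1 : ℝ) ≤ 1 + |(ℓ ν : ℝ)| := by linarith [abs_nonneg (ℓ ν : ℝ)]
  calc ‖dirichlet (s ν) (shift k ℓ ν)‖ ^ 𝔮 ≤ (C / (1 + |(ℓ ν : ℝ)|)) ^ 𝔮 := by
        gcongr; exact h1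
    _ = C ^ 𝔮 * ((1 + |(ℓ ν : ℝ)|) ^ 𝔮)⁻¹ := by rw [div_pow, div_eq_mul_inv]
    _ ≤ (C + 1) ^ 𝔮 * ((1 + |(ℓ ν : ℝ)|) ^ 2)⁻¹ := by
        gcongr <;> linarith

theorem avgSymbol_ofReal (𝔮 : ℕ) {s : Fin 4 → ℕ} (hs : ∀ ν, Odd (s ν)) (p : Fin 4 → ℝ) :
    avgSymbol 𝔮 s (fun ν => (p ν : ℂ)) = ((∏ ν, dirichletReal (s ν) (p ν) ^ 𝔮 : ℝ) : ℂ) := by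
  rw [avgSymbol]
  push_cast
  exact Finset.prod_congr rfl fun ν _ => by rw [dirichlet_ofReal (hs ν)]

theorem shift_ofReal (κ : Fin 4 → ℝ) (ℓ : Fin 4 → ℤ) :
    shift (fun ν => (κ ν : ℂ)) ℓ = fun ν => ((κ ν + 2 * Real.pi * ℓ ν : ℝ) : ℂ) := by
  ext ν; simp [shift]

theorem exists_avgSymbol_shift_ofReal (𝔮 : ℕ) {s : Fin 4 → ℕ} (hs : ∀ ν, Odd (s ν))
    (κ : Fin 4 → ℝ) (ℓ : Fin 4 → ℤ) :
    ∃ r : ℝ, avgSymbol 𝔮 s (shift (fun ν => (κ ν : ℂ)) ℓ) = r := by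
  rw [shift_ofReal]
  exact ⟨_, avgSymbol_ofReal 𝔮 hs _⟩

theorem le_norm_avgSymbol_ofReal (𝔮 : ℕ) {s : Fin 4 → ℕ} (hs : ∀ ν, Odd (s ν)) (κ : Fin 4 → ℝ)
    (hκ : ∀ ν, |κ ν| ≤ Real.pi) :
    ((1 / 2 : ℝ) ^ 𝔮) ^ 4 ≤ ‖avgSymbol 𝔮 s (fun ν => (κ ν : ℂ))‖ := by
  rw [avgSymbol, norm_prod]
  have h4 : ((1 / 2 : ℝ) ^ 𝔮) ^ 4 = ∏ _ν : Fin 4, (1 / 2 : ℝ) ^ 𝔮 := by simp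
  rw [h4]
  refine Finset.prod_le_prod (fun ν _ => by positivity) fun ν _ => ?_
  rw [norm_pow, dirichlet_ofReal (hs ν), Complex.norm_real]
  gcongr
  exact (half_le_dirichletReal (hs ν) _ (hκ ν)).trans (le_abs_self _)

/-- At real momenta the averaging symbols are real, so the sum consists of squares with positive
weights. This yields both the invertibility of the Gram operator and the lower bound 1/a in the
denominator of the Green's function. -/
theorem exists_gramSymbol_ofReal (𝔮 : ℕ) {L : ℕ} (hL : Odd L) (n : ℕ) (κ : Fin 4 → ℝ) :
    ∃ r : ℝ, 1 ≤ r ∧ gramSymbol 𝔮 L n (fun ν => (κ ν : ℂ)) = r := by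
  choose f hf using fun (j : ℕ) (ℓ : Fin 4 → ℤ) =>
    exists_avgSymbol_shift_ofReal 𝔮 (s := scale L j) (scale_odd hL j) κ ℓ
  refine ⟨1 + ∑ j ∈ Finset.Icc 1 (n - 1), ((L : ℝ) ^ (2 * j))⁻¹ *
    ∑ ℓ ∈ shifts (scale L j), f j ℓ ^ 2, ?_, ?_⟩
  · have : 0 ≤ ∑ j ∈ Finset.Icc 1 (n - 1), ((L : ℝ) ^ (2 * j))⁻¹ *
      ∑ ℓ ∈ shifts (scale L j), f j ℓ ^ 2 := by positivity
    linarith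
  · rw [gramSymbol]
    push_cast
    simp only [hf]

/-- The sum over ℓ is bounded uniformly in j, and the factors L^{-2j} ≤ 2^{-j} make the sum over j
uniform in n and L. -/
theorem exists_norm_gramSymbol_le {𝔮 : ℕ} (h𝔮 : 2 ≤ 𝔮) :
    ∃ C : ℝ, 1 ≤ C ∧ ∀ L : ℕ, Odd L → 1 < L → ∀ n : ℕ, ∀ κ : Fin 4 → ℝ,
      (∀ ν, |κ ν| ≤ Real.pi) → ∀ k : Fin 4 → ℂ, (∀ ν, ‖k ν - κ ν‖ ≤ 1) →
      ‖gramSymbol 𝔮 L n k‖ ≤ C := by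
  obtain ⟨C, hC, hb⟩ := exists_norm_avgSymbol_le h𝔮
  obtain ⟨W, hW, hWb⟩ := exists_sum_weight_le
  refine ⟨1 + 2 * (C ^ 2 * W), by nlinarith [sq_nonneg C], fun L hL hL1 n κ hκ k hk => ?_⟩
  rw [gramSymbol]
  refine (norm_add_le _ _).trans ?_
  rw [norm_one]
  gcongr
  have h1 : ∀ j ∈ Finset.Icc 1 (n - 1), ‖((L : ℂ) ^ (2 * j))⁻¹ *
      ∑ ℓ ∈ shifts (scale L j), avgSymbol 𝔮 (scale L j) (shift k ℓ) ^ 2‖ ≤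
      (1 / 2 : ℝ) ^ j * (C ^ 2 * W) := by
    intro j _
    rw [norm_mul, norm_inv, norm_pow, Complex.norm_natCast]
    have hL2 : (2 : ℝ) ≤ L := by exact_mod_cast hL1
    gcongr
    · rw [one_div, inv_pow]
      gcongr
      calc (2 : ℝ) ^ j ≤ (L : ℝ) ^ j := by gcongr
        _ ≤ (L : ℝ) ^ (2 * j) := pow_le_pow_right₀ (by linarith) (by omega)
    · calc _ ≤ ∑ ℓ ∈ shifts (scale L j), C ^ 2 * weight ℓ := by
            refine norm_sum_le_of_le _ fun ℓ hℓ => ?_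
            rw [norm_pow]
            have h2 := hb _ (scale_odd hL j) κ hκ k hk ℓ hℓ
            have h3 := weight_pos ℓ
            calc _ ≤ (C * weight ℓ) ^ 2 := by gcongr
              _ = C ^ 2 * weight ℓ * weight ℓ := by ring
              _ ≤ C ^ 2 * weight ℓ * 1 := by gcongr; exact weight_le_one ℓ
              _ = _ := mul_one _
        _ ≤ _ := by rw [← Finset.mul_sum]; gcongr; exact hWb _
  refine (norm_sum_le_of_le _ h1).trans ?_
  rw [← Finset.sum_mul]
  gcongr
  have h4 : Summable fun j : ℕ => (1 / 2 : ℝ) ^ j := summable_geometric_two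
  exact (h4.sum_le_tsum _ fun j _ => by positivity).trans_eq tsum_geometric_two

/-! ### Bounds for the symbol of the differential operator -/

set_option maxHeartbeats 1000000 in
-- Write D = M²(1 - e^{-w}), with P the norm of the spatial part of the real momentum p. There M²|w|
-- dominates both P² and |p_0|, hence is bounded below outside the central zone. Moving p by r into
-- the complex domain changes M²w by at most a multiple of r(1 + P), a small fraction of M²|w|.
-- Finally |1 - e^{-w}| is comparable to |w|, since |Im w| stays below π + 1.
theorem exists_diffSymbol_bounds {h : (Fin 3 → ℤ) → ℂ} {hhat : (Fin 3 → ℂ) → ℂ}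
    (H : IsHamiltonian h hhat) :
    ∃ r : ℝ, 0 < r ∧ r ≤ 1 ∧ ∃ c : ℝ, 0 < c ∧ ∃ C : ℝ, 0 < C ∧ ∀ M : ℕ, 0 < M →
      ∀ p : Fin 4 → ℝ, |p 0| ≤ Real.pi * M ^ 2 → (∀ i : Fin 3, |p i.succ| ≤ Real.pi * M) →
      ∀ p' : Fin 4 → ℂ, (∀ ν, ‖p' ν - p ν‖ ≤ r) →
        ((∃ ν, Real.pi ≤ |p ν|) → c ≤ ‖diffSymbol M hhat p'‖) ∧
        ((∀ ν, |p ν| ≤ Real.pi) → ‖diffSymbol M hhat p'‖ ≤ C) := by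
  have hpi := Real.pi_pos
  have hpi3 := Real.pi_gt_three
  obtain ⟨C₁, hC₁, hb₁⟩ := H.exists_norm_le_sq (Real.pi + 1)
  obtain ⟨C, hC, hb⟩ := H.exists_norm_sub_le Real.pi
  obtain ⟨ch, hch, hlow⟩ := H.exists_re_lower
  set R := C₁ * (Real.pi + 1) ^ 2 + (Real.pi + 1) with hR
  obtain ⟨ce, hce, hexp⟩ := exists_mul_norm_le_norm_one_sub_exp_neg R
  set c₁ := min (ch * Real.pi ^ 2) Real.pi with hc₁
  have hc₁p : 0 < c₁ := by positivity
  -- `A₁` is chosen so that the perturbation costs at most half of M²|w|, and `A₂` so that it moves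
  -- Im w by at most 1.
  set A₁ := 2 * ((2 * C + 1) / c₁ + C / ch) with hA₁
  have hA₁p : 0 < A₁ := by positivity
  set A₂ := C * (Real.pi + 1) + 1 with hA₂
  have hA₂p : 0 < A₂ := by positivity
  set r := min 1 (min (1 / A₁) (1 / A₂)) with hr
  have hr0 : 0 < r := by positivity
  have hr1 : r ≤ 1 := min_le_left _ _
  have hrA₁ : r * A₁ ≤ 1 := by
    rw [← le_div_iff₀ hA₁p]; exact (min_le_right _ _).trans (min_le_left _ _)
  have hrA₂ : r * A₂ ≤ 1 := by
    rw [← le_div_iff₀ hA₂p]; exact (min_le_right _ _).trans (min_le_right _ _)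
  refine ⟨r, hr0, hr1, ce * (c₁ / 2), by positivity, Real.exp R * R, by positivity,
    fun M hM p hp0 hps p' hp' => ?_⟩
  have hM0 : (0 : ℝ) < M := by exact_mod_cast hM
  have hM1 : (1 : ℝ) ≤ M := by exact_mod_cast hM
  have hMc : (M : ℂ) ≠ 0 := by exact_mod_cast hM.ne'
  set sr : Fin 3 → ℝ := fun i => p i.succ / M with hsr
  set s : Fin 3 → ℂ := fun i => (sr i : ℂ) with hs
  set d : Fin 3 → ℂ := spatial M p' - s with hd
  have hsd : spatial M p' = s + d := by rw [hd]; abel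
  have hsn : ‖s‖ = ‖sr‖ := IsHamiltonian.norm_ofReal_pi sr
  have hsrpi : ‖sr‖ ≤ Real.pi := by
    refine (pi_norm_le_iff_of_nonneg hpi.le).mpr fun i => ?_
    rw [Real.norm_eq_abs, hsr, abs_div, Nat.abs_cast, div_le_iff₀ hM0]
    exact hps i
  have hdn : ‖d‖ ≤ r / M := by
    refine (pi_norm_le_iff_of_nonneg (by positivity)).mpr fun i => ?_
    have : d i = (p' i.succ - p i.succ) / M := by
      simp only [hd, hs, hsr, spatial, Pi.sub_apply]; push_cast; ring
    rw [this, norm_div, Complex.norm_natCast]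
    gcongr
    exact hp' _
  have hrM : r / M ≤ r := div_le_self hr0.le hM1
  have hdiff := hb s d (hsn ▸ hsrpi) (hdn.trans (hrM.trans hr1))
  rw [← hsd, hsn] at hdiff
  set w : ℂ := hhat s - Complex.I * p 0 / (M : ℂ) ^ 2 with hw
  set w' : ℂ := hhat (spatial M p') - Complex.I * p' 0 / (M : ℂ) ^ 2 with hw'
  have hD : ‖diffSymbol M hhat p'‖ = (M : ℝ) ^ 2 * ‖1 - Complex.exp (-w')‖ := by
    rw [diffSymbol, norm_mul, norm_pow, Complex.norm_natCast]
  have hp0n : ‖Complex.I * p' 0 / (M : ℂ) ^ 2‖ = ‖p' 0‖ / (M : ℝ) ^ 2 := by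
    rw [norm_div, norm_mul, Complex.norm_I, one_mul, norm_pow, Complex.norm_natCast]
  have hp'n : ∀ ν, ‖p' ν‖ ≤ |p ν| + r := by
    intro ν
    have h1 : p' ν = (p ν : ℂ) + (p' ν - p ν) := by ring
    rw [h1]
    refine (norm_add_le _ _).trans ?_
    rw [Complex.norm_real, Real.norm_eq_abs]
    linarith [hp' ν]
  have hs'n : ‖spatial M p'‖ ≤ Real.pi + 1 := by
    rw [hsd]
    refine (norm_add_le _ _).trans ?_
    rw [hsn]; linarith
  have hw'R : ‖w'‖ ≤ R := by
    refine (norm_sub_le _ _).trans ?_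
    rw [hp0n, hR]
    gcongr
    · refine (hb₁ _ hs'n).trans ?_
      gcongr
    · rw [div_le_iff₀ (by positivity)]
      have := hp'n 0
      nlinarith
  refine ⟨fun hν => ?_, fun hp => ?_⟩
  · have hw'im : |w'.im| ≤ Real.pi + 1 := by
      have h1 : w'.im = (hhat (spatial M p') - hhat s).im -
          (Complex.I * (p' 0 - p 0) / (M : ℂ) ^ 2).im - p 0 / (M : ℝ) ^ 2 := by
        have h2 : (hhat s).im = 0 := (H.nonneg sr).1
        have h3 : (Complex.I * (p 0 : ℂ) / (M : ℂ) ^ 2).im = p 0 / (M : ℝ) ^ 2 := by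
          have : Complex.I * (p 0 : ℂ) / (M : ℂ) ^ 2 =
            ((p 0 / (M : ℝ) ^ 2 : ℝ) : ℂ) * Complex.I := by push_cast; ring
          rw [this, Complex.im_ofReal_mul, Complex.I_im, mul_one]
        rw [hw', mul_sub, sub_div, Complex.sub_im, Complex.sub_im, Complex.sub_im, h2, h3]
        ring
      have h4 : |(hhat (spatial M p') - hhat s).im| ≤ C * r * (Real.pi + 1) := by
        refine (Complex.abs_im_le_norm _).trans (hdiff.trans ?_)
        gcongr <;> linarith
      have h5 : |(Complex.I * (p' 0 - p 0) / (M : ℂ) ^ 2).im| ≤ r := by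
        refine (Complex.abs_im_le_norm _).trans ?_
        rw [norm_div, norm_mul, Complex.norm_I, one_mul, norm_pow, Complex.norm_natCast]
        exact (div_le_self (norm_nonneg _) (one_le_pow₀ hM1)).trans (hp' 0)
      have h6 : |p 0 / (M : ℝ) ^ 2| ≤ Real.pi := by
        rw [abs_div, abs_of_pos (show (0:ℝ) < (M : ℝ) ^ 2 by positivity),
          div_le_iff₀ (by positivity)]
        exact hp0
      rw [h1]
      have h7 : C * r * (Real.pi + 1) + r ≤ 1 := by
        have : C * r * (Real.pi + 1) + r = r * A₂ := by rw [hA₂]; ring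
        rw [this]; exact hrA₂
      have h8 := abs_sub ((hhat (spatial M p') - hhat s).im -
          (Complex.I * (p' 0 - p 0) / (M : ℂ) ^ 2).im) (p 0 / (M : ℝ) ^ 2)
      have h9 := abs_sub (hhat (spatial M p') - hhat s).im
          (Complex.I * (p' 0 - p 0) / (M : ℂ) ^ 2).im
      linarith
    set P := (M : ℝ) * ‖sr‖ with hP
    have hP0 : 0 ≤ P := by positivity
    have hA1 : ch * P ^ 2 ≤ (M : ℝ) ^ 2 * ‖w‖ := by
      have h1 : (hhat s).re ≤ ‖w‖ := by
        have h2 : w.re = (hhat s).re := by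
          have : Complex.I * (p 0 : ℂ) / (M : ℂ) ^ 2 =
            ((p 0 / (M : ℝ) ^ 2 : ℝ) : ℂ) * Complex.I := by push_cast; ring
          rw [hw, Complex.sub_re, this, Complex.re_ofReal_mul, Complex.I_re]; simp
        rw [← h2]; exact Complex.re_le_norm _
      have h2 := hlow sr hsrpi
      calc ch * P ^ 2 = (M : ℝ) ^ 2 * (ch * ‖sr‖ ^ 2) := by rw [hP]; ring
        _ ≤ _ := by gcongr; exact h2.trans h1
    have hA2 : |p 0| ≤ (M : ℝ) ^ 2 * ‖w‖ := by
      have h1 : |w.im| = |p 0| / (M : ℝ) ^ 2 := by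
        have : Complex.I * (p 0 : ℂ) / (M : ℂ) ^ 2 =
            ((p 0 / (M : ℝ) ^ 2 : ℝ) : ℂ) * Complex.I := by push_cast; ring
        rw [hw, Complex.sub_im, (H.nonneg sr).1, this, Complex.im_ofReal_mul, Complex.I_im,
          mul_one, zero_sub, abs_neg, abs_div, abs_of_pos (show (0:ℝ) < (M : ℝ) ^ 2 by positivity)]
      have h2 := Complex.abs_im_le_norm w
      rw [h1, div_le_iff₀ (by positivity)] at h2
      linarith
    set A := (M : ℝ) ^ 2 * ‖w‖ with hA
    have hAc : c₁ ≤ A := by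
      obtain ⟨ν, hν⟩ := hν
      revert hν
      refine Fin.cases (fun hν => ?_) (fun i hν => ?_) ν
      · exact (min_le_right _ _).trans (hν.trans hA2)
      · refine (min_le_left _ _).trans (le_trans ?_ hA1)
        have h1 : Real.pi ≤ P := by
          have := norm_le_pi_norm sr i
          rw [Real.norm_eq_abs, hsr, abs_div, Nat.abs_cast, div_le_iff₀ hM0] at this
          rw [hP, mul_comm]
          exact hν.trans this
        gcongr
    -- The linear growth in P is absorbed through P ≤ 1 + P² ≤ 1 + A/ch, and constants through 1 ≤
    -- A/c₁.
    have hchange : (M : ℝ) ^ 2 * ‖w' - w‖ ≤ A / 2 := by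
      have h1 : ‖w' - w‖ ≤ C * (r / M) * (‖sr‖ + r / M) + r / (M : ℝ) ^ 2 := by
        have : w' - w = (hhat (spatial M p') - hhat s) -
            Complex.I * (p' 0 - p 0) / (M : ℂ) ^ 2 := by rw [hw', hw]; ring
        rw [this]
        refine (norm_sub_le _ _).trans ?_
        gcongr
        · exact hdiff.trans (by gcongr)
        · rw [norm_div, norm_mul, Complex.norm_I, one_mul, norm_pow, Complex.norm_natCast]
          gcongr
          exact hp' 0
      have h2 : (M : ℝ) ^ 2 * ‖w' - w‖ ≤ C * r * (P + r) + r := by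
        calc _ ≤ (M : ℝ) ^ 2 * (C * (r / M) * (‖sr‖ + r / M) + r / (M : ℝ) ^ 2) := by gcongr
          _ = _ := by rw [hP]; field_simp
      have h3 : P ≤ 1 + A / ch := by
        have : P ^ 2 ≤ A / ch := by rw [le_div_iff₀ hch]; linarith
        nlinarith
      have h4 : 1 ≤ A / c₁ := by rw [le_div_iff₀ hc₁p]; linarith
      calc _ ≤ C * r * (P + r) + r := h2
        _ ≤ C * r * ((1 + A / ch) + 1) + r := by gcongr
        _ = r * ((2 * C + 1) * 1 + C * (A / ch)) := by ring
        _ ≤ r * ((2 * C + 1) * (A / c₁) + C * (A / ch)) := by gcongr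
        _ = r * A₁ * (A / 2) := by rw [hA₁]; ring
        _ ≤ 1 * (A / 2) := by gcongr
        _ = A / 2 := one_mul _
    have hw'low : c₁ / 2 ≤ (M : ℝ) ^ 2 * ‖w'‖ := by
      have h1 : ‖w‖ ≤ ‖w'‖ + ‖w' - w‖ := by
        have : w = w' - (w' - w) := by ring
        nth_rewrite 1 [this]
        exact norm_sub_le _ _
      have h2 : A ≤ (M : ℝ) ^ 2 * ‖w'‖ + (M : ℝ) ^ 2 * ‖w' - w‖ := by
        rw [hA, ← mul_add]; gcongr
      linarith
    rw [hD]
    calc ce * (c₁ / 2) ≤ ce * ((M : ℝ) ^ 2 * ‖w'‖) := by gcongr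
      _ = (M : ℝ) ^ 2 * (ce * ‖w'‖) := by ring
      _ ≤ _ := by gcongr; exact hexp _ hw'R hw'im
  · rw [hD]
    have h1 := norm_one_sub_exp_neg_le R w' hw'R
    calc (M : ℝ) ^ 2 * ‖1 - Complex.exp (-w')‖ ≤ (M : ℝ) ^ 2 * (Real.exp R * ‖w'‖) := by gcongr
      _ = Real.exp R * ((M : ℝ) ^ 2 * ‖w'‖) := by ring
      _ ≤ Real.exp R * R := by
        gcongr
        have h2 : ‖spatial M p'‖ ≤ (Real.pi + 1) / M := by
          refine (pi_norm_le_iff_of_nonneg (by positivity)).mpr fun i => ?_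
          rw [spatial, norm_div, Complex.norm_natCast]
          gcongr
          linarith [hp'n i.succ, hp i.succ]
        have h3 : ‖w'‖ ≤ C₁ * ((Real.pi + 1) / M) ^ 2 + (Real.pi + 1) / (M : ℝ) ^ 2 := by
          refine (norm_sub_le _ _).trans ?_
          rw [hp0n]
          gcongr
          · exact (hb₁ _ hs'n).trans (by gcongr)
          · linarith [hp'n 0, hp 0]
        calc (M : ℝ) ^ 2 * ‖w'‖ ≤
            (M : ℝ) ^ 2 * (C₁ * ((Real.pi + 1) / M) ^ 2 + (Real.pi + 1) / (M : ℝ) ^ 2) := by gcongr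
          _ = R := by rw [hR]; field_simp

theorem re_diffSymbol_nonneg {h : (Fin 3 → ℤ) → ℂ} {hhat : (Fin 3 → ℂ) → ℂ}
    (H : IsHamiltonian h hhat) (M : ℕ) (p : Fin 4 → ℝ) :
    0 ≤ (diffSymbol M hhat fun ν => (p ν : ℂ)).re := by
  set z : ℂ := hhat (spatial M fun ν => (p ν : ℂ)) - Complex.I * (p 0 : ℂ) / (M : ℂ) ^ 2 with hz
  have h1 : 0 ≤ z.re := by
    have h2 := (H.nonneg fun i => p i.succ / M).2
    have h3 : spatial M (fun ν => (p ν : ℂ)) = fun i => ((p i.succ / M : ℝ) : ℂ) := by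
      ext i; simp [spatial]
    have h4 : Complex.I * (p 0 : ℂ) / (M : ℂ) ^ 2 =
        ((p 0 / (M : ℝ) ^ 2 : ℝ) : ℂ) * Complex.I := by push_cast; ring
    rw [hz, h3, Complex.sub_re, h4, Complex.re_ofReal_mul, Complex.I_re]
    simpa using h2
  have h5 : (diffSymbol M hhat fun ν => (p ν : ℂ)) =
      (((M : ℝ) ^ 2 : ℝ) : ℂ) * (1 - Complex.exp (-z)) := by
    rw [diffSymbol]; push_cast; rfl
  rw [h5, Complex.re_ofReal_mul, Complex.sub_re, Complex.one_re]
  have h6 : (Complex.exp (-z)).re ≤ 1 := by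
    refine (Complex.re_le_norm _).trans ?_
    rw [Complex.norm_exp, Complex.neg_re]
    exact Real.exp_le_one_iff.mpr (by linarith)
  exact mul_nonneg (by positivity) (by linarith)

/-! ### The symbol of the Green's function -/

/-- The quotient `D(k) / D(k + 2 π ℓ)`, with the value `1` at `ℓ = 0`. -/
def diffRatio (M : ℕ) (hhat : (Fin 3 → ℂ) → ℂ) (k : Fin 4 → ℂ) (ℓ : Fin 4 → ℤ) : ℂ :=
  if ℓ = 0 then 1 else diffSymbol M hhat k / diffSymbol M hhat (shift k ℓ)

/-- The product of `D(k)` with `𝔔_n(k)⁻¹ + ∑_ℓ u(k + 2 π ℓ)² / D(k + 2 π ℓ)`. -/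
def greenDenom (𝔮 L n : ℕ) (a : ℝ) (hhat : (Fin 3 → ℂ) → ℂ) (k : Fin 4 → ℂ) : ℂ :=
  diffSymbol (L ^ n) hhat k * (gramSymbol 𝔮 L n k / a) +
    ∑ ℓ ∈ shifts (scale L n), avgSymbol 𝔮 (scale L n) (shift k ℓ) ^ 2 * diffRatio (L ^ n) hhat k ℓ

/-- The component at momentum `k + 2 π ℓ` of the image under `S_n Q_n^*` of the plane wave with
momentum `k`. -/
def greenSymbol (𝔮 L n : ℕ) (a : ℝ) (hhat : (Fin 3 → ℂ) → ℂ) (k : Fin 4 → ℂ) (ℓ : Fin 4 → ℤ) : ℂ :=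
  gramSymbol 𝔮 L n k / a * avgSymbol 𝔮 (scale L n) (shift k ℓ) * diffRatio (L ^ n) hhat k ℓ /
    greenDenom 𝔮 L n a hhat k

theorem differentiable_shift (ℓ : Fin 4 → ℤ) : Differentiable ℂ fun k => shift k ℓ := by
  unfold shift; fun_prop

theorem differentiable_avgSymbol (𝔮 : ℕ) (s : Fin 4 → ℕ) : Differentiable ℂ (avgSymbol 𝔮 s) := by
  have h : ∀ ν, Differentiable ℂ fun p : Fin 4 → ℂ => dirichlet (s ν) (p ν) := fun ν =>
    (differentiable_dirichlet (s ν)).comp (by fun_prop)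
  unfold avgSymbol
  fun_prop

theorem differentiable_gramSymbol (𝔮 L n : ℕ) : Differentiable ℂ (gramSymbol 𝔮 L n) := by
  have h : ∀ j ℓ, Differentiable ℂ fun k : Fin 4 → ℂ => avgSymbol 𝔮 (scale L j) (shift k ℓ) :=
    fun j ℓ => (differentiable_avgSymbol 𝔮 _).comp (differentiable_shift ℓ)
  unfold gramSymbol
  fun_prop

theorem differentiable_diffSymbol (M : ℕ) {hhat : (Fin 3 → ℂ) → ℂ} (hh : Differentiable ℂ hhat) :
    Differentiable ℂ (diffSymbol M hhat) := by
  have h : Differentiable ℂ fun p : Fin 4 → ℂ => hhat (spatial M p) :=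
    hh.comp (by unfold spatial; fun_prop)
  have h0 : Differentiable ℂ fun p : Fin 4 → ℂ => Complex.I * p 0 / (M : ℂ) ^ 2 := by fun_prop
  exact (((h.sub h0).neg.cexp).const_sub 1).const_mul _

theorem differentiableAt_diffRatio {M : ℕ} {hhat : (Fin 3 → ℂ) → ℂ} (hh : Differentiable ℂ hhat)
    {k : Fin 4 → ℂ} {ℓ : Fin 4 → ℤ} (hk : ℓ ≠ 0 → diffSymbol M hhat (shift k ℓ) ≠ 0) :
    DifferentiableAt ℂ (fun k => diffRatio M hhat k ℓ) k := by
  unfold diffRatio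
  by_cases hℓ : ℓ = 0
  · simp [hℓ]
  · simp only [hℓ, if_false, div_eq_mul_inv]
    exact ((differentiable_diffSymbol M hh) k).mul
      ((((differentiable_diffSymbol M hh).comp (differentiable_shift ℓ)) k).inv (hk hℓ))

theorem differentiableAt_greenDenom (𝔮 L n : ℕ) (a : ℝ) {hhat : (Fin 3 → ℂ) → ℂ}
    (hh : Differentiable ℂ hhat) {k : Fin 4 → ℂ}
    (hk : ∀ ℓ ∈ shifts (scale L n), ℓ ≠ 0 → diffSymbol (L ^ n) hhat (shift k ℓ) ≠ 0) :
    DifferentiableAt ℂ (greenDenom 𝔮 L n a hhat) k := by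
  unfold greenDenom
  simp only [div_eq_mul_inv]
  refine DifferentiableAt.add (((differentiable_diffSymbol _ hh) k).mul
    ((differentiable_gramSymbol 𝔮 L n k).mul_const _)) (DifferentiableAt.fun_sum fun ℓ hℓ => ?_)
  exact (((differentiable_avgSymbol 𝔮 _).comp (differentiable_shift ℓ) k).pow 2).mul
    (differentiableAt_diffRatio hh (hk ℓ hℓ))

theorem differentiableAt_greenSymbol (𝔮 L n : ℕ) (a : ℝ) {hhat : (Fin 3 → ℂ) → ℂ}
    (hh : Differentiable ℂ hhat) {k : Fin 4 → ℂ}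
    (hk : ∀ ℓ ∈ shifts (scale L n), ℓ ≠ 0 → diffSymbol (L ^ n) hhat (shift k ℓ) ≠ 0)
    (hd : greenDenom 𝔮 L n a hhat k ≠ 0) {ℓ : Fin 4 → ℤ} (hℓ : ℓ ∈ shifts (scale L n)) :
    DifferentiableAt ℂ (fun k => greenSymbol 𝔮 L n a hhat k ℓ) k := by
  unfold greenSymbol
  simp only [div_eq_mul_inv]
  refine DifferentiableAt.mul (DifferentiableAt.mul (DifferentiableAt.mul ?_ ?_)
    (differentiableAt_diffRatio hh (hk ℓ hℓ))) ((differentiableAt_greenDenom 𝔮 L n a hh hk).inv hd)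
  · exact (differentiable_gramSymbol 𝔮 L n k).mul_const _
  · exact (differentiable_avgSymbol 𝔮 _).comp (differentiable_shift ℓ) k

/-- Lower bounds for the symbol of the differential operator, away from the singularity at `0`. -/
theorem exists_diffSymbol_shift_bounds {h : (Fin 3 → ℤ) → ℂ} {hhat : (Fin 3 → ℂ) → ℂ}
    (H : IsHamiltonian h hhat) :
    ∃ r : ℝ, 0 < r ∧ r ≤ 1 ∧ ∃ c : ℝ, 0 < c ∧ ∃ C : ℝ, 0 < C ∧ ∀ L n : ℕ, Odd L →
      ∀ κ : Fin 4 → ℝ, (∀ ν, |κ ν| ≤ Real.pi) → ∀ k : Fin 4 → ℂ, (∀ ν, ‖k ν - κ ν‖ ≤ r) →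
        (∀ ℓ ∈ shifts (scale L n), ℓ ≠ 0 ∨ (∃ ν, Real.pi ≤ |κ ν|) →
          c ≤ ‖diffSymbol (L ^ n) hhat (shift k ℓ)‖) ∧
        ‖diffSymbol (L ^ n) hhat k‖ ≤ C := by
  obtain ⟨r, hr, hr1, c, hc, C, hC, hb⟩ := exists_diffSymbol_bounds H
  have hpi := Real.pi_pos
  refine ⟨r, hr, hr1, c, hc, C, hC, fun L n hL κ hκ k hk => ?_⟩
  have hM : 0 < L ^ n := pow_pos hL.pos n
  have hzone : ∀ ℓ ∈ shifts (scale L n), ∀ ν,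
      |κ ν + 2 * Real.pi * ℓ ν| ≤ Real.pi * (scale L n ν : ℕ) := by
    intro ℓ hℓ ν
    have h1 := two_mul_abs_le_of_mem_residues_odd (scale_odd hL n ν) (Fintype.mem_piFinset.mp hℓ ν)
    calc |κ ν + 2 * Real.pi * ℓ ν| ≤ |κ ν| + |2 * Real.pi * ℓ ν| := abs_add_le _ _
      _ = |κ ν| + Real.pi * (2 * |(ℓ ν:ℝ)|) := by
          rw [abs_mul, abs_of_pos Real.two_pi_pos]; ring
      _ ≤ Real.pi + Real.pi * ((scale L n ν : ℕ) - 1) := by gcongr; exact hκ ν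
      _ = _ := by ring
  have hbℓ : ∀ ℓ ∈ shifts (scale L n), _ := fun ℓ hℓ => hb (L ^ n) hM
    (fun ν => κ ν + 2 * Real.pi * ℓ ν) (by simpa using hzone ℓ hℓ 0)
    (fun i => by simpa using hzone ℓ hℓ i.succ) (shift k ℓ)
    (fun ν => by
      have : shift k ℓ ν - ((κ ν + 2 * Real.pi * ℓ ν : ℝ) : ℂ) = k ν - κ ν := by
        simp [shift]
      rw [this]; exact hk ν)
  refine ⟨fun ℓ hℓ hor => (hbℓ ℓ hℓ).1 ?_, ?_⟩
  · by_cases hℓ0 : ℓ = 0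
    · obtain ⟨ν, hν⟩ := hor.resolve_left (not_not.mpr hℓ0)
      exact ⟨ν, by simpa [hℓ0] using hν⟩
    · obtain ⟨ν, hν⟩ := Function.ne_iff.mp hℓ0
      refine ⟨ν, ?_⟩
      have h1 : (1 : ℝ) ≤ |(ℓ ν : ℝ)| := by exact_mod_cast Int.one_le_abs hν
      have h2 : |2 * Real.pi * (ℓ ν : ℝ)| ≤ |κ ν + 2 * Real.pi * ℓ ν| + |κ ν| := by
        have : 2 * Real.pi * (ℓ ν : ℝ) = (κ ν + 2 * Real.pi * ℓ ν) - κ ν := by ring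
        nth_rewrite 1 [this]
        exact abs_sub _ _
      rw [abs_mul, abs_of_pos Real.two_pi_pos] at h2
      nlinarith [hκ ν]
  · have h0 := (hbℓ 0 (zero_mem_shifts (scale_odd hL n))).2 (by simpa using hκ)
    rwa [shift_zero] at h0

/-- The delicate point is the lower bound for the denominator near the zero of D. At real momenta
two estimates complement each other: one is good when |D(κ)| is large, the other when it is small.
Analyticity extends the result to a complex neighbourhood, and the decay of the averaging symbol
makes the coefficients summable. -/
theorem exists_greenSymbol_bounds {𝔮 : ℕ} (h𝔮 : 2 ≤ 𝔮) {a : ℝ} (ha : 0 < a)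
    {h : (Fin 3 → ℤ) → ℂ} {hhat : (Fin 3 → ℂ) → ℂ} (H : IsHamiltonian h hhat) :
    ∃ m : ℝ, 0 < m ∧ m ≤ 1 ∧ ∃ C : ℝ, 0 < C ∧ ∀ L n : ℕ, Odd L → 1 < L →
      ∀ κ : Fin 4 → ℝ, (∀ ν, |κ ν| ≤ Real.pi) → ∀ k : Fin 4 → ℂ, (∀ ν, ‖k ν - κ ν‖ ≤ m) →
        (∀ ℓ ∈ shifts (scale L n), ℓ ≠ 0 ∨ (∃ ν, Real.pi ≤ |κ ν|) →
          diffSymbol (L ^ n) hhat (shift k ℓ) ≠ 0) ∧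
        greenDenom 𝔮 L n a hhat k ≠ 0 ∧
        ∑ ℓ ∈ shifts (scale L n), ‖greenSymbol 𝔮 L n a hhat k ℓ‖ ≤ C := by
  obtain ⟨r, hr, hr1, c, hc, CD, hCD, hD⟩ := exists_diffSymbol_shift_bounds H
  obtain ⟨Cu, hCu, hu⟩ := exists_norm_avgSymbol_le h𝔮
  obtain ⟨Cg, hCg, hg⟩ := exists_norm_gramSymbol_le h𝔮
  obtain ⟨W, hW, hWb⟩ := exists_sum_weight_le
  set Cr := 1 + CD / c with hCr
  have hCr0 : 0 < Cr := by positivity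
  set B := CD * (Cg / a) + Cu ^ 2 * W * Cr with hB
  have hB0 : 0 < B := by positivity
  set C₁ := Cg / a + Cu ^ 2 * W / c with hC₁
  have hC₁0 : 0 < C₁ := by positivity
  set c₃ := (((1 / 2 : ℝ) ^ 𝔮) ^ 4) ^ 2 / (1 + a * C₁) with hc₃
  have hc₃0 : 0 < c₃ := by positivity
  set m := min (r / 2) (r * c₃ / (4 * B)) with hm
  have hm0 : 0 < m := by positivity
  have hmr : m < r := (min_le_left _ _).trans_lt (by linarith)
  refine ⟨m, hm0, by linarith, Cg / a * Cu * Cr * W / (c₃ / 2), by positivity,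
    fun L n hL hL1 κ hκ => ?_⟩
  set M := L ^ n with hM
  set s := scale L n with hs
  have hso : ∀ ν, Odd (s ν) := scale_odd hL n
  have hsq : ∀ k : Fin 4 → ℂ, (∀ ν, ‖k ν - κ ν‖ ≤ r) → ∀ ℓ ∈ shifts s,
      ‖avgSymbol 𝔮 s (shift k ℓ)‖ ^ 2 ≤ Cu ^ 2 * weight ℓ := by
    intro k hk ℓ hℓ
    have h1 := hu s hso κ hκ k (fun ν => (hk ν).trans hr1) ℓ hℓ
    have h2 := weight_pos ℓ
    calc _ ≤ (Cu * weight ℓ) ^ 2 := by gcongr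
      _ = Cu ^ 2 * weight ℓ * weight ℓ := by ring
      _ ≤ Cu ^ 2 * weight ℓ * 1 := by gcongr; exact weight_le_one ℓ
      _ = _ := mul_one _
  have hratio : ∀ k : Fin 4 → ℂ, (∀ ν, ‖k ν - κ ν‖ ≤ r) → ∀ ℓ ∈ shifts s,
      ‖diffRatio M hhat k ℓ‖ ≤ Cr := by
    intro k hk ℓ hℓ
    rw [diffRatio]
    split_ifs with h0
    · rw [norm_one, hCr]; linarith [div_pos hCD hc]
    · rw [norm_div]
      have h1 := (hD L n hL κ hκ k hk)
      calc _ ≤ CD / c := by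
            gcongr
            · exact h1.2
            · exact h1.1 ℓ hℓ (Or.inl h0)
        _ ≤ Cr := by rw [hCr]; linarith
  have hga : ∀ k : Fin 4 → ℂ, (∀ ν, ‖k ν - κ ν‖ ≤ r) →
      ‖gramSymbol 𝔮 L n k / a‖ ≤ Cg / a := by
    intro k hk
    rw [norm_div, Complex.norm_real, Real.norm_eq_abs, abs_of_pos ha]
    gcongr
    exact hg L hL hL1 n κ hκ k fun ν => (hk ν).trans hr1
  have hub : ∀ k : Fin 4 → ℂ, (∀ ν, ‖k ν - κ ν‖ ≤ r) → ‖greenDenom 𝔮 L n a hhat k‖ ≤ B := by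
    intro k hk
    refine (norm_add_le _ _).trans ?_
    rw [hB]
    gcongr
    · rw [norm_mul]
      have := (hD L n hL κ hκ k hk).2
      have := hga k hk
      gcongr
    · calc _ ≤ ∑ ℓ ∈ shifts s, Cu ^ 2 * weight ℓ * Cr := by
            refine norm_sum_le_of_le _ fun ℓ hℓ => ?_
            rw [norm_mul, norm_pow]
            have := hsq k hk ℓ hℓ
            have := hratio k hk ℓ hℓ
            have := weight_pos ℓ
            gcongr
        _ ≤ _ := by
            rw [← Finset.sum_mul, ← Finset.mul_sum]
            gcongr
            exact hWb s
  -- the lower bound for real momenta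
  set κc : Fin 4 → ℂ := fun ν => (κ ν : ℂ) with hκc
  have hκr : ∀ ν, ‖κc ν - κ ν‖ ≤ r := fun ν => by simp [hκc, hr.le]
  have hDκ := hD L n hL κ hκ κc hκr
  set d := diffSymbol M hhat κc with hd
  -- After extracting the factor D(κ), the first term of the other factor is at least 1/a and every
  -- summand has nonnegative real part, because u is real and Re D ≥ 0 implies Re D⁻¹ ≥ 0.
  have hlow1 : ‖d‖ / a ≤ ‖greenDenom 𝔮 L n a hhat κc‖ := by
    by_cases hd0 : d = 0
    · rw [hd0]; simp
    have hfac : greenDenom 𝔮 L n a hhat κc = d * (gramSymbol 𝔮 L n κc / a +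
        ∑ ℓ ∈ shifts s, avgSymbol 𝔮 s (shift κc ℓ) ^ 2 * (diffSymbol M hhat (shift κc ℓ))⁻¹) := by
      rw [greenDenom, mul_add, Finset.mul_sum]
      congr 1
      refine Finset.sum_congr rfl fun ℓ _ => ?_
      rw [diffRatio]
      split_ifs with h0
      · rw [h0, shift_zero, ← hd]; field_simp; rfl
      · rw [← hd]; ring
    rw [hfac, norm_mul, div_eq_mul_inv]
    gcongr
    refine le_trans ?_ (Complex.re_le_norm _)
    obtain ⟨γ, hγ, hγe⟩ := exists_gramSymbol_ofReal 𝔮 hL n κ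
    rw [Complex.add_re, Complex.re_sum, hγe, ← Complex.ofReal_div, Complex.ofReal_re]
    have h1 : a⁻¹ ≤ γ / a := by rw [inv_eq_one_div]; gcongr
    refine h1.trans (le_add_of_nonneg_right (Finset.sum_nonneg fun ℓ _ => ?_))
    obtain ⟨ρ, hρ⟩ := exists_avgSymbol_shift_ofReal 𝔮 hso κ ℓ
    rw [hρ, ← Complex.ofReal_pow, Complex.re_ofReal_mul]
    refine mul_nonneg (sq_nonneg _) ?_
    rw [Complex.inv_re]
    refine div_nonneg ?_ (Complex.normSq_nonneg _)
    rw [hκc, shift_ofReal]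
    exact re_diffSymbol_nonneg H M _
  -- The term ℓ = 0 is u(κ)², which is bounded below; everything else carries a factor D(κ).
  have hlow2 : (((1 / 2 : ℝ) ^ 𝔮) ^ 4) ^ 2 - ‖d‖ * C₁ ≤ ‖greenDenom 𝔮 L n a hhat κc‖ := by
    have h0 := zero_mem_shifts hso
    have hfac : greenDenom 𝔮 L n a hhat κc = avgSymbol 𝔮 s κc ^ 2 - -(d * (gramSymbol 𝔮 L n κc / a +
        ∑ ℓ ∈ (shifts s).erase 0,
          avgSymbol 𝔮 s (shift κc ℓ) ^ 2 * (diffSymbol M hhat (shift κc ℓ))⁻¹)) := by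
      rw [greenDenom, ← Finset.add_sum_erase _ _ h0, shift_zero, diffRatio, if_pos rfl,
        mul_add, Finset.mul_sum]
      have : ∀ ℓ ∈ (shifts s).erase 0, avgSymbol 𝔮 s (shift κc ℓ) ^ 2 * diffRatio M hhat κc ℓ =
          d * (avgSymbol 𝔮 s (shift κc ℓ) ^ 2 * (diffSymbol M hhat (shift κc ℓ))⁻¹) := by
        intro ℓ hℓ
        rw [diffRatio, if_neg (Finset.ne_of_mem_erase hℓ)]
        ring
      rw [Finset.sum_congr rfl this]
      ring
    rw [hfac]
    refine le_trans ?_ (norm_sub_norm_le _ _)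
    rw [norm_neg, norm_mul, norm_pow]
    have h1 := le_norm_avgSymbol_ofReal 𝔮 hso κ hκ
    gcongr
    refine (norm_add_le _ _).trans ?_
    rw [hC₁]
    gcongr
    · exact hga κc hκr
    · calc _ ≤ ∑ ℓ ∈ (shifts s).erase 0, Cu ^ 2 * weight ℓ * c⁻¹ := by
            refine norm_sum_le_of_le _ fun ℓ hℓ => ?_
            rw [norm_mul, norm_pow, norm_inv]
            have h2 := hsq κc hκr ℓ (Finset.mem_of_mem_erase hℓ)
            have h3 := hDκ.1 ℓ (Finset.mem_of_mem_erase hℓ) (Or.inl (Finset.ne_of_mem_erase hℓ))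
            have := weight_pos ℓ
            gcongr
        _ ≤ ∑ ℓ ∈ shifts s, Cu ^ 2 * weight ℓ * c⁻¹ :=
            Finset.sum_le_sum_of_subset_of_nonneg (Finset.erase_subset _ _) fun ℓ _ _ => by
              have := weight_pos ℓ
              positivity
        _ ≤ _ := by
            rw [← Finset.sum_mul, ← Finset.mul_sum, div_eq_mul_inv]
            gcongr
            exact hWb s
  -- Adding a·C₁ times the first estimate to the second eliminates |D(κ)|, whence the form of c₃.
  have hlow : c₃ ≤ ‖greenDenom 𝔮 L n a hhat κc‖ := by
    rw [hc₃, div_le_iff₀ (by positivity)]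
    rw [div_le_iff₀ ha] at hlow1
    nlinarith
  -- the lower bound for complex momenta
  have hclow : ∀ k : Fin 4 → ℂ, (∀ ν, ‖k ν - κ ν‖ ≤ m) →
      c₃ / 2 ≤ ‖greenDenom 𝔮 L n a hhat k‖ := by
    intro k hk
    have hball : ∀ z ∈ Metric.ball κc r, ∀ ν, ‖z ν - κ ν‖ ≤ r := by
      intro z hz ν
      have h1 := norm_le_pi_norm (z - κc) ν
      rw [Metric.mem_ball, dist_eq_norm] at hz
      exact h1.trans hz.le
    have hkn : ‖k - κc‖ ≤ m := (pi_norm_le_iff_of_nonneg hm0.le).mpr hk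
    -- Since the denominator is analytic and bounded by B on the polydisc of radius r, it is
    -- Lipschitz around its centre with constant 2B/r; the bound r c₃/(4B) on m therefore costs at
    -- most c₃/2.
    have := Complex.dist_le_div_mul_dist_of_mapsTo_ball (f := greenDenom 𝔮 L n a hhat) (c := κc)
      (z := k) (R₁ := r) (R₂ := 2 * B)
      (fun z hz => (differentiableAt_greenDenom 𝔮 L n a H.entire fun ℓ hℓ h0 =>
        norm_pos_iff.mp (hc.trans_le ((hD L n hL κ hκ z (hball z hz)).1 ℓ hℓ (Or.inl
          h0)))).differentiableWithinAt)
      (fun z hz => by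
        rw [Metric.mem_closedBall, dist_eq_norm]
        refine (norm_sub_le _ _).trans ?_
        linarith [hub z (hball z hz), hub κc hκr])
      (by rw [Metric.mem_ball, dist_eq_norm]; linarith)
    rw [dist_eq_norm, dist_eq_norm] at this
    have h1 : 2 * B / r * ‖k - κc‖ ≤ c₃ / 2 := by
      calc 2 * B / r * ‖k - κc‖ ≤ 2 * B / r * (r * c₃ / (4 * B)) := by
            gcongr; exact hkn.trans (min_le_right _ _)
        _ = c₃ / 2 := by field_simp; norm_num
    have h2 : ‖greenDenom 𝔮 L n a hhat κc‖ ≤ ‖greenDenom 𝔮 L n a hhat k‖ +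
        ‖greenDenom 𝔮 L n a hhat k - greenDenom 𝔮 L n a hhat κc‖ := by
      rw [norm_sub_rev]
      have := norm_add_le (greenDenom 𝔮 L n a hhat k)
        (greenDenom 𝔮 L n a hhat κc - greenDenom 𝔮 L n a hhat k)
      simpa using this
    linarith
  intro k hk
  have hkr : ∀ ν, ‖k ν - κ ν‖ ≤ r := fun ν => (hk ν).trans hmr.le
  refine ⟨fun ℓ hℓ hor => norm_pos_iff.mp (hc.trans_le ((hD L n hL κ hκ k hkr).1 ℓ hℓ hor)),
    norm_pos_iff.mp (lt_of_lt_of_le (by positivity) (hclow k hk)), ?_⟩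
  calc _ ≤ ∑ ℓ ∈ shifts s, Cg / a * (Cu * weight ℓ) * Cr / (c₃ / 2) := by
        refine Finset.sum_le_sum fun ℓ hℓ => ?_
        rw [greenSymbol, norm_div, norm_mul, norm_mul]
        have h1 := hga k hkr
        have h2 := hu s hso κ hκ k (fun ν => (hkr ν).trans hr1) ℓ hℓ
        have h3 := hratio k hkr ℓ hℓ
        have h4 := hclow k hk
        have := weight_pos ℓ
        gcongr
    _ = Cg / a * Cu * Cr * (∑ ℓ ∈ shifts s, weight ℓ) / (c₃ / 2) := by
        rw [Finset.mul_sum, Finset.sum_div]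
        exact Finset.sum_congr rfl fun ℓ _ => by ring
    _ ≤ _ := by gcongr; exact hWb s

/-! ### Periodicity -/

/-- Adding 1 to one component permutes the residues modulo `s ν` cyclically. Only the last residue
leaves the set, and periodicity of f brings it back. -/
theorem sum_shifts_add_single {s : Fin 4 → ℕ} (ν : Fin 4) (f : (Fin 4 → ℤ) → ℂ)
    (hf : ∀ ℓ, f (ℓ + Pi.single ν (s ν : ℤ)) = f ℓ) :
    ∑ ℓ ∈ shifts s, f (ℓ + Pi.single ν 1) = ∑ ℓ ∈ shifts s, f ℓ := by
  have hmem : ∀ (ℓ : Fin 4 → ℤ) (x : ℤ), ℓ ∈ shifts s → x ∈ residues (s ν) →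
      Function.update ℓ ν x ∈ shifts s := by
    intro ℓ x hℓ hx
    rw [shifts, Fintype.mem_piFinset] at *
    intro μ
    by_cases hμ : μ = ν
    · subst hμ; simpa using hx
    · simpa [Function.update_of_ne hμ] using hℓ μ
  refine Finset.sum_nbij'
    (fun ℓ => Function.update ℓ ν
      (if ℓ ν + 1 ∈ residues (s ν) then ℓ ν + 1 else ℓ ν + 1 - s ν))
    (fun ℓ => Function.update ℓ ν
      (if ℓ ν - 1 ∈ residues (s ν) then ℓ ν - 1 else ℓ ν - 1 + s ν)) ?_ ?_ ?_ ?_ ?_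
  · intro ℓ hℓ
    refine hmem ℓ _ hℓ ?_
    have h1 := Fintype.mem_piFinset.mp hℓ ν
    split_ifs with h2
    · exact h2
    · rw [mem_residues] at *; omega
  · intro ℓ hℓ
    refine hmem ℓ _ hℓ ?_
    have h1 := Fintype.mem_piFinset.mp hℓ ν
    split_ifs with h2
    · exact h2
    · rw [mem_residues] at *; omega
  · intro ℓ hℓ
    have h1 := Fintype.mem_piFinset.mp hℓ ν
    simp only [Function.update_self, Function.update_idem]
    rw [Function.update_eq_iff]
    refine ⟨?_, fun _ _ => rfl⟩
    simp only [mem_residues] at *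
    split_ifs <;> omega
  · intro ℓ hℓ
    have h1 := Fintype.mem_piFinset.mp hℓ ν
    simp only [Function.update_self, Function.update_idem]
    rw [Function.update_eq_iff]
    refine ⟨?_, fun _ _ => rfl⟩
    simp only [mem_residues] at *
    split_ifs <;> omega
  · intro ℓ _
    have h0 : ∀ x, ℓ + Pi.single ν x = Function.update ℓ ν (ℓ ν + x) := by
      intro x
      ext μ
      by_cases hμ : μ = ν
      · subst hμ; simp
      · simp [Function.update_of_ne hμ, Pi.single_eq_of_ne hμ]
    split_ifs with h2
    · rw [h0]
    · rw [h0, ← hf (Function.update ℓ ν (ℓ ν + 1 - s ν))]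
      congr 1
      ext μ
      by_cases hμ : μ = ν
      · subst hμ; simp
      · simp [Function.update_of_ne hμ, Pi.single_eq_of_ne hμ]

theorem shift_add_single (k : Fin 4 → ℂ) (ν : Fin 4) (ℓ : Fin 4 → ℤ) (x : ℤ) :
    shift k (ℓ + Pi.single ν x) = shift k ℓ + Pi.single ν (2 * Real.pi * (x : ℂ)) := by
  ext μ
  by_cases hμ : μ = ν
  · subst hμ; simp [shift]; ring
  · simp [shift, Pi.single_eq_of_ne hμ]

theorem shift_single_add (k : Fin 4 → ℂ) (ν : Fin 4) (ℓ : Fin 4 → ℤ) :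
    shift (k + Pi.single ν (2 * Real.pi : ℂ)) ℓ = shift k (ℓ + Pi.single ν 1) := by
  ext μ
  by_cases hμ : μ = ν
  · subst hμ; simp [shift]; ring
  · simp [shift, Pi.single_eq_of_ne hμ]

theorem avgSymbol_add_single (𝔮 : ℕ) (s : Fin 4 → ℕ) (ν : Fin 4) (p : Fin 4 → ℂ) :
    avgSymbol 𝔮 s (p + Pi.single ν (2 * Real.pi * ((s ν : ℤ) : ℂ))) = avgSymbol 𝔮 s p := by
  refine Finset.prod_congr rfl fun μ _ => ?_
  by_cases hμ : μ = ν
  · subst hμ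
    have := dirichlet_add_two_pi_mul (s μ) (p μ)
    simp [this]
  · simp [Pi.single_eq_of_ne hμ]

theorem gramSymbol_add_single (𝔮 L n : ℕ) (ν : Fin 4) (k : Fin 4 → ℂ) :
    gramSymbol 𝔮 L n (k + Pi.single ν (2 * Real.pi : ℂ)) = gramSymbol 𝔮 L n k := by
  simp only [gramSymbol, shift_single_add]
  refine congrArg (1 + ·) (Finset.sum_congr rfl fun j _ => congrArg (fun x => ((L : ℂ) ^ (2 * j))⁻¹ * x) ?_)
  refine sum_shifts_add_single ν (fun ℓ => avgSymbol 𝔮 (scale L j) (shift k ℓ) ^ 2) fun ℓ => ?_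
  rw [shift_add_single, avgSymbol_add_single]

/-- In the time direction the period comes from the exponential, in a space direction from the
Hamiltonian. The latter is known only when the remaining components are real, hence `hp`. -/
theorem diffSymbol_add_single {h : (Fin 3 → ℤ) → ℂ} {hhat : (Fin 3 → ℂ) → ℂ}
    (H : IsHamiltonian h hhat) {L : ℕ} (hL : 0 < L) (n : ℕ) (ν : Fin 4) (p : Fin 4 → ℂ)
    (hp : ∀ μ ≠ ν, (p μ).im = 0) :
    diffSymbol (L ^ n) hhat (p + Pi.single ν (2 * Real.pi * ((scale L n ν : ℤ) : ℂ))) =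
      diffSymbol (L ^ n) hhat p := by
  have hM : ((L ^ n : ℕ) : ℂ) ≠ 0 := Nat.cast_ne_zero.mpr (pow_pos hL n).ne'
  revert hp
  refine Fin.cases (fun _ => ?_) (fun i hp => ?_) ν
  · have h1 : spatial (L ^ n) (p + Pi.single 0 (2 * Real.pi * ((scale L n 0 : ℤ) : ℂ))) =
        spatial (L ^ n) p := by
      ext i; simp [spatial]
    rw [diffSymbol, diffSymbol, h1]
    congr 2
    rw [Complex.exp_eq_exp_iff_exists_int]
    refine ⟨1, ?_⟩
    simp only [Pi.add_apply, Pi.single_eq_same, scale_zero]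
    push_cast at hM ⊢
    field_simp
    ring
  · set q : Fin 3 → ℝ := fun j => (p j.succ).re / (L ^ n : ℕ) with hq
    have h2 : spatial (L ^ n) p =
        Function.update (fun j => (q j : ℂ)) i (p i.succ / (L ^ n : ℕ)) := by
      ext j
      by_cases hj : j = i
      · subst hj; simp [spatial]
      · rw [Function.update_of_ne hj, spatial, hq]
        have h3 := hp j.succ (by simpa using hj)
        have h4 : p j.succ = ((p j.succ).re : ℂ) := by
          apply Complex.ext <;> simp [h3]
        rw [h4]
        push_cast
        simp
    have h3 : spatial (L ^ n) (p + Pi.single i.succ (2 * Real.pi * ((scale L n i.succ : ℤ) : ℂ))) =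
        Function.update (fun j => (q j : ℂ)) i (p i.succ / (L ^ n : ℕ) + 2 * Real.pi) := by
      ext j
      by_cases hj : j = i
      · subst hj
        simp only [spatial, Pi.add_apply, Pi.single_eq_same, scale_succ, Function.update_self]
        push_cast at hM ⊢
        field_simp
      · rw [Function.update_of_ne hj]
        have h4 := congrFun h2 j
        rw [Function.update_of_ne hj] at h4
        rw [← h4]
        simp [spatial, hj]
    have h0 : (p + Pi.single i.succ (2 * Real.pi * ((scale L n i.succ : ℤ) : ℂ)) :
        Fin 4 → ℂ) 0 = p 0 := by simp
    rw [diffSymbol, diffSymbol, h3, h2, H.apply_update_add_two_pi, h0]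

/-- The plane wave with momentum `p`. -/
def wave (p : Fin 4 → ℂ) (y : Fin 4 → ℝ) : ℂ := Complex.exp (Complex.I * ∑ ν, p ν * y ν)

theorem wave_add_single (p : Fin 4 → ℂ) (y : Fin 4 → ℝ) (ν : Fin 4) (x z : ℤ)
    (hx : y ν * x = z) :
    wave (p + Pi.single ν (2 * Real.pi * (x : ℂ))) y = wave p y := by
  rw [wave, wave, Complex.exp_eq_exp_iff_exists_int]
  refine ⟨z, ?_⟩
  have h1 : (y ν : ℂ) * x = z := by exact_mod_cast hx
  simp only [Pi.add_apply, add_mul, Finset.sum_add_distrib]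
  rw [Finset.sum_eq_single_of_mem (f := fun i =>
    (Pi.single ν (2 * Real.pi * (x : ℂ)) : Fin 4 → ℂ) i * (y i : ℂ)) ν (Finset.mem_univ ν)
    (fun μ _ hμ => by simp [Pi.single_eq_of_ne hμ])]
  rw [Pi.single_eq_same, ← h1]
  ring

/-- The integral kernel of `S_n Q_n^*`, Fourier transformed with respect to the unit lattice. -/
def greenFiber (𝔮 L n : ℕ) (a : ℝ) (hhat : (Fin 3 → ℂ) → ℂ) (y : Fin 4 → ℝ)
    (k : Fin 4 → ℂ) : ℂ :=
  ∑ ℓ ∈ shifts (scale L n), greenSymbol 𝔮 L n a hhat k ℓ * wave (shift k ℓ) y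

/-- The normalisation by D(k) singles out ℓ = 0 and hides the periodicity in k. Where D(k) ≠ 0 it
can be undone, and the resulting sums treat all ℓ alike, so that shifting k by 2π merely relabels
them. -/
theorem greenFiber_eq (𝔮 L n : ℕ) (a : ℝ) (hhat : (Fin 3 → ℂ) → ℂ) (y : Fin 4 → ℝ)
    {k : Fin 4 → ℂ} (hk : diffSymbol (L ^ n) hhat k ≠ 0) :
    greenFiber 𝔮 L n a hhat y k = gramSymbol 𝔮 L n k / a *
      (∑ ℓ ∈ shifts (scale L n), avgSymbol 𝔮 (scale L n) (shift k ℓ) *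
        (diffSymbol (L ^ n) hhat (shift k ℓ))⁻¹ * wave (shift k ℓ) y) /
      (gramSymbol 𝔮 L n k / a + ∑ ℓ ∈ shifts (scale L n), avgSymbol 𝔮 (scale L n) (shift k ℓ) ^ 2 *
        (diffSymbol (L ^ n) hhat (shift k ℓ))⁻¹) := by
  have h1 : ∀ ℓ, diffRatio (L ^ n) hhat k ℓ =
      diffSymbol (L ^ n) hhat k * (diffSymbol (L ^ n) hhat (shift k ℓ))⁻¹ := by
    intro ℓ
    rw [diffRatio]
    split_ifs with h0
    · rw [h0, shift_zero, mul_inv_cancel₀ hk]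
    · rw [div_eq_mul_inv]
  set E := gramSymbol 𝔮 L n k / a + ∑ ℓ ∈ shifts (scale L n),
    avgSymbol 𝔮 (scale L n) (shift k ℓ) ^ 2 * (diffSymbol (L ^ n) hhat (shift k ℓ))⁻¹ with hE
  have h2 : greenDenom 𝔮 L n a hhat k = diffSymbol (L ^ n) hhat k * E := by
    rw [greenDenom, hE, mul_add, Finset.mul_sum]
    congr 1
    exact Finset.sum_congr rfl fun ℓ _ => by rw [h1]; ring
  rw [greenFiber, Finset.mul_sum, Finset.sum_div]
  refine Finset.sum_congr rfl fun ℓ _ => ?_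
  rw [greenSymbol, h2, h1]
  field_simp

theorem greenFiber_add_single {𝔮 L n : ℕ} {a : ℝ} {h : (Fin 3 → ℤ) → ℂ}
    {hhat : (Fin 3 → ℂ) → ℂ} (H : IsHamiltonian h hhat) (hL : 0 < L) {y : Fin 4 → ℝ} {ν : Fin 4}
    {z : ℤ} (hy : y ν * ((scale L n ν : ℕ) : ℤ) = z) {k : Fin 4 → ℂ} (hkr : ∀ μ ≠ ν, (k μ).im = 0)
    (hk : diffSymbol (L ^ n) hhat k ≠ 0)
    (hk' : diffSymbol (L ^ n) hhat (k + Pi.single ν (2 * Real.pi : ℂ)) ≠ 0) :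
    greenFiber 𝔮 L n a hhat y (k + Pi.single ν (2 * Real.pi : ℂ)) =
      greenFiber 𝔮 L n a hhat y k := by
  have hD : ∀ ℓ, diffSymbol (L ^ n) hhat (shift k (ℓ + Pi.single ν ((scale L n ν : ℕ) : ℤ))) =
      diffSymbol (L ^ n) hhat (shift k ℓ) := by
    intro ℓ
    rw [shift_add_single]
    exact diffSymbol_add_single H hL n ν _ fun μ hμ => by simp [shift, hkr μ hμ]
  have hu : ∀ ℓ, avgSymbol 𝔮 (scale L n) (shift k (ℓ + Pi.single ν ((scale L n ν : ℕ) : ℤ))) =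
      avgSymbol 𝔮 (scale L n) (shift k ℓ) := by
    intro ℓ
    rw [shift_add_single]
    exact avgSymbol_add_single 𝔮 _ ν _
  have hw : ∀ ℓ, wave (shift k (ℓ + Pi.single ν ((scale L n ν : ℕ) : ℤ))) y =
      wave (shift k ℓ) y := by
    intro ℓ
    rw [shift_add_single]
    exact wave_add_single _ _ _ _ _ hy
  rw [greenFiber_eq 𝔮 L n a hhat y hk, greenFiber_eq 𝔮 L n a hhat y hk', gramSymbol_add_single]
  simp only [shift_single_add]
  rw [sum_shifts_add_single ν (fun ℓ => avgSymbol 𝔮 (scale L n) (shift k ℓ) *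
        (diffSymbol (L ^ n) hhat (shift k ℓ))⁻¹ * wave (shift k ℓ) y)
        (fun ℓ => by simp only [hD, hu, hw]),
    sum_shifts_add_single ν (fun ℓ => avgSymbol 𝔮 (scale L n) (shift k ℓ) ^ 2 *
        (diffSymbol (L ^ n) hhat (shift k ℓ))⁻¹) (fun ℓ => by simp only [hD, hu])]

/-! ### Discrete Fourier transforms of analytic functions -/

theorem sum_residues_exp (N : ℕ) (x : ℤ) :
    ∑ b ∈ residues N, Complex.exp (Complex.I * (2 * Real.pi * (b : ℂ) / N) * x) =
      if (N : ℤ) ∣ x then (N : ℂ) else 0 := by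
  rcases eq_or_ne N 0 with rfl | hN
  · simp [residues]
  have hNc : (N : ℂ) ≠ 0 := Nat.cast_ne_zero.mpr hN
  split_ifs with hx
  · obtain ⟨z, rfl⟩ := hx
    have : ∀ b ∈ residues N,
        Complex.exp (Complex.I * (2 * Real.pi * (b : ℂ) / N) * ((N : ℤ) * z : ℤ)) = 1 := by
      intro b _
      rw [Complex.exp_eq_one_iff]
      exact ⟨b * z, by push_cast; field_simp⟩
    rw [Finset.sum_congr rfl this, Finset.sum_const, card_residues]
    simp
  · set ζ := Complex.exp (Complex.I * (2 * Real.pi / N) * x) with hζ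
    have hζ1 : ζ ≠ 1 := by
      rw [hζ, Ne, Complex.exp_eq_one_iff]
      rintro ⟨z, hz⟩
      apply hx
      refine ⟨z, ?_⟩
      have h1 : (x : ℂ) = N * z := by
        have h2 : (2 * Real.pi * Complex.I : ℂ) ≠ 0 := Complex.two_pi_I_ne_zero
        field_simp at hz
        refine mul_left_cancel₀ h2 ?_
        linear_combination (2 * Real.pi * Complex.I : ℂ) * hz
      exact_mod_cast h1
    have hζN : ζ ^ N = 1 := by
      rw [hζ, ← Complex.exp_nat_mul, Complex.exp_eq_one_iff]
      exact ⟨x, by field_simp⟩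
    rw [sum_residues_eq_sum_range]
    have : ∀ i ∈ Finset.range N, Complex.exp (Complex.I *
        (2 * Real.pi * ((((i : ℕ) : ℤ) - ((N / 2 : ℕ) : ℤ) : ℤ) : ℂ) / N) * x) =
        Complex.exp (-(Complex.I * (2 * Real.pi / N) * x * ((N / 2 : ℕ) : ℂ))) * ζ ^ i := by
      intro i _
      rw [hζ, ← Complex.exp_nat_mul, ← Complex.exp_add, Int.cast_sub, Int.cast_natCast,
        Int.cast_natCast]
      congr 1
      ring
    rw [Finset.sum_congr rfl this, ← Finset.mul_sum]
    have h2 := geom_sum_mul ζ N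
    rw [hζN, sub_self] at h2
    rw [(mul_eq_zero.mp h2).resolve_right (sub_ne_zero.mpr hζ1), mul_zero]

theorem summable_exp_neg_mul_abs {m : ℝ} (hm : 0 < m) :
    Summable fun x : ℤ => Real.exp (-(m * |(x : ℝ)|)) := by
  have h : Summable fun n : ℕ => Real.exp (-(m * (n : ℝ))) := by
    have := Real.summable_exp_nat_mul_iff.mpr (neg_lt_zero.mpr hm)
    refine this.congr fun n => ?_
    congr 1; ring
  refine Summable.of_nat_of_neg ?_ ?_
  · simpa using h
  · simpa using h

section Strip

variable {f : ℂ → ℂ} {m C : ℝ}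

/-- Cauchy's theorem on a rectangle; the vertical sides cancel by periodicity. Only the values on
the two edges are compared, so g need not be periodic elsewhere. -/
theorem integral_shift_strip {η : ℝ} {g : ℂ → ℂ} (hη : |η| ≤ m)
    (hd : ∀ z : ℂ, |z.re| ≤ Real.pi → |z.im| ≤ m → DifferentiableAt ℂ g z)
    (hper : ∀ t : ℝ, |t| ≤ m → g (-Real.pi + t * Complex.I) = g (Real.pi + t * Complex.I)) :
    ∫ x in (-Real.pi)..Real.pi, g x = ∫ x in (-Real.pi)..Real.pi, g (x + η * Complex.I) := by
  have hpi := Real.pi_pos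
  have hm0 : 0 ≤ m := (abs_nonneg _).trans hη
  have hseg : ∀ t ∈ Set.uIcc 0 η, |t| ≤ m := by
    intro t ht
    rcases Set.mem_uIcc.mp ht with h | h
    · rw [abs_le] at *; constructor <;> linarith
    · rw [abs_le] at *; constructor <;> linarith
  have h := Complex.integral_boundary_rect_eq_zero_of_differentiableOn g (-Real.pi : ℂ)
    (Real.pi + η * Complex.I) (fun z hz => by
      refine (hd z ?_ ?_).differentiableWithinAt
      · have h1 := hz.1
        simp at h1
        rw [Set.uIcc_of_le (by linarith)] at h1
        exact abs_le.mpr h1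
      · have h1 := hz.2
        simp at h1
        exact hseg _ h1)
  simp only [Complex.neg_re, Complex.ofReal_re, Complex.neg_im, Complex.ofReal_im, neg_zero,
    Complex.add_re, Complex.mul_re, Complex.I_re, mul_zero, Complex.I_im, mul_one, sub_self,
    add_zero, Complex.add_im, Complex.mul_im, zero_add, Complex.ofReal_zero, zero_mul] at h
  have h2 : ∫ y : ℝ in (0:ℝ)..η, g ((Real.pi : ℂ) + y * Complex.I) =
      ∫ y : ℝ in (0:ℝ)..η, g (((-Real.pi : ℝ) : ℂ) + y * Complex.I) := by
    refine intervalIntegral.integral_congr fun t ht => ?_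
    have := hper t (hseg t ht)
    push_cast
    exact this.symm
  rw [h2] at h
  simp only [add_sub_cancel_right] at h
  exact sub_eq_zero.mp h

theorem norm_integral_mul_exp_le (hm : 0 ≤ m)
    (hd : ∀ z : ℂ, |z.re| ≤ Real.pi → |z.im| ≤ m → DifferentiableAt ℂ f z)
    (hb : ∀ z : ℂ, |z.re| ≤ Real.pi → |z.im| ≤ m → ‖f z‖ ≤ C)
    (hper : ∀ t : ℝ, |t| ≤ m → f (-Real.pi + t * Complex.I) = f (Real.pi + t * Complex.I))
    (n : ℤ) :
    ‖∫ x in (-Real.pi)..Real.pi, f x * Complex.exp (-(Complex.I * n * x))‖ ≤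
      2 * Real.pi * (C * Real.exp (-(m * |(n : ℝ)|))) := by
  have hpi := Real.pi_pos
  -- The contour goes to the side of the strip on which the exponential is small, which depends on
  -- the sign of n.
  obtain ⟨η, hη, hηn⟩ : ∃ η : ℝ, |η| ≤ m ∧ n * η = -(m * |(n : ℝ)|) := by
    rcases abs_cases (n : ℝ) with h | h
    · exact ⟨-m, by rw [abs_neg, abs_of_nonneg hm], by rw [h.1]; ring⟩
    · exact ⟨m, by rw [abs_of_nonneg hm], by rw [h.1]; ring⟩
  have h1 := integral_shift_strip (m := m) (η := η)
    (g := fun z => f z * Complex.exp (-(Complex.I * n * z))) hη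
    (fun z hz1 hz2 => (hd z hz1 hz2).mul (by fun_prop))
    (fun t ht => by
      rw [hper t ht]
      congr 1
      rw [Complex.exp_eq_exp_iff_exists_int]
      exact ⟨n, by ring⟩)
  rw [h1]
  refine (intervalIntegral.norm_integral_le_of_norm_le_const
    (C := C * Real.exp (-(m * |(n : ℝ)|))) fun x hx => ?_).trans ?_
  · rw [Set.uIoc_of_le (by linarith)] at hx
    rw [norm_mul, Complex.norm_exp]
    have h2 : (-(Complex.I * n * (x + η * Complex.I))).re = n * η := by simp
    rw [h2, hηn]
    gcongr
    refine hb _ ?_ ?_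
    · simp only [Complex.add_re, Complex.ofReal_re, Complex.mul_re, Complex.I_re, mul_zero,
        Complex.ofReal_im, Complex.I_im, mul_one, sub_self, add_zero]
      exact abs_le.mpr ⟨hx.1.le, hx.2⟩
    · simpa using hη
  · have : |Real.pi - -Real.pi| = 2 * Real.pi := by
      rw [abs_of_pos (by linarith)]; ring
    rw [this, mul_comm]

/-- The restriction of f to [-π, π) is lifted to the circle, where it is continuous by `hper` at t =
0. The contour shift makes its Fourier coefficients summable, so the series converges to f
pointwise. -/
theorem exists_hasSum_fourier (hm : 0 < m)
    (hd : ∀ z : ℂ, |z.re| ≤ Real.pi → |z.im| ≤ m → DifferentiableAt ℂ f z)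
    (hb : ∀ z : ℂ, |z.re| ≤ Real.pi → |z.im| ≤ m → ‖f z‖ ≤ C)
    (hper : ∀ t : ℝ, |t| ≤ m → f (-Real.pi + t * Complex.I) = f (Real.pi + t * Complex.I)) :
    ∃ c : ℤ → ℂ, (∀ n, ‖c n‖ ≤ C * Real.exp (-(m * |(n : ℝ)|))) ∧
      ∀ x : ℝ, -Real.pi ≤ x → x < Real.pi →
        HasSum (fun n : ℤ => c n * Complex.exp (Complex.I * x * n)) (f x) := by
  have hpi := Real.pi_pos
  have : Fact (0 < 2 * Real.pi) := ⟨Real.two_pi_pos⟩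
  set fr : ℝ → ℂ := fun x => f x with hfr
  have h2pi : -Real.pi + 2 * Real.pi = Real.pi := by ring
  have hcont : Continuous (AddCircle.liftIco (2 * Real.pi) (-Real.pi) fr) := by
    refine AddCircle.liftIco_continuous ?_ ?_
    · rw [h2pi, hfr]
      have := hper 0 (by simpa using hm.le)
      simpa using this
    · rw [h2pi]
      intro x hx
      have h1 : ContinuousAt f (x : ℂ) :=
        (hd x (by simpa using abs_le.mpr hx) (by simpa using hm.le)).continuousAt
      exact (ContinuousAt.comp (g := f) h1
        Complex.continuous_ofReal.continuousAt).continuousWithinAt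
  set g : C(AddCircle (2 * Real.pi), ℂ) := ⟨_, hcont⟩ with hg
  have hcoef : ∀ n, ‖fourierCoeff g n‖ ≤ C * Real.exp (-(m * |(n : ℝ)|)) := by
    intro n
    have h1 : fourierCoeff g n = (1 / (2 * Real.pi) : ℝ) •
        ∫ x in (-Real.pi)..Real.pi, f x * Complex.exp (-(Complex.I * n * x)) := by
      have h2 := fourierCoeff_liftIco_eq (T := 2 * Real.pi) (a := -Real.pi) fr n
      have h3 : fourierCoeff g n =
        fourierCoeff (AddCircle.liftIco (2 * Real.pi) (-Real.pi) fr) n := rfl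
      rw [h3, h2, fourierCoeffOn_eq_integral]
      simp only [h2pi]
      congr 1
      · congr 1; ring
      refine intervalIntegral.integral_congr fun x _ => ?_
      simp only [fourier_coe_apply, smul_eq_mul, hfr]
      rw [mul_comm]
      congr 2
      push_cast
      have hpc : (Real.pi : ℂ) ≠ 0 := by exact_mod_cast hpi.ne'
      field_simp
      ring
    rw [h1, norm_smul, Real.norm_eq_abs, abs_of_pos (by positivity)]
    have h4 := norm_integral_mul_exp_le hm.le hd hb hper n
    rw [one_div, inv_mul_le_iff₀ (by positivity)]
    exact h4
  refine ⟨fourierCoeff g, hcoef, fun x hx1 hx2 => ?_⟩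
  have hsum : Summable (fourierCoeff g) :=
    Summable.of_norm_bounded ((summable_exp_neg_mul_abs hm).mul_left C) hcoef
  have h1 := has_pointwise_sum_fourier_series_of_summable hsum (x : AddCircle (2 * Real.pi))
  have h2 : g (x : AddCircle (2 * Real.pi)) = f x := by
    have := AddCircle.liftIco_coe_apply (p := 2 * Real.pi) (a := -Real.pi) (f := fr) (x := x)
      ⟨hx1, by rw [h2pi]; exact hx2⟩
    exact this
  rw [h2] at h1
  convert h1 using 1
  funext n
  rw [fourier_coe_apply, smul_eq_mul]
  congr 2
  have hpc : (Real.pi : ℂ) ≠ 0 := by exact_mod_cast hpi.ne'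
  push_cast
  field_simp

theorem norm_addCircle_le_abs {R : ℕ} {j n : ℤ} (hdvd : (R : ℤ) ∣ n + j) :
    ‖((j : ℝ) : AddCircle (R : ℝ))‖ ≤ |(n : ℝ)| := by
  obtain ⟨z, hz⟩ := hdvd
  have h1 : ((j : ℝ) : AddCircle (R : ℝ)) = ((-(n : ℝ) : ℝ) : AddCircle (R : ℝ)) := by
    have h2 : (j : ℝ) = -(n : ℝ) + z • (R : ℝ) := by
      have : (n : ℝ) + j = R * z := by exact_mod_cast hz
      rw [zsmul_eq_mul]; linarith
    rw [h2, AddCircle.coe_add, AddCircle.coe_zsmul, AddCircle.coe_period]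
    simp
  rw [h1, ← abs_neg (n : ℝ), ← Real.norm_eq_abs]
  exact QuotientAddGroup.norm_mk_le_norm

/-- The discrete Fourier transform of an analytic function decays exponentially, uniformly in the
period. -/
theorem norm_discrete_fourier_le (hm : 0 < m)
    (hd : ∀ z : ℂ, |z.re| ≤ Real.pi → |z.im| ≤ m → DifferentiableAt ℂ f z)
    (hb : ∀ z : ℂ, |z.re| ≤ Real.pi → |z.im| ≤ m → ‖f z‖ ≤ C)
    (hper : ∀ t : ℝ, |t| ≤ m → f (-Real.pi + t * Complex.I) = f (Real.pi + t * Complex.I))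
    {R : ℕ} (hR : 0 < R) (j : ℤ) :
    ‖(R : ℂ)⁻¹ * ∑ b ∈ residues R, f ((2 * Real.pi * b / R : ℝ) : ℂ) *
        Complex.exp (Complex.I * (2 * Real.pi * (b : ℂ) / R) * j)‖ ≤
      C * (∑' x : ℤ, Real.exp (-(m / 2 * |(x : ℝ)|))) *
        Real.exp (-(m / 2 * ‖((j : ℝ) : AddCircle (R : ℝ))‖)) := by
  have hpi := Real.pi_pos
  have hRr : (0 : ℝ) < R := by exact_mod_cast hR
  have hRc : (R : ℂ) ≠ 0 := by exact_mod_cast hR.ne'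
  have hC : 0 ≤ C := (norm_nonneg _).trans (hb 0 (by simpa using hpi.le) (by simpa using hm.le))
  obtain ⟨c, hc, hsum⟩ := exists_hasSum_fourier hm hd hb hper
  have h1 : HasSum (fun n : ℤ => (R : ℂ)⁻¹ * ∑ b ∈ residues R,
      (c n * Complex.exp (Complex.I * ((2 * Real.pi * b / R : ℝ) : ℂ) * n)) *
        Complex.exp (Complex.I * (2 * Real.pi * (b : ℂ) / R) * j))
      ((R : ℂ)⁻¹ * ∑ b ∈ residues R, f ((2 * Real.pi * b / R : ℝ) : ℂ) *
        Complex.exp (Complex.I * (2 * Real.pi * (b : ℂ) / R) * j)) := by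
    refine HasSum.mul_left _ (hasSum_sum fun b hb => HasSum.mul_right _ (hsum _ ?_ ?_))
    · have := two_mul_abs_le_of_mem_residues hb
      rw [le_div_iff₀ hRr]
      have h2 := neg_abs_le (b : ℝ)
      nlinarith
    -- The point π must be excluded, because the Fourier expansion is stated on the half-open
    -- interval.
    · rw [mem_residues] at hb
      have h2 : 2 * b < R := by omega
      have h3 : 2 * (b : ℝ) < R := by exact_mod_cast h2
      rw [div_lt_iff₀ hRr]
      nlinarith
  -- Poisson summation: averaging over the discrete momenta retains exactly the coefficients with n
  -- ≡ -j modulo R.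
  have h2 : (fun n : ℤ => (R : ℂ)⁻¹ * ∑ b ∈ residues R,
      (c n * Complex.exp (Complex.I * ((2 * Real.pi * b / R : ℝ) : ℂ) * n)) *
        Complex.exp (Complex.I * (2 * Real.pi * (b : ℂ) / R) * j)) =
      fun n => if (R : ℤ) ∣ n + j then c n else 0 := by
    funext n
    have h3 : ∀ b ∈ residues R,
        (c n * Complex.exp (Complex.I * ((2 * Real.pi * b / R : ℝ) : ℂ) * n)) *
        Complex.exp (Complex.I * (2 * Real.pi * (b : ℂ) / R) * j) =
        c n * Complex.exp (Complex.I * (2 * Real.pi * (b : ℂ) / R) * ((n + j : ℤ) : ℂ)) := by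
      intro b _
      rw [mul_assoc, ← Complex.exp_add]
      congr 2
      push_cast
      ring
    rw [Finset.sum_congr rfl h3, ← Finset.mul_sum, sum_residues_exp]
    split_ifs
    · field_simp
    · simp
  rw [h2] at h1
  rw [← h1.tsum_eq]
  have hs := summable_exp_neg_mul_abs (half_pos hm)
  have h4 : HasSum (fun n : ℤ => C * Real.exp (-(m / 2 * |(n : ℝ)|)) *
      Real.exp (-(m / 2 * ‖((j : ℝ) : AddCircle (R : ℝ))‖)))
      (C * (∑' x : ℤ, Real.exp (-(m / 2 * |(x : ℝ)|))) *
        Real.exp (-(m / 2 * ‖((j : ℝ) : AddCircle (R : ℝ))‖))) :=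
    (hs.hasSum.mul_left C).mul_right _
  refine tsum_of_norm_bounded h4 fun n => ?_
  split_ifs with hdvd
  -- Half of the decay rate pays for the sum over n. The other half gives the decay in j, since
  -- every surviving n satisfies |n| ≥ the distance of j from Rℤ.
  · refine (hc n).trans ?_
    rw [mul_assoc, ← Real.exp_add]
    gcongr
    have := norm_addCircle_le_abs hdvd
    nlinarith
  · rw [norm_zero]; positivity

end Strip

/-! ### The infinite volume form of the Green's function -/

/-- The momenta of the unit lattice in a torus with periods `R ν`. -/
def momentum (R : Fin 4 → ℕ) (b : Fin 4 → ℤ) (ν : Fin 4) : ℝ := 2 * Real.pi * b ν / R ν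

/-- The kernel of `S_n Q_n^*` as a function of the displacement. -/
def greenKernel (𝔮 L n : ℕ) (a : ℝ) (hhat : (Fin 3 → ℂ) → ℂ) (R : Fin 4 → ℕ) (y : Fin 4 → ℝ) : ℂ :=
  (∏ ν, (R ν : ℂ))⁻¹ * ∑ b ∈ shifts R,
    greenFiber 𝔮 L n a hhat y fun ν => (momentum R b ν : ℂ)

theorem update_mem_shifts {R : Fin 4 → ℕ} {b : Fin 4 → ℤ} (hb : b ∈ shifts R) {ν : Fin 4} {x : ℤ}
    (hx : x ∈ residues (R ν)) : Function.update b ν x ∈ shifts R := by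
  rw [shifts, Fintype.mem_piFinset] at *
  intro μ
  by_cases hμ : μ = ν
  · subst hμ; simpa using hx
  · simpa [Function.update_of_ne hμ] using hb μ

theorem card_shifts (R : Fin 4 → ℕ) : (shifts R).card = ∏ ν, R ν := by
  simp [shifts, card_residues]

/-- An average over all momenta is bounded by the averages over one of their components. -/
theorem norm_average_shifts_le {R : Fin 4 → ℕ} (hR : ∀ ν, 0 < R ν) (ν : Fin 4)
    (F : (Fin 4 → ℤ) → ℂ) {B : ℝ}
    (hF : ∀ b ∈ shifts R, ‖(R ν : ℂ)⁻¹ * ∑ x ∈ residues (R ν), F (Function.update b ν x)‖ ≤ B) :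
    ‖(∏ μ, (R μ : ℂ))⁻¹ * ∑ b ∈ shifts R, F b‖ ≤ B := by
  have hRc : (R ν : ℂ) ≠ 0 := by exact_mod_cast (hR ν).ne'
  have h1 : ∑ b ∈ shifts R, ∑ x ∈ residues (R ν), F (Function.update b ν x) =
      (R ν : ℂ) * ∑ b ∈ shifts R, F b := by
    rw [← Finset.sum_product']
    have h2 : ∑ p ∈ shifts R ×ˢ residues (R ν), F (Function.update p.1 ν p.2) =
        ∑ p ∈ shifts R ×ˢ residues (R ν), F p.1 := by
      -- Exchanging the component ν of b with the extra variable x is an involution of the product.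
      refine Finset.sum_nbij' (fun p => (Function.update p.1 ν p.2, p.1 ν))
        (fun p => (Function.update p.1 ν p.2, p.1 ν)) ?_ ?_ ?_ ?_ ?_
      · rintro ⟨b, x⟩ hp
        rw [Finset.mem_product] at hp ⊢
        exact ⟨update_mem_shifts hp.1 hp.2, Fintype.mem_piFinset.mp hp.1 ν⟩
      · rintro ⟨b, x⟩ hp
        rw [Finset.mem_product] at hp ⊢
        exact ⟨update_mem_shifts hp.1 hp.2, Fintype.mem_piFinset.mp hp.1 ν⟩
      · rintro ⟨b, x⟩ _
        simp
      · rintro ⟨b, x⟩ _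
        simp
      · rintro ⟨b, x⟩ _
        rfl
    rw [h2, Finset.sum_product, Finset.mul_sum]
    refine Finset.sum_congr rfl fun b _ => ?_
    simp only [Finset.sum_const, card_residues, nsmul_eq_mul]
  have h3 : ∑ b ∈ shifts R, F b = ∑ b ∈ shifts R,
      ((R ν : ℂ)⁻¹ * ∑ x ∈ residues (R ν), F (Function.update b ν x)) := by
    rw [← Finset.mul_sum, h1, inv_mul_cancel_left₀ hRc]
  have hP : (0 : ℝ) < ∏ μ, (R μ : ℝ) := Finset.prod_pos fun μ _ => by exact_mod_cast hR μ
  rw [norm_mul, norm_inv, norm_prod]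
  simp only [Complex.norm_natCast]
  rw [inv_mul_le_iff₀ hP, h3]
  calc _ ≤ ∑ b ∈ shifts R, B := norm_sum_le_of_le _ hF
    _ = _ := by rw [Finset.sum_const, card_shifts, nsmul_eq_mul]; push_cast; rfl

theorem differentiable_wave_shift (ℓ : Fin 4 → ℤ) (y : Fin 4 → ℝ) :
    Differentiable ℂ fun k => wave (shift k ℓ) y := by
  unfold wave shift; fun_prop

theorem norm_wave (p : Fin 4 → ℂ) (y : Fin 4 → ℝ) :
    ‖wave p y‖ = Real.exp (-∑ ν, (p ν).im * y ν) := by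
  rw [wave, Complex.norm_exp]
  congr 1
  simp [Complex.mul_re, Complex.mul_im]

theorem wave_shift_sub_int (k : Fin 4 → ℂ) (ℓ : Fin 4 → ℤ) (y : Fin 4 → ℝ) (ν : Fin 4) (j : ℤ) :
    wave (shift k ℓ) y =
      wave (shift k ℓ) (Function.update y ν (y ν - j)) * Complex.exp (Complex.I * k ν * j) := by
  rw [wave, wave, ← Complex.exp_add, Complex.exp_eq_exp_iff_exists_int]
  refine ⟨ℓ ν * j, ?_⟩
  rw [← Finset.add_sum_erase _ _ (Finset.mem_univ ν),
    ← Finset.add_sum_erase Finset.univ (fun μ => shift k ℓ μ *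
      ((Function.update y ν (y ν - j) μ : ℝ) : ℂ)) (Finset.mem_univ ν)]
  have h1 : ∀ μ ∈ Finset.univ.erase ν, shift k ℓ μ *
      ((Function.update y ν (y ν - j) μ : ℝ) : ℂ) = shift k ℓ μ * (y μ : ℂ) := by
    intro μ hμ
    rw [Function.update_of_ne (Finset.ne_of_mem_erase hμ)]
  rw [Finset.sum_congr rfl h1, Function.update_self]
  simp only [shift]
  push_cast
  ring

set_option maxHeartbeats 600000 in
-- All components of the momentum but the one in direction ν are frozen at real values, and the
-- one-variable decay estimate is applied to the remaining one. The other three averages cost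
-- nothing.
theorem exists_greenKernel_bound {𝔮 : ℕ} (h𝔮 : 2 ≤ 𝔮) {a : ℝ} (ha : 0 < a)
    {h : (Fin 3 → ℤ) → ℂ} {hhat : (Fin 3 → ℂ) → ℂ} (H : IsHamiltonian h hhat) :
    ∃ m : ℝ, 0 < m ∧ ∃ C : ℝ, 0 < C ∧ ∀ L n : ℕ, Odd L → 1 < L →
      ∀ R : Fin 4 → ℕ, (∀ ν, 0 < R ν) → ∀ (y : Fin 4 → ℝ) (ν : Fin 4) (z : ℤ),
        y ν * (scale L n ν : ℕ) = z →
        ‖greenKernel 𝔮 L n a hhat R y‖ ≤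
          C * Real.exp (-(m * ‖((y ν : ℝ) : AddCircle (R ν : ℝ))‖)) := by
  obtain ⟨m, hm, hm1, C, hC, hb⟩ := exists_greenSymbol_bounds h𝔮 ha H
  have hpi := Real.pi_pos
  have hts : 0 < ∑' x : ℤ, Real.exp (-(m / 2 * |(x : ℝ)|)) :=
    (summable_exp_neg_mul_abs (half_pos hm)).tsum_pos (fun _ => (Real.exp_pos _).le) 0
      (Real.exp_pos _)
  refine ⟨m / 2, half_pos hm, C * Real.exp 1 * (∑' x : ℤ, Real.exp (-(m / 2 * |(x : ℝ)|))) *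
    Real.exp (m / 2), by positivity, fun L n hL hL1 R hR y ν z hyz => ?_⟩
  refine norm_average_shifts_le hR ν _ fun b hbm => ?_
  set κ : Fin 4 → ℝ := momentum R b with hκ
  have hκb : ∀ μ, |κ μ| ≤ Real.pi := by
    intro μ
    have h1 := two_mul_abs_le_of_mem_residues (Fintype.mem_piFinset.mp hbm μ)
    have h2 : (0 : ℝ) < R μ := by exact_mod_cast hR μ
    rw [hκ, momentum, abs_div, Nat.abs_cast, div_le_iff₀ h2, abs_mul, abs_of_pos Real.two_pi_pos]
    nlinarith
  -- The integer part of the displacement supplies the character of the discrete Fourier transform.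
  -- The fractional part stays inside f, where its plane wave is bounded by e in the strip; keeping
  -- all of `y ν` there would give no uniform bound.
  set j : ℤ := ⌊y ν⌋ with hj
  set y' : Fin 4 → ℝ := Function.update y ν (y ν - j) with hy'
  have hfr0 : 0 ≤ y ν - j := by rw [hj]; linarith [Int.floor_le (y ν)]
  have hfr1 : y ν - j ≤ 1 := by rw [hj]; linarith [Int.lt_floor_add_one (y ν)]
  set K : ℂ → Fin 4 → ℂ := fun z => Function.update (fun μ => (κ μ : ℂ)) ν z with hK
  set f : ℂ → ℂ := fun z => greenFiber 𝔮 L n a hhat y' (K z) with hf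
  have hKd : Differentiable ℂ K := by
    rw [hK, differentiable_pi]
    intro μ
    by_cases hμ : μ = ν
    · subst hμ; simp
    · simp [Function.update_of_ne hμ]
  have hnear : ∀ z : ℂ, |z.re| ≤ Real.pi → |z.im| ≤ m →
      (∀ μ, |Function.update κ ν z.re μ| ≤ Real.pi) ∧
      (∀ μ, ‖K z μ - (Function.update κ ν z.re μ : ℝ)‖ ≤ m) := by
    intro z hz1 hz2
    constructor
    · intro μ
      by_cases hμ : μ = ν
      · subst hμ; simpa using hz1
      · simpa [Function.update_of_ne hμ] using hκb μ
    · intro μ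
      by_cases hμ : μ = ν
      · subst hμ
        simp only [hK, Function.update_self]
        have : z - (z.re : ℂ) = (z.im : ℂ) * Complex.I := by
          apply Complex.ext <;> simp
        rw [this]
        simpa using hz2
      · simp [hK, Function.update_of_ne hμ, hm.le]
  have hfd : ∀ z : ℂ, |z.re| ≤ Real.pi → |z.im| ≤ m → DifferentiableAt ℂ f z := by
    intro z hz1 hz2
    obtain ⟨h1, h2⟩ := hnear z hz1 hz2
    obtain ⟨h3, h4, _⟩ := hb L n hL hL1 _ h1 _ h2
    have h5 : DifferentiableAt ℂ (greenFiber 𝔮 L n a hhat y') (K z) := by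
      unfold greenFiber
      exact DifferentiableAt.fun_sum fun ℓ hℓ =>
        (differentiableAt_greenSymbol 𝔮 L n a H.entire
          (fun ℓ hℓ h0 => h3 ℓ hℓ (Or.inl h0)) h4 hℓ).mul (differentiable_wave_shift ℓ y' _)
    exact h5.comp z (hKd z)
  have hfb : ∀ z : ℂ, |z.re| ≤ Real.pi → |z.im| ≤ m → ‖f z‖ ≤ C * Real.exp 1 := by
    intro z hz1 hz2
    obtain ⟨h1, h2⟩ := hnear z hz1 hz2
    obtain ⟨_, _, h3⟩ := hb L n hL hL1 _ h1 _ h2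
    calc ‖f z‖ ≤ ∑ ℓ ∈ shifts (scale L n), ‖greenSymbol 𝔮 L n a hhat (K z) ℓ‖ * Real.exp 1 := by
          refine norm_sum_le_of_le _ fun ℓ _ => ?_
          rw [norm_mul]
          gcongr
          rw [norm_wave]
          apply Real.exp_le_exp.mpr
          rw [Finset.sum_eq_single_of_mem ν (Finset.mem_univ ν) (fun μ _ hμ => by
            simp [shift, hK, Function.update_of_ne hμ])]
          have h4 : (shift (K z) ℓ ν).im = z.im := by simp [shift, hK]
          rw [h4, hy', Function.update_self]
          calc -(z.im * (y ν - j)) ≤ |z.im * (y ν - j)| := neg_le_abs _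
            _ = |z.im| * (y ν - j) := by rw [abs_mul, abs_of_nonneg hfr0]
            _ ≤ 1 * 1 := by gcongr; linarith
            _ = 1 := one_mul 1
      _ ≤ _ := by rw [← Finset.sum_mul]; gcongr
  -- Periodicity is needed only on the edges |Re z| = π. There D(k) itself is nonzero, which is why
  -- the nonvanishing statement above also covers ℓ = 0 on the boundary of the zone.
  have hper : ∀ t : ℝ, |t| ≤ m →
      f (-Real.pi + t * Complex.I) = f (Real.pi + t * Complex.I) := by
    intro t ht
    have hK2 : K (Real.pi + t * Complex.I) =
        K (-Real.pi + t * Complex.I) + Pi.single ν (2 * Real.pi : ℂ) := by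
      ext μ
      by_cases hμ : μ = ν
      · subst hμ; simp [hK]; ring
      · simp [hK, Function.update_of_ne hμ, Pi.single_eq_of_ne hμ]
    have hne : ∀ σ : ℝ, |σ| = Real.pi → diffSymbol (L ^ n) hhat (K (σ + t * Complex.I)) ≠ 0 := by
      intro σ hσ
      have hre : ((σ : ℂ) + t * Complex.I).re = σ := by simp
      have him : ((σ : ℂ) + t * Complex.I).im = t := by simp
      obtain ⟨h1, h2⟩ := hnear (σ + t * Complex.I) (by rw [hre, hσ]) (by rw [him]; exact ht)
      obtain ⟨h3, _, _⟩ := hb L n hL hL1 _ h1 _ h2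
      have := h3 0 (zero_mem_shifts (scale_odd hL n))
        (Or.inr ⟨ν, by rw [Function.update_self, hre, hσ]⟩)
      rwa [shift_zero] at this
    have h1 := hne (-Real.pi) (by rw [abs_neg, abs_of_pos hpi])
    have h2 := hne Real.pi (abs_of_pos hpi)
    rw [Complex.ofReal_neg] at h1
    rw [hK2] at h2
    simp only [hf]
    rw [hK2]
    symm
    refine greenFiber_add_single (z := z - j * (scale L n ν : ℕ)) H hL.pos ?_ ?_ h1 h2
    · rw [hy', Function.update_self]
      push_cast
      rw [sub_mul, hyz]
    · intro μ hμ
      simp [hK, Function.update_of_ne hμ]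
  have hmain := norm_discrete_fourier_le hm hfd hfb hper (hR ν) j
  have hsum : ∀ x ∈ residues (R ν), greenFiber 𝔮 L n a hhat y
      (fun μ => (momentum R (Function.update b ν x) μ : ℂ)) =
      f ((2 * Real.pi * x / R ν : ℝ) : ℂ) *
        Complex.exp (Complex.I * (2 * Real.pi * (x : ℂ) / R ν) * j) := by
    intro x _
    have h1 : (fun μ => (momentum R (Function.update b ν x) μ : ℂ)) =
        K ((2 * Real.pi * x / R ν : ℝ) : ℂ) := by
      ext μ
      by_cases hμ : μ = ν
      · subst hμ; simp [hK, momentum]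
      · simp [hK, hκ, momentum, Function.update_of_ne hμ]
    rw [h1]
    simp only [hf, greenFiber, Finset.sum_mul]
    refine Finset.sum_congr rfl fun ℓ _ => ?_
    have hKν : K ((2 * Real.pi * x / R ν : ℝ) : ℂ) ν = 2 * Real.pi * (x : ℂ) / R ν := by
      simp [hK]
    rw [wave_shift_sub_int _ _ y ν j, hKν]
    exact (mul_assoc _ _ _).symm
  rw [Finset.sum_congr rfl hsum]
  refine hmain.trans ?_
  rw [mul_assoc (_ * _) (Real.exp (m / 2)), ← Real.exp_add]
  gcongr
  -- Replacing `y ν` by its integer part changes the distance by at most 1, at the price of the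
  -- factor e^{m/2} in the constant.
  have h1 : ‖((y ν : ℝ) : AddCircle (R ν : ℝ))‖ ≤ ‖((j : ℝ) : AddCircle (R ν : ℝ))‖ + 1 := by
    have h2 : ((y ν : ℝ) : AddCircle (R ν : ℝ)) =
        ((j : ℝ) : AddCircle (R ν : ℝ)) + ((y ν - j : ℝ) : AddCircle (R ν : ℝ)) := by
      rw [← AddCircle.coe_add]; congr 1; ring
    rw [h2]
    refine (norm_add_le _ _).trans ?_
    gcongr
    refine (QuotientAddGroup.norm_mk_le_norm).trans ?_
    rw [Real.norm_eq_abs, abs_of_nonneg hfr0]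
    exact hfr1
  nlinarith

/-! ### Characters of the lattices -/

/-- The coordinates of a lattice vector. -/
def coords (x : ℤ × (Fin 3 → ℤ)) : Fin 4 → ℤ := Fin.cons x.1 x.2

/-- The position in `ℝ⁴` of a lattice vector, for a lattice with `s ν` points per unit length. -/
def position (s : Fin 4 → ℕ) (x : ℤ × (Fin 3 → ℤ)) (ν : Fin 4) : ℝ := coords x ν / s ν

/-- A lattice vector in the class of a lattice point. -/
def label {L T S j : ℕ} (u : Lattice L T S j) : ℤ × (Fin 3 → ℤ) :=
  ((u.1.val : ℤ), fun i => ((u.2 i).val : ℤ))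

section

variable (L T S : ℕ) [NeZero L] [NeZero T] [NeZero S]

theorem latClass_label {j : ℕ} (u : Lattice L T S j) : latClass L T S j (label u) = u := by
  ext
  · simp [latClass, label]
  · simp [latClass, label]

/-- The character of the `j`-th lattice with momentum label `m`. -/
def latChar (j : ℕ) (m : Fin 4 → ℤ) (u : Lattice L T S j) : ℂ :=
  ZMod.stdAddChar (N := L ^ (2 * j) * T) ((m 0 : ZMod (L ^ (2 * j) * T)) * u.1) *
    ∏ i : Fin 3, ZMod.stdAddChar (N := L ^ j * S) ((m i.succ : ZMod (L ^ j * S)) * u.2 i)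

theorem latChar_add (j : ℕ) (m : Fin 4 → ℤ) (u v : Lattice L T S j) :
    latChar L T S j m (u + v) = latChar L T S j m u * latChar L T S j m v := by
  simp only [latChar, Prod.fst_add, Prod.snd_add, Pi.add_apply, mul_add, AddChar.map_add_eq_mul,
    Finset.prod_mul_distrib]
  ring

theorem latChar_zero (j : ℕ) (m : Fin 4 → ℤ) : latChar L T S j m 0 = 1 := by
  simp [latChar]

theorem period_pos (ν : Fin 4) : 0 < period T S ν := by
  refine Fin.cases ?_ (fun i => ?_) ν <;> simp [period, Nat.pos_of_neZero]

theorem latChar_latClass (j : ℕ) (m : Fin 4 → ℤ) (x : ℤ × (Fin 3 → ℤ)) :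
    latChar L T S j m (latClass L T S j x) =
      wave (fun ν => (momentum (period T S) m ν : ℂ)) (position (scale L j) x) := by
  have hL : (L : ℂ) ≠ 0 := Nat.cast_ne_zero.mpr (NeZero.ne L)
  have hT : (T : ℂ) ≠ 0 := Nat.cast_ne_zero.mpr (NeZero.ne T)
  have hS : (S : ℂ) ≠ 0 := Nat.cast_ne_zero.mpr (NeZero.ne S)
  rw [latChar, wave, Finset.mul_sum, Complex.exp_sum]
  conv_rhs => rw [Fin.prod_univ_succ]
  refine congrArg₂ (· * ·) ?_ (Finset.prod_congr rfl fun i _ => ?_)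
  · have h1 : (m 0 : ZMod (L ^ (2 * j) * T)) * (latClass L T S j x).1 =
        ((m 0 * x.1 : ℤ) : ZMod (L ^ (2 * j) * T)) := by simp [latClass]
    rw [h1, ZMod.stdAddChar_coe]
    congr 1
    simp [momentum, position, coords, period, scale]
    field_simp
  · have h1 : (m i.succ : ZMod (L ^ j * S)) * (latClass L T S j x).2 i =
        ((m i.succ * x.2 i : ℤ) : ZMod (L ^ j * S)) := by simp [latClass]
    rw [h1, ZMod.stdAddChar_coe]
    congr 1
    simp [momentum, position, coords, period]
    field_simp

theorem latChar_eq_wave (j : ℕ) (m : Fin 4 → ℤ) (u : Lattice L T S j) :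
    latChar L T S j m u =
      wave (fun ν => (momentum (period T S) m ν : ℂ)) (position (scale L j) (label u)) := by
  rw [← latChar_latClass, latClass_label]

/-- The inclusion does not change the position in the torus, and characters depend on positions
only. -/
theorem latChar_embed (j : ℕ) (m : Fin 4 → ℤ) (u : Lattice L T S j) :
    latChar L T S (j + 1) m (embed L T S j u) = latChar L T S j m u := by
  have hL : (L : ℝ) ≠ 0 := Nat.cast_ne_zero.mpr (NeZero.ne L)
  have h1 : embed L T S j u = latClass L T S (j + 1)
      ((L : ℤ) ^ 2 * (label u).1, fun i => (L : ℤ) * (label u).2 i) := by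
    ext <;> simp [embed, latClass, label]
  rw [h1, latChar_latClass, latChar_eq_wave]
  congr 1
  ext ν
  refine Fin.cases ?_ (fun i => ?_) ν
  · simp [position, coords, label]
    field_simp
    ring
  · simp [position, coords, label]
    field_simp
    ring

theorem conj_latChar (j : ℕ) (m : Fin 4 → ℤ) (u : Lattice L T S j) :
    (starRingEnd ℂ) (latChar L T S j m u) = latChar L T S j m (-u) := by
  have h1 : ‖latChar L T S j m u‖ = 1 := by
    rw [latChar_eq_wave, norm_wave]; simp
  have h2 : latChar L T S j m (-u) * latChar L T S j m u = 1 := by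
    rw [← latChar_add, neg_add_cancel, latChar_zero]
  have h3 : (starRingEnd ℂ) (latChar L T S j m u) * latChar L T S j m u = 1 := by
    rw [Complex.conj_mul', h1]; simp
  have h0 : latChar L T S j m u ≠ 0 := by
    intro h; rw [h] at h1; simp at h1
  exact mul_right_cancel₀ h0 (h3.trans h2.symm)

/-- The momentum label `b + R ℓ`. -/
def freq (R : Fin 4 → ℕ) (b ℓ : Fin 4 → ℤ) : Fin 4 → ℤ := fun ν => b ν + R ν * ℓ ν

theorem momentum_freq {R : Fin 4 → ℕ} (hR : ∀ ν, 0 < R ν) (b ℓ : Fin 4 → ℤ) :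
    (fun ν => (momentum R (freq R b ℓ) ν : ℂ)) = shift (fun ν => (momentum R b ν : ℂ)) ℓ := by
  ext ν
  have : (R ν : ℂ) ≠ 0 := by exact_mod_cast (hR ν).ne'
  simp only [momentum, freq, shift]
  push_cast
  field_simp

theorem abs_momentum_le {R : Fin 4 → ℕ} (hR : ∀ ν, 0 < R ν) {b : Fin 4 → ℤ} (hb : b ∈ shifts R)
    (ν : Fin 4) : |momentum R b ν| ≤ Real.pi := by
  have h1 := two_mul_abs_le_of_mem_residues (Fintype.mem_piFinset.mp hb ν)
  have h2 : (0 : ℝ) < R ν := by exact_mod_cast hR ν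
  rw [momentum, abs_div, Nat.abs_cast, div_le_iff₀ h2, abs_mul, abs_of_pos Real.two_pi_pos]
  nlinarith [Real.pi_pos]

/-- Aliasing: momenta that differ by 2πℓ cannot be distinguished on the unit lattice. This is why a
fiber is coupled through a single mode. -/
theorem latChar_level_zero_freq (b ℓ : Fin 4 → ℤ) :
    latChar L T S 0 (freq (period T S) b ℓ) = latChar L T S 0 b := by
  have h1 : ((L ^ (2 * 0) * T : ℕ) : ZMod (L ^ (2 * 0) * T)) = 0 := ZMod.natCast_self _
  have h2 : ((L ^ 0 * S : ℕ) : ZMod (L ^ 0 * S)) = 0 := ZMod.natCast_self _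
  have h1' : (T : ZMod (L ^ (2 * 0) * T)) = 0 := by rw [← h1]; congr 1; simp
  have h2' : (S : ZMod (L ^ 0 * S)) = 0 := by rw [← h2]; congr 1; simp
  funext u
  simp only [latChar, freq, period, Fin.cons_zero, Fin.cons_succ, Int.cast_add, Int.cast_mul,
    Int.cast_natCast, h1', h2', zero_mul, add_zero]

/-- The labels b + Rℓ form a complete system modulo sR. The sum over ℓ forces s to divide x, and the
sum over b then forces R to divide the quotient. -/
theorem sum_residues_residues_exp {s R : ℕ} (hs : 0 < s) (hR : 0 < R) (x : ℤ) :
    ∑ b ∈ residues R, ∑ ℓ ∈ residues s,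
      Complex.exp (Complex.I * ((2 * Real.pi * b / R : ℂ) + 2 * Real.pi * ℓ) * ((x : ℂ) / s)) =
      if ((s * R : ℕ) : ℤ) ∣ x then ((s * R : ℕ) : ℂ) else 0 := by
  have hsc : (s : ℂ) ≠ 0 := by exact_mod_cast hs.ne'
  have hRc : (R : ℂ) ≠ 0 := by exact_mod_cast hR.ne'
  have h1 : ∀ b ∈ residues R, ∑ ℓ ∈ residues s,
      Complex.exp (Complex.I * ((2 * Real.pi * b / R : ℂ) + 2 * Real.pi * ℓ) * ((x : ℂ) / s)) =
      Complex.exp (Complex.I * (2 * Real.pi * b / R : ℂ) * ((x : ℂ) / s)) *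
        if (s : ℤ) ∣ x then (s : ℂ) else 0 := by
    intro b _
    rw [← sum_residues_exp, Finset.mul_sum]
    refine Finset.sum_congr rfl fun ℓ _ => ?_
    rw [← Complex.exp_add]
    congr 1
    field_simp
  rw [Finset.sum_congr rfl h1, ← Finset.sum_mul]
  by_cases hx : (s : ℤ) ∣ x
  · obtain ⟨z, rfl⟩ := hx
    have h2 : ∀ b ∈ residues R,
        Complex.exp (Complex.I * (2 * Real.pi * b / R : ℂ) * ((((s : ℤ) * z : ℤ) : ℂ) / s)) =
        Complex.exp (Complex.I * (2 * Real.pi * (b : ℂ) / R) * z) := by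
      intro b _
      congr 1
      push_cast
      field_simp
    rw [Finset.sum_congr rfl h2, sum_residues_exp, if_pos (Dvd.intro _ rfl)]
    have h3 : ((s * R : ℕ) : ℤ) ∣ (s : ℤ) * z ↔ (R : ℤ) ∣ z := by
      push_cast
      exact mul_dvd_mul_iff_left (by exact_mod_cast hs.ne')
    simp only [h3]
    split_ifs
    · push_cast; ring
    · simp
  · rw [if_neg hx, mul_zero, if_neg]
    intro h
    apply hx
    exact (Dvd.intro (R : ℤ) (by push_cast; ring)).trans h

theorem sum_latChar (j : ℕ) (u : Lattice L T S j) :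
    ∑ b ∈ shifts (period T S), ∑ ℓ ∈ shifts (scale L j),
      latChar L T S j (freq (period T S) b ℓ) u =
      if u = 0 then ∏ ν, ((scale L j ν * period T S ν : ℕ) : ℂ) else 0 := by
  have hR := period_pos T S
  have hs := scale_pos (Nat.pos_of_neZero L) j
  set x := coords (label u) with hx
  have h1 : ∀ b ℓ, latChar L T S j (freq (period T S) b ℓ) u = ∏ ν, Complex.exp (Complex.I *
      ((2 * Real.pi * b ν / period T S ν : ℂ) + 2 * Real.pi * ℓ ν) * ((x ν : ℂ) / scale L j ν)) := by
    intro b ℓ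
    rw [latChar_eq_wave, momentum_freq hR, wave, Finset.mul_sum, Complex.exp_sum]
    refine Finset.prod_congr rfl fun ν _ => ?_
    congr 1
    simp only [shift, momentum, position, hx]
    push_cast
    ring
  simp only [h1]
  have h2 : ∀ b ∈ shifts (period T S), ∑ ℓ ∈ shifts (scale L j), ∏ ν, Complex.exp (Complex.I *
      ((2 * Real.pi * b ν / period T S ν : ℂ) + 2 * Real.pi * ℓ ν) * ((x ν : ℂ) / scale L j ν)) =
      ∏ ν, ∑ ℓ ∈ residues (scale L j ν), Complex.exp (Complex.I *
      ((2 * Real.pi * b ν / period T S ν : ℂ) + 2 * Real.pi * ℓ) * ((x ν : ℂ) / scale L j ν)) := by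
    intro b _
    rw [Finset.prod_univ_sum]; rfl
  rw [Finset.sum_congr rfl h2]
  have h3 := Finset.prod_univ_sum (fun ν => residues (period T S ν)) (fun ν b =>
    ∑ ℓ ∈ residues (scale L j ν), Complex.exp (Complex.I *
      ((2 * Real.pi * (b : ℂ) / period T S ν : ℂ) + 2 * Real.pi * ℓ) * ((x ν : ℂ) / scale L j ν)))
  rw [shifts, ← h3]
  simp only [sum_residues_residues_exp (hs _) (hR _)]
  rw [Finset.prod_ite_zero]
  have h4 : (∀ ν ∈ Finset.univ, ((scale L j ν * period T S ν : ℕ) : ℤ) ∣ x ν) ↔ u = 0 := by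
    constructor
    · intro h
      have h5 : ∀ i, u.2 i = 0 := by
        intro i
        have := h i.succ (Finset.mem_univ _)
        simp only [hx, coords, label, scale, period, Fin.cons_succ] at this
        rw [← ZMod.natCast_zmod_val (u.2 i)]
        rw [ZMod.natCast_eq_zero_iff]
        exact_mod_cast this
      have h6 : u.1 = 0 := by
        have := h 0 (Finset.mem_univ _)
        simp only [hx, coords, label, scale, period, Fin.cons_zero] at this
        rw [← ZMod.natCast_zmod_val u.1]
        rw [ZMod.natCast_eq_zero_iff]
        exact_mod_cast this
      exact Prod.ext h6 (funext h5)
    · rintro rfl ν _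
      refine Fin.cases ?_ (fun i => ?_) ν <;> simp [hx, coords, label]
  simp only [h4]

/-- Completeness of the characters. -/
theorem sum_latChar_mul_conj (j : ℕ) (u v : Lattice L T S j) :
    ∑ b ∈ shifts (period T S), ∑ ℓ ∈ shifts (scale L j),
      latChar L T S j (freq (period T S) b ℓ) u *
        (starRingEnd ℂ) (latChar L T S j (freq (period T S) b ℓ) v) =
      if u = v then ∏ ν, ((scale L j ν * period T S ν : ℕ) : ℂ) else 0 := by
  simp only [conj_latChar, ← latChar_add, ← sub_eq_add_neg]
  rw [sum_latChar]
  simp only [sub_eq_zero]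

/-- Orthogonality of the characters of the unit lattice. -/
theorem sum_conj_latChar_mul {b b' : Fin 4 → ℤ} (hb : b ∈ shifts (period T S))
    (hb' : b' ∈ shifts (period T S)) :
    ∑ x : Lattice L T S 0, (starRingEnd ℂ) (latChar L T S 0 b x) * latChar L T S 0 b' x =
      if b = b' then ∏ ν, (period T S ν : ℂ) else 0 := by
  have h1 : ∀ x : Lattice L T S 0, (starRingEnd ℂ) (latChar L T S 0 b x) * latChar L T S 0 b' x =
      latChar L T S 0 (b' - b) x := by
    intro x
    rw [conj_latChar]
    simp only [latChar, Prod.fst_neg, Prod.snd_neg, Pi.neg_apply, Pi.sub_apply, Int.cast_sub]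
    rw [mul_mul_mul_comm, ← AddChar.map_add_eq_mul, ← Finset.prod_mul_distrib]
    simp only [← AddChar.map_add_eq_mul]
    congr 2
    · ring
    · funext i; congr 1; ring
  simp only [h1]
  have h2 : ∀ N : ℕ, [NeZero N] → ∀ c : ℤ, ∑ x : ZMod N, ZMod.stdAddChar (N := N) ((c : ZMod N) * x) =
      if (N : ℤ) ∣ c then (N : ℂ) else 0 := by
    intro N _ c
    have := AddChar.sum_mulShift (c : ZMod N) (ZMod.isPrimitive_stdAddChar N)
    simp only [mul_comm (c : ZMod N), this, ZMod.card, ← ZMod.intCast_zmod_eq_zero_iff_dvd]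
    simp
  simp only [latChar]
  rw [Fintype.sum_prod_type]
  simp only [← Finset.mul_sum]
  rw [← Finset.sum_mul]
  have h3 := Finset.prod_univ_sum (fun _ : Fin 3 => (Finset.univ : Finset (ZMod (L ^ 0 * S))))
    (fun i x => ZMod.stdAddChar (N := L ^ 0 * S) ((((b' - b) i.succ : ℤ) : ZMod (L ^ 0 * S)) * x))
  rw [Fintype.piFinset_univ] at h3
  rw [← h3]
  simp only [h2]
  rw [Finset.prod_ite_zero]
  have h4 : (∀ ν, ((period T S ν : ℕ) : ℤ) ∣ (b' - b) ν) ↔ b = b' := by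
    constructor
    · intro h
      funext ν
      obtain ⟨z, hz⟩ := h ν
      have h5 := mem_residues.mp (Fintype.mem_piFinset.mp hb ν)
      have h6 := mem_residues.mp (Fintype.mem_piFinset.mp hb' ν)
      simp only [Pi.sub_apply] at hz
      have hz0 : z = 0 := by
        by_contra hne
        have h7 : 1 ≤ |z| := Int.one_le_abs hne
        have h8 : |b' ν - b ν| = (period T S ν : ℤ) * |z| := by
          rw [hz, abs_mul, Nat.abs_cast]
        have h9 : |b' ν - b ν| < (period T S ν : ℤ) := by
          rw [abs_lt]; constructor <;> omega
        nlinarith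
      rw [hz0] at hz
      omega
    · rintro rfl ν; simp
  have h5 : ((L ^ (2 * 0) * T : ℕ) : ℤ) = (period T S 0 : ℤ) := by simp [period]
  have h6 : ∀ i : Fin 3, ((L ^ 0 * S : ℕ) : ℤ) = (period T S i.succ : ℤ) := by
    intro i; simp [period]
  by_cases hbb : b = b'
  · have h7 := h4.mpr hbb
    rw [if_pos hbb, if_pos (h5 ▸ h7 0), if_pos (fun i _ => (h6 i) ▸ h7 i.succ)]
    conv_rhs => rw [Fin.prod_univ_succ]
    simp [period]
  · rw [if_neg hbb]
    by_cases h0 : ((L ^ (2 * 0) * T : ℕ) : ℤ) ∣ (b' - b) 0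
    · rw [if_neg (c := ∀ i ∈ Finset.univ, _), mul_zero]
      intro h
      apply hbb
      rw [← h4]
      intro ν
      refine Fin.cases (h5 ▸ h0) (fun i => ?_) ν
      exact (h6 i) ▸ h i (Finset.mem_univ _)
    · rw [if_neg h0, zero_mul]

end

/-! ### The averaging operators on characters -/

theorem geom_sum_mul_geom_sum_pow (w : ℂ) (N N' : ℕ) :
    (∑ i ∈ Finset.range N, (w ^ N') ^ i) * ∑ i ∈ Finset.range N', w ^ i =
      ∑ i ∈ Finset.range (N * N'), w ^ i := by
  by_cases hw : w = 1
  · simp [hw]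
  · apply mul_right_cancel₀ (sub_ne_zero.mpr hw)
    rw [mul_assoc, geom_sum_mul, geom_sum_mul, geom_sum_mul, ← pow_mul, mul_comm N' N]

/-- Averaging over N points and then over N' points of a finer grid is averaging over NN' points.
This is what turns the symbol of the composition of n averaging steps into one Dirichlet kernel at
scale L^n. -/
theorem dirichlet_mul {N N' : ℕ} (hN : Odd N) (hN' : Odd N') (p : ℂ) :
    dirichlet (N * N') p = dirichlet N p * dirichlet N' (p / N) := by
  have hNc : (N : ℂ) ≠ 0 := by exact_mod_cast hN.pos.ne'
  have hNc' : (N' : ℂ) ≠ 0 := by exact_mod_cast hN'.pos.ne'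
  rw [dirichlet_eq_range, dirichlet_eq_range, dirichlet_eq_range,
    ← geom_sum_mul_geom_sum_pow]
  have h1 : Complex.exp (Complex.I * p / ((N * N' : ℕ) : ℂ)) ^ N' =
      Complex.exp (Complex.I * p / N) := by
    rw [← Complex.exp_nat_mul]
    congr 1
    push_cast
    field_simp
  have h2 : Complex.I * (p / N) / N' = Complex.I * p / ((N * N' : ℕ) : ℂ) := by
    push_cast
    field_simp
  have h3 : Complex.exp (-(Complex.I * p * (((N * N' / 2 : ℕ) : ℂ) / ((N * N' : ℕ) : ℂ)))) =
      Complex.exp (-(Complex.I * p * (((N / 2 : ℕ) : ℂ) / N))) *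
        Complex.exp (-(Complex.I * (p / N) * (((N' / 2 : ℕ) : ℂ) / N'))) := by
    rw [← Complex.exp_add]
    congr 1
    -- For odd N and N' the centres of the two residue systems combine exactly.
    have h4 : N * N' / 2 = (N / 2) * N' + N' / 2 := by
      obtain ⟨m, rfl⟩ := hN
      obtain ⟨m', rfl⟩ := hN'
      have h5 : (2 * m + 1) * (2 * m' + 1) = 2 * (m * (2 * m' + 1) + m') + 1 := by ring
      have h6 : (2 * m + 1) / 2 = m := by omega
      have h7 : (2 * m' + 1) / 2 = m' := by omega
      rw [h6, h7, h5]
      omega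
    rw [h4, Nat.cast_add, Nat.cast_mul, Nat.cast_mul]
    field_simp
    ring
  rw [h1, h2, h3, Nat.cast_mul, mul_inv]
  ring

theorem scale_add_one (L j : ℕ) (ν : Fin 4) : scale L (j + 1) ν = scale L j ν * scale L 1 ν := by
  refine Fin.cases ?_ (fun i => ?_) ν
  · simp; ring
  · simp; ring

theorem avgSymbol_scale_add_one (𝔮 : ℕ) {L : ℕ} (hL : Odd L) (j : ℕ) (p : Fin 4 → ℂ) :
    avgSymbol 𝔮 (scale L (j + 1)) p =
      avgSymbol 𝔮 (scale L j) p * avgSymbol 𝔮 (scale L 1) fun ν => p ν / scale L j ν := by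
  simp only [avgSymbol, ← Finset.prod_mul_distrib, ← mul_pow]
  refine Finset.prod_congr rfl fun ν _ => ?_
  rw [scale_add_one, dirichlet_mul (scale_odd hL j ν) (scale_odd hL 1 ν)]

theorem avgSymbol_scale_zero (𝔮 L : ℕ) (p : Fin 4 → ℂ) : avgSymbol 𝔮 (scale L 0) p = 1 := by
  refine Finset.prod_eq_one fun ν _ => ?_
  have h1 : scale L 0 ν = 1 := by
    refine Fin.cases ?_ (fun i => ?_) ν <;> simp
  have h2 : residues 1 = {0} := by decide
  rw [h1, dirichlet, h2]
  simp

theorem prod_scale (L j : ℕ) : ∏ ν, (scale L j ν : ℂ) = (L : ℂ) ^ (5 * j) := by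
  rw [Fin.prod_univ_succ]
  simp only [scale_zero, scale_succ, Finset.prod_const, Finset.card_univ, Fintype.card_fin]
  push_cast
  ring

theorem Icc_eq_residues {N : ℕ} (hN : Odd N) :
    Finset.Icc (-(((N : ℤ) - 1) / 2)) (((N : ℤ) - 1) / 2) = residues N := by
  ext x
  rw [Finset.mem_Icc, mem_residues]
  obtain ⟨m, rfl⟩ := hN
  omega

theorem sum_box_wave {L : ℕ} (hL : Odd L) (j : ℕ) (p : Fin 4 → ℂ) :
    ∑ x ∈ box L, wave p (position (scale L (j + 1)) x) =
      (L : ℂ) ^ 5 * ∏ ν, dirichlet (scale L 1 ν) (p ν / scale L j ν) := by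
  have h1 : (L : ℂ) ^ 5 * ∏ ν, dirichlet (scale L 1 ν) (p ν / scale L j ν) =
      ∏ ν, ∑ x ∈ residues (scale L 1 ν),
        Complex.exp (Complex.I * p ν * ((x : ℂ) / scale L (j + 1) ν)) := by
    have := prod_scale L 1
    rw [mul_one] at this
    rw [← this, ← Finset.prod_mul_distrib]
    refine Finset.prod_congr rfl fun ν _ => ?_
    have h2 : (scale L 1 ν : ℂ) ≠ 0 := by exact_mod_cast (scale_pos hL.pos 1 ν).ne'
    have h3 : (scale L j ν : ℂ) ≠ 0 := by exact_mod_cast (scale_pos hL.pos j ν).ne'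
    rw [dirichlet, mul_inv_cancel_left₀ h2]
    refine Finset.sum_congr rfl fun x _ => ?_
    congr 1
    rw [scale_add_one L j]
    push_cast
    field_simp
  rw [h1, Fin.prod_univ_succ, Finset.prod_univ_sum, Finset.sum_mul_sum, ← Finset.sum_product']
  have h4 : box L = residues (scale L 1 0) ×ˢ
      Fintype.piFinset fun i : Fin 3 => residues (scale L 1 i.succ) := by
    rw [box]
    congr 1
    · rw [← Icc_eq_residues (scale_odd hL 1 0)]
      simp
    · congr 1
      funext i
      rw [← Icc_eq_residues (scale_odd hL 1 i.succ)]
      simp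
  rw [h4]
  refine Finset.sum_congr rfl fun x _ => ?_
  rw [wave, Finset.mul_sum, Complex.exp_sum, Fin.prod_univ_succ]
  simp only [position, coords, Fin.cons_zero, Fin.cons_succ]
  push_cast
  simp only [mul_assoc]

theorem hasSum_of_eq {β : Type*} {f g : β → ℂ} {a : ℂ} (hfg : ∀ x, f x = g x) (hg : HasSum g a) :
    HasSum f a := (funext hfg : f = g) ▸ hg

/-- The generating function of the iterated convolutions of the box. -/
theorem hasSum_boxConv (L : ℕ) (e : ℤ × (Fin 3 → ℤ) → ℂ) (he0 : e 0 = 1)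
    (hadd : ∀ x y, e (x + y) = e x * e y) (k : ℕ) :
    HasSum (fun x => (boxConv L k x : ℂ) * e x) ((∑ x ∈ box L, e x) ^ k) := by
  induction k with
  | zero =>
    have := hasSum_ite_eq (0 : ℤ × (Fin 3 → ℤ)) (1 : ℂ)
    rw [pow_zero]
    refine hasSum_of_eq (fun x => ?_) this
    by_cases hx : x = 0
    · simp [hx, boxConv, he0]
    · simp [hx, boxConv]
  | succ k ih =>
    have h1 : ∀ y, HasSum (fun x => (boxConv L k (x - y) : ℂ) * e x)
        ((∑ x ∈ box L, e x) ^ k * e y) := by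
      intro y
      have h2 := ((Equiv.subRight y).hasSum_iff.mpr ih).mul_right (e y)
      refine hasSum_of_eq (fun x => ?_) h2
      simp only [Function.comp_apply, Equiv.subRight_apply]
      rw [mul_assoc, ← hadd, sub_add_cancel]
    have h3 := hasSum_sum (s := box L) fun y _ => h1 y
    rw [← Finset.mul_sum, ← pow_succ] at h3
    refine hasSum_of_eq (fun x => ?_) h3
    simp only [boxConv]
    push_cast
    rw [Finset.sum_mul]

theorem wave_position_add (p : Fin 4 → ℂ) (s : Fin 4 → ℕ) (x y : ℤ × (Fin 3 → ℤ)) :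
    wave p (position s (x + y)) = wave p (position s x) * wave p (position s y) := by
  have h1 : ∀ ν, position s (x + y) ν = position s x ν + position s y ν := by
    intro ν
    have : coords (x + y) ν = coords x ν + coords y ν := by
      refine Fin.cases ?_ (fun i => ?_) ν <;> simp [coords]
    simp only [position, this]
    push_cast
    ring
  rw [wave, wave, wave, ← Complex.exp_add, ← mul_add, ← Finset.sum_add_distrib]
  congr 2
  refine Finset.sum_congr rfl fun ν _ => ?_
  rw [h1]; push_cast; ring

theorem wave_position_zero (p : Fin 4 → ℂ) (s : Fin 4 → ℕ) : wave p (position s 0) = 1 := by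
  have h1 : ∀ ν, position s 0 ν = 0 := by
    intro ν
    have : coords 0 ν = 0 := by
      refine Fin.cases ?_ (fun i => ?_) ν <;> simp [coords]
    simp [position, this]
  simp [wave, h1]

theorem hasSum_profile (𝔮 L : ℕ) (e : ℤ × (Fin 3 → ℤ) → ℂ) (he0 : e 0 = 1)
    (hadd : ∀ x y, e (x + y) = e x * e y) :
    HasSum (fun x => ((profile 𝔮 L x : ℝ) : ℂ) * e x)
      (((L : ℂ) ^ (5 * 𝔮))⁻¹ * (∑ x ∈ box L, e x) ^ 𝔮) := by
  refine hasSum_of_eq (fun x => ?_) ((hasSum_boxConv L e he0 hadd 𝔮).mul_left _)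
  rw [profile, Complex.ofReal_mul, Complex.ofReal_inv, Complex.ofReal_pow, Complex.ofReal_natCast,
    mul_assoc]

theorem hasSum_profile_wave (𝔮 : ℕ) {L : ℕ} (hL : Odd L) (j : ℕ) (p : Fin 4 → ℂ) :
    HasSum (fun x => ((profile 𝔮 L x : ℝ) : ℂ) * wave p (position (scale L (j + 1)) x))
      (avgSymbol 𝔮 (scale L 1) fun ν => p ν / scale L j ν) := by
  have hLc : (L : ℂ) ≠ 0 := by exact_mod_cast hL.pos.ne'
  have h2 : avgSymbol 𝔮 (scale L 1) (fun ν => p ν / scale L j ν) =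
      ((L : ℂ) ^ (5 * 𝔮))⁻¹ * (∑ x ∈ box L, wave p (position (scale L (j + 1)) x)) ^ 𝔮 := by
    rw [sum_box_wave hL, mul_pow, ← pow_mul, inv_mul_cancel_left₀ (pow_ne_zero _ hLc), avgSymbol,
      Finset.prod_pow]
  rw [h2]
  exact hasSum_profile 𝔮 L _ (wave_position_zero _ _) (wave_position_add _ _)

theorem summable_profile (𝔮 : ℕ) {L : ℕ} (hL : Odd L) :
    Summable fun x => ((profile 𝔮 L x : ℝ) : ℂ) := by
  have := (hasSum_profile_wave 𝔮 hL 0 0).summable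
  refine this.congr fun x => ?_
  simp [wave]

theorem prod_scale_mul_period (L T S n : ℕ) : ∏ ν, ((scale L n ν * period T S ν : ℕ) : ℂ) =
    (L : ℂ) ^ (5 * n) * ∏ ν, (period T S ν : ℂ) := by
  push_cast
  rw [Finset.prod_mul_distrib, prod_scale]

section

variable (L T S : ℕ) [NeZero L] [NeZero T] [NeZero S]

/-- Each x contributes to exactly one w, so the finite sum over w collapses, and multiplicativity of
the character leaves the generating function of the profile. -/
theorem avgStep_mulVec_latChar (𝔮 : ℕ) (hL : Odd L) (j : ℕ) (m : Fin 4 → ℤ) :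
    (avgStep 𝔮 L T S j).mulVec (latChar L T S (j + 1) m) =
      (avgSymbol 𝔮 (scale L 1) fun ν => (momentum (period T S) m ν : ℂ) / scale L j ν) •
        latChar L T S j m := by
  funext y
  simp only [Matrix.mulVec, dotProduct, avgStep, Pi.smul_apply, smul_eq_mul]
  have h1 : ∀ w : Lattice L T S (j + 1), HasSum (fun x : ℤ × (Fin 3 → ℤ) =>
      (if embed L T S j y + latClass L T S (j + 1) x = w then ((profile 𝔮 L x : ℝ) : ℂ) else 0) *
        latChar L T S (j + 1) m w)
      ((∑' x : ℤ × (Fin 3 → ℤ), if embed L T S j y + latClass L T S (j + 1) x = w then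
        ((profile 𝔮 L x : ℝ) : ℂ) else 0) * latChar L T S (j + 1) m w) := by
    intro w
    refine HasSum.mul_right _ (Summable.hasSum ?_)
    refine Summable.of_norm_bounded (summable_profile 𝔮 hL).norm fun x => ?_
    split_ifs
    · exact le_rfl
    · rw [norm_zero]; exact norm_nonneg _
  have h2 := hasSum_sum (s := Finset.univ) fun w _ => h1 w
  have h3 := (hasSum_profile_wave 𝔮 hL j fun ν => (momentum (period T S) m ν : ℂ)).mul_right
    (latChar L T S j m y)
  refine h2.unique ?_
  refine hasSum_of_eq (fun x => ?_) h3
  simp only [ite_mul, zero_mul, Finset.sum_ite_eq, Finset.mem_univ, if_true]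
  rw [latChar_add, latChar_embed, latChar_latClass]
  ring

theorem avg_mulVec_latChar (𝔮 : ℕ) (hL : Odd L) (n : ℕ) (m : Fin 4 → ℤ) :
    (avg 𝔮 L T S n).mulVec (latChar L T S n m) =
      avgSymbol 𝔮 (scale L n) (fun ν => (momentum (period T S) m ν : ℂ)) • latChar L T S 0 m := by
  induction n with
  | zero => rw [avgSymbol_scale_zero, one_smul]; simp [avg]
  | succ n ih =>
    rw [avg, ← Matrix.mulVec_mulVec, avgStep_mulVec_latChar L T S 𝔮 hL, Matrix.mulVec_smul, ih,
      smul_smul, avgSymbol_scale_add_one 𝔮 hL n, mul_comm]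

theorem avg_real (𝔮 n : ℕ) (x : Lattice L T S 0) (y : Lattice L T S n) :
    (starRingEnd ℂ) (avg 𝔮 L T S n x y) = avg 𝔮 L T S n x y := by
  induction n with
  | zero =>
    simp only [avg, Matrix.one_apply]
    split_ifs <;> simp
  | succ n ih =>
    simp only [avg, Matrix.mul_apply, map_sum, map_mul, ih]
    refine Finset.sum_congr rfl fun z _ => ?_
    congr 1
    rw [avgStep, Complex.conj_tsum]
    refine tsum_congr fun w => ?_
    split_ifs <;> simp

/-- Fourier inversion on the `j`-th lattice. -/
theorem eq_sum_latChar (j : ℕ) (v : Lattice L T S j → ℂ) :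
    v = (∏ ν, ((scale L j ν * period T S ν : ℕ) : ℂ))⁻¹ •
      ∑ b ∈ shifts (period T S), ∑ ℓ ∈ shifts (scale L j),
        (∑ w, v w * (starRingEnd ℂ) (latChar L T S j (freq (period T S) b ℓ) w)) •
          latChar L T S j (freq (period T S) b ℓ) := by
  have hne : ∏ ν, ((scale L j ν * period T S ν : ℕ) : ℂ) ≠ 0 :=
    Finset.prod_ne_zero_iff.mpr fun ν _ => by
      exact_mod_cast (Nat.mul_pos (scale_pos (Nat.pos_of_neZero L) j ν) (period_pos T S ν)).ne'
  funext u
  simp only [Pi.smul_apply, Finset.sum_apply, smul_eq_mul, Finset.sum_mul]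
  rw [eq_inv_mul_iff_mul_eq₀ hne]
  have h1 : ∀ b ∈ shifts (period T S), (∑ ℓ ∈ shifts (scale L j), ∑ w,
      v w * (starRingEnd ℂ) (latChar L T S j (freq (period T S) b ℓ) w) *
        latChar L T S j (freq (period T S) b ℓ) u) = ∑ w, ∑ ℓ ∈ shifts (scale L j),
      v w * (starRingEnd ℂ) (latChar L T S j (freq (period T S) b ℓ) w) *
        latChar L T S j (freq (period T S) b ℓ) u := fun b _ => Finset.sum_comm
  rw [Finset.sum_congr rfl h1, Finset.sum_comm]
  have h2 : ∀ w, (∑ b ∈ shifts (period T S), ∑ ℓ ∈ shifts (scale L j),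
      v w * (starRingEnd ℂ) (latChar L T S j (freq (period T S) b ℓ) w) *
        latChar L T S j (freq (period T S) b ℓ) u) =
      v w * if u = w then ∏ ν, ((scale L j ν * period T S ν : ℕ) : ℂ) else 0 := by
    intro w
    rw [← sum_latChar_mul_conj, Finset.mul_sum]
    refine Finset.sum_congr rfl fun b _ => ?_
    rw [Finset.mul_sum]
    exact Finset.sum_congr rfl fun ℓ _ => by ring
  simp only [h2, mul_ite, mul_zero, Finset.sum_ite_eq, Finset.mem_univ, if_true]
  ring

/-- The characters span, and in finite dimension surjectivity is enough. -/
theorem isUnit_of_latChar_mem_range {j : ℕ} (A : Operator L T S j j)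
    (hA : ∀ b ∈ shifts (period T S), ∀ ℓ ∈ shifts (scale L j),
      latChar L T S j (freq (period T S) b ℓ) ∈ LinearMap.range A.mulVecLin) : IsUnit A := by
  rw [← Matrix.mulVec_surjective_iff_isUnit]
  intro v
  have h1 : v ∈ LinearMap.range A.mulVecLin := by
    rw [eq_sum_latChar L T S j v]
    exact Submodule.smul_mem _ _ (Submodule.sum_mem _ fun b hb => Submodule.sum_mem _ fun ℓ hℓ =>
      Submodule.smul_mem _ _ (hA b hb ℓ hℓ))
  obtain ⟨w, hw⟩ := h1
  exact ⟨w, hw⟩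

theorem avg_apply (𝔮 : ℕ) (hL : Odd L) (n : ℕ) (x : Lattice L T S 0) (y : Lattice L T S n) :
    avg 𝔮 L T S n x y = (∏ ν, ((scale L n ν * period T S ν : ℕ) : ℂ))⁻¹ *
      ∑ b ∈ shifts (period T S), ∑ ℓ ∈ shifts (scale L n),
        avgSymbol 𝔮 (scale L n) (shift (fun ν => (momentum (period T S) b ν : ℂ)) ℓ) *
          (starRingEnd ℂ) (latChar L T S 0 b x) * latChar L T S n (freq (period T S) b ℓ) y := by
  have h0 : avg 𝔮 L T S n x y = (avg 𝔮 L T S n).mulVec (Pi.single y 1) x := by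
    rw [Matrix.mulVec_single_one]; rfl
  -- The delta function at y is expanded in characters. The entry is first replaced by its complex
  -- conjugate, which is harmless since it is real, so that the conjugation ends up on the unit
  -- lattice, ready for orthogonality there.
  rw [← avg_real, h0, eq_sum_latChar L T S n (Pi.single y 1)]
  simp only [Matrix.mulVec_smul, Matrix.mulVec_sum, avg_mulVec_latChar L T S 𝔮 hL,
    momentum_freq (period_pos T S), latChar_level_zero_freq, Pi.smul_apply, Finset.sum_apply,
    smul_eq_mul, map_mul, map_sum]
  congr 1
  · rw [map_inv₀, map_prod]; simp
  refine Finset.sum_congr rfl fun b _ => Finset.sum_congr rfl fun ℓ _ => ?_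
  obtain ⟨r, hr⟩ := exists_avgSymbol_shift_ofReal 𝔮 (s := scale L n) (scale_odd hL n)
    (momentum (period T S) b) ℓ
  rw [hr, Finset.sum_eq_single_of_mem y (Finset.mem_univ y) (fun w _ hw => by
    simp [Pi.single_eq_of_ne hw])]
  simp
  ring

theorem adjoint_avg_mulVec_latChar (𝔮 : ℕ) (hL : Odd L) (n : ℕ) {b : Fin 4 → ℤ}
    (hb : b ∈ shifts (period T S)) :
    (adjoint L T S n 0 (avg 𝔮 L T S n)).mulVec (latChar L T S 0 b) =
      ∑ ℓ ∈ shifts (scale L n),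
        avgSymbol 𝔮 (scale L n) (shift (fun ν => (momentum (period T S) b ν : ℂ)) ℓ) •
          latChar L T S n (freq (period T S) b ℓ) := by
  have hLc : (L : ℂ) ≠ 0 := by exact_mod_cast hL.pos.ne'
  have hP : ∏ ν, (period T S ν : ℂ) ≠ 0 := Finset.prod_ne_zero_iff.mpr fun ν _ => by
    exact_mod_cast (period_pos T S ν).ne'
  have h0 : ∀ y, (Matrix.transpose (avg 𝔮 L T S n)).mulVec (latChar L T S 0 b) y =
      ∑ x, avg 𝔮 L T S n x y * latChar L T S 0 b x := fun y => rfl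
  funext y
  rw [adjoint, Matrix.smul_mulVec, Pi.smul_apply, h0]
  simp only [avg_apply L T S 𝔮 hL, Finset.sum_apply, Pi.smul_apply, smul_eq_mul]
  have h1 : ∀ x : Lattice L T S 0, ((∏ ν, ((scale L n ν * period T S ν : ℕ) : ℂ))⁻¹ *
      ∑ b ∈ shifts (period T S), ∑ ℓ ∈ shifts (scale L n),
        avgSymbol 𝔮 (scale L n) (shift (fun ν => (momentum (period T S) b ν : ℂ)) ℓ) *
          (starRingEnd ℂ) (latChar L T S 0 b x) * latChar L T S n (freq (period T S) b ℓ) y) *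
          latChar L T S 0 b x =
      (∏ ν, ((scale L n ν * period T S ν : ℕ) : ℂ))⁻¹ * ∑ b' ∈ shifts (period T S),
        (∑ ℓ ∈ shifts (scale L n),
        avgSymbol 𝔮 (scale L n) (shift (fun ν => (momentum (period T S) b' ν : ℂ)) ℓ) *
          latChar L T S n (freq (period T S) b' ℓ) y) *
          ((starRingEnd ℂ) (latChar L T S 0 b' x) * latChar L T S 0 b x) := by
    intro x
    rw [mul_assoc, Finset.sum_mul]
    congr 1
    refine Finset.sum_congr rfl fun b' _ => ?_
    rw [Finset.sum_mul, Finset.sum_mul]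
    exact Finset.sum_congr rfl fun ℓ _ => by ring
  rw [Finset.sum_congr rfl fun x _ => h1 x, ← Finset.mul_sum, Finset.sum_comm]
  simp only [← Finset.mul_sum]
  have h2 : ∀ b' ∈ shifts (period T S), (∑ ℓ ∈ shifts (scale L n),
        avgSymbol 𝔮 (scale L n) (shift (fun ν => (momentum (period T S) b' ν : ℂ)) ℓ) *
          latChar L T S n (freq (period T S) b' ℓ) y) *
          ∑ x, (starRingEnd ℂ) (latChar L T S 0 b' x) * latChar L T S 0 b x =
      if b' = b then (∑ ℓ ∈ shifts (scale L n),
        avgSymbol 𝔮 (scale L n) (shift (fun ν => (momentum (period T S) b ν : ℂ)) ℓ) *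
          latChar L T S n (freq (period T S) b ℓ) y) * ∏ ν, (period T S ν : ℂ) else 0 := by
    intro b' hb'
    rw [sum_conj_latChar_mul L T S hb' hb]
    split_ifs with h
    · rw [h]
    · rw [mul_zero]
  -- The factor L^{5n} in the adjoint cancels the number of fine lattice points per unit cell, so
  -- the adjoint has the same symbol u.
  rw [Finset.sum_congr rfl h2, Finset.sum_ite_eq' , if_pos hb, prod_scale_mul_period]
  field_simp
  simp

end

/-! ### The differential operator on characters -/

theorem exp_mulVec_of_eigenvector {ι : Type*} [Fintype ι] [DecidableEq ι] {A : Matrix ι ι ℂ}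
    {v : ι → ℂ} {μ : ℂ} (hA : A.mulVec v = μ • v) :
    (NormedSpace.exp A).mulVec v = Complex.exp μ • v := by
  -- A norm is chosen only to make sense of the convergence of the exponential series; it is then
  -- applied to v term by term.
  let _ : NormedRing (Matrix ι ι ℂ) := Matrix.linftyOpNormedRing
  let _ : NormedAlgebra ℂ (Matrix ι ι ℂ) := Matrix.linftyOpNormedAlgebra
  have hpow : ∀ k : ℕ, (A ^ k).mulVec v = μ ^ k • v := by
    intro k
    induction k with
    | zero => simp
    | succ k ih => rw [pow_succ, ← Matrix.mulVec_mulVec, hA, Matrix.mulVec_smul, ih, smul_smul,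
        pow_succ']
  have h1 := NormedSpace.exp_series_hasSum_exp' (𝕂 := ℂ) A
  have hc : Continuous fun B : Matrix ι ι ℂ => B.mulVec v :=
    continuous_id.matrix_mulVec continuous_const
  have h2 := h1.map (Matrix.mulVec.addMonoidHomLeft v) hc
  have h3 := (NormedSpace.exp_series_hasSum_exp' (𝕂 := ℂ) μ).smul_const v
  rw [← Complex.exp_eq_exp_ℂ] at h3
  refine h2.unique ?_
  have h4 : (⇑(Matrix.mulVec.addMonoidHomLeft v) ∘ fun n : ℕ => ((n.factorial : ℂ)⁻¹) • A ^ n) =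
      fun n : ℕ => (((n.factorial : ℂ)⁻¹) • μ ^ n) • v := by
    funext n
    change ((((n.factorial : ℂ)⁻¹) • A ^ n).mulVec v) = _
    rw [Matrix.smul_mulVec, hpow, smul_eq_mul, mul_smul]
  rw [h4]
  exact h3

/-- The spatial part of a character. -/
def spaceChar (N : ℕ) [NeZero N] (m : Fin 3 → ℤ) (x : Fin 3 → ZMod N) : ℂ :=
  ∏ i, ZMod.stdAddChar (N := N) ((m i : ZMod N) * x i)

theorem spaceChar_sub_intCast (N : ℕ) [NeZero N] (m : Fin 3 → ℤ) (x : Fin 3 → ZMod N)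
    (z : Fin 3 → ℤ) : spaceChar N m (fun i => x i - (z i : ZMod N)) =
      spaceChar N m x * Complex.exp (-Complex.I * ∑ i, ((2 * Real.pi * m i / N : ℝ) : ℂ) * z i) := by
  rw [Finset.mul_sum, Complex.exp_sum, spaceChar, spaceChar, ← Finset.prod_mul_distrib]
  refine Finset.prod_congr rfl fun i _ => ?_
  rw [mul_sub, sub_eq_add_neg, AddChar.map_add_eq_mul]
  have : -((m i : ZMod N) * (z i : ZMod N)) = ((-(m i * z i) : ℤ) : ZMod N) := by push_cast; ring
  rw [this, ZMod.stdAddChar_coe]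
  congr 2
  push_cast
  ring

theorem periodization_mulVec_spaceChar {h : (Fin 3 → ℤ) → ℂ} {hhat : (Fin 3 → ℂ) → ℂ}
    (H : IsHamiltonian h hhat) (N : ℕ) [NeZero N] (m : Fin 3 → ℤ) :
    (periodization N h).mulVec (spaceChar N m) =
      hhat (fun i => ((2 * Real.pi * m i / N : ℝ) : ℂ)) • spaceChar N m := by
  have hs : Summable h := by
    have := (H.fourier 0).summable
    refine this.congr fun x => ?_
    simp
  have hmv : ∀ x, (periodization N h).mulVec (spaceChar N m) x = ∑ y,
      (∑' z : Fin 3 → ℤ, if (fun i => (z i : ZMod N)) = x - y then h z else 0) *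
        spaceChar N m y := fun x => rfl
  funext x
  rw [hmv, Pi.smul_apply, smul_eq_mul]
  have h1 : ∀ y : Fin 3 → ZMod N, HasSum (fun z : Fin 3 → ℤ =>
      (if (fun i => (z i : ZMod N)) = x - y then h z else 0) * spaceChar N m y)
      ((∑' z : Fin 3 → ℤ, if (fun i => (z i : ZMod N)) = x - y then h z else 0) *
        spaceChar N m y) := by
    intro y
    refine HasSum.mul_right _ (Summable.hasSum ?_)
    refine Summable.of_norm_bounded hs.norm fun z => ?_
    split_ifs
    · exact le_rfl
    · rw [norm_zero]; exact norm_nonneg _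
  have h2 := hasSum_sum (s := Finset.univ) fun y _ => h1 y
  have h3 := (H.fourier fun i => 2 * Real.pi * m i / N).mul_right (spaceChar N m x)
  refine h2.unique (hasSum_of_eq (fun z => ?_) h3)
  have h4 : ∀ y : Fin 3 → ZMod N, ((fun i => (z i : ZMod N)) = x - y) ↔
      (fun i => x i - (z i : ZMod N)) = y := by
    intro y
    constructor
    · intro h; funext i
      have := congrFun h i
      simp only [Pi.sub_apply] at this
      rw [this]; ring
    · rintro rfl; funext i; simp
  simp only [h4, ite_mul, zero_mul, Finset.sum_ite_eq, Finset.mem_univ, if_true]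
  rw [spaceChar_sub_intCast]
  ring

theorem gramSymbol_momentum_ne_zero (L T S 𝔮 : ℕ) (hL : Odd L) (n : ℕ) (b : Fin 4 → ℤ) :
    gramSymbol 𝔮 L n (fun ν => (momentum (period T S) b ν : ℂ)) ≠ 0 := by
  obtain ⟨r, hr, h⟩ := exists_gramSymbol_ofReal 𝔮 hL n (momentum (period T S) b)
  rw [h]
  exact_mod_cast (by linarith : r ≠ 0)

section

variable (L T S : ℕ) [NeZero L] [NeZero T] [NeZero S]

theorem latChar_eq_mul_spaceChar (j : ℕ) (m : Fin 4 → ℤ) (t : ZMod (L ^ (2 * j) * T))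
    (x : Fin 3 → ZMod (L ^ j * S)) : latChar L T S j m (t, x) =
      ZMod.stdAddChar (N := L ^ (2 * j) * T) ((m 0 : ZMod (L ^ (2 * j) * T)) * t) *
        spaceChar (L ^ j * S) (fun i => m i.succ) x := rfl

theorem expNegH_mulVec_latChar {h : (Fin 3 → ℤ) → ℂ} {hhat : (Fin 3 → ℂ) → ℂ}
    (H : IsHamiltonian h hhat) (n : ℕ) (m : Fin 4 → ℤ) :
    (expNegH L T S n h).mulVec (latChar L T S n m) =
      Complex.exp (-hhat (spatial (L ^ n) fun ν => (momentum (period T S) m ν : ℂ))) •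
        latChar L T S n m := by
  have h1 := periodization_mulVec_spaceChar H (L ^ n * S) fun i => m i.succ
  have h2 : (fun i : Fin 3 => ((2 * Real.pi * m i.succ / (L ^ n * S : ℕ) : ℝ) : ℂ)) =
      spatial (L ^ n) fun ν => (momentum (period T S) m ν : ℂ) := by
    have hL : (L : ℂ) ≠ 0 := Nat.cast_ne_zero.mpr (NeZero.ne L)
    have hS : (S : ℂ) ≠ 0 := Nat.cast_ne_zero.mpr (NeZero.ne S)
    funext i
    simp only [spatial, momentum, period, Fin.cons_succ]
    push_cast
    field_simp
  rw [h2] at h1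
  have h3 : (-periodization (L ^ n * S) h).mulVec (spaceChar (L ^ n * S) fun i => m i.succ) =
      (-hhat (spatial (L ^ n) fun ν => (momentum (period T S) m ν : ℂ))) •
        spaceChar (L ^ n * S) fun i => m i.succ := by
    rw [Matrix.neg_mulVec, h1, neg_smul]
  have h4 := exp_mulVec_of_eigenvector h3
  funext u
  obtain ⟨t, x⟩ := u
  have h5 : (expNegH L T S n h).mulVec (latChar L T S n m) (t, x) =
      ∑ v : ZMod (L ^ (2 * n) * T) × (Fin 3 → ZMod (L ^ n * S)),
        ((1 : Matrix (ZMod (L ^ (2 * n) * T)) (ZMod (L ^ (2 * n) * T)) ℂ) t v.1 *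
        NormedSpace.exp (-periodization (L ^ n * S) h) x v.2) * latChar L T S n m (v.1, v.2) := rfl
  rw [h5, Fintype.sum_prod_type, Finset.sum_eq_single_of_mem t (Finset.mem_univ t) (fun t' _ ht =>
    Finset.sum_eq_zero fun x' _ => by rw [Matrix.one_apply_ne ht.symm, zero_mul, zero_mul])]
  have h6 := congrFun h4 x
  have h7 : (NormedSpace.exp (-periodization (L ^ n * S) h)).mulVec
      (spaceChar (L ^ n * S) fun i => m i.succ) x =
      ∑ x', NormedSpace.exp (-periodization (L ^ n * S) h) x x' *
        spaceChar (L ^ n * S) (fun i => m i.succ) x' := rfl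
  rw [h7, Pi.smul_apply, smul_eq_mul] at h6
  rw [Pi.smul_apply, smul_eq_mul, latChar_eq_mul_spaceChar, mul_left_comm, ← h6, Finset.mul_sum]
  refine Finset.sum_congr rfl fun x' _ => ?_
  rw [Matrix.one_apply_eq, one_mul, latChar_eq_mul_spaceChar]
  ring

theorem forwardDiff_mulVec_latChar (n : ℕ) (m : Fin 4 → ℤ) :
    (forwardDiff L T S n).mulVec (latChar L T S n m) =
      (Complex.exp (Complex.I * momentum (period T S) m 0 / ((L ^ n : ℕ) : ℂ) ^ 2) - 1) •
        latChar L T S n m := by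
  have h0 : ∀ u : Lattice L T S n, (forwardDiff L T S n).mulVec (latChar L T S n m) u =
      ∑ v, ((if ((u.1 + 1, u.2) : Lattice L T S n) = v then (1 : ℂ) else 0) -
        (if u = v then 1 else 0)) * latChar L T S n m v := fun u => rfl
  funext u
  rw [h0]
  simp only [sub_mul, Finset.sum_sub_distrib, ite_mul, one_mul, zero_mul, Finset.sum_ite_eq,
    Finset.mem_univ, if_true]
  have h1 : ((u.1 + 1, u.2) : Lattice L T S n) = u + latClass L T S n (1, 0) := by
    ext <;> simp [latClass]
  rw [h1, latChar_add, latChar_latClass, Pi.smul_apply, smul_eq_mul]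
  have h2 : wave (fun ν => (momentum (period T S) m ν : ℂ)) (position (scale L n) (1, 0)) =
      Complex.exp (Complex.I * momentum (period T S) m 0 / ((L ^ n : ℕ) : ℂ) ^ 2) := by
    rw [wave, Fin.sum_univ_succ]
    congr 1
    simp [position, coords]
    ring
  rw [h2]
  ring

theorem diffOp_mulVec_latChar {h : (Fin 3 → ℤ) → ℂ} {hhat : (Fin 3 → ℂ) → ℂ}
    (H : IsHamiltonian h hhat) (n : ℕ) (m : Fin 4 → ℤ) :
    (diffOp L T S n h).mulVec (latChar L T S n m) =
      diffSymbol (L ^ n) hhat (fun ν => (momentum (period T S) m ν : ℂ)) • latChar L T S n m := by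
  rw [diffOp, Matrix.smul_mulVec, Matrix.sub_mulVec, Matrix.sub_mulVec, Matrix.one_mulVec,
    ← Matrix.mulVec_mulVec, forwardDiff_mulVec_latChar, Matrix.mulVec_smul,
    expNegH_mulVec_latChar L T S H, smul_smul, diffSymbol]
  funext u
  simp only [Pi.smul_apply, Pi.sub_apply, smul_eq_mul]
  rw [neg_sub, sub_eq_add_neg (_ / _), Complex.exp_add]
  push_cast
  ring

/-! ### The block spin operators on characters -/

theorem avgGram_mulVec_latChar (𝔮 : ℕ) (hL : Odd L) (n : ℕ) {b : Fin 4 → ℤ}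
    (hb : b ∈ shifts (period T S)) :
    (avgGram 𝔮 L T S n).mulVec (latChar L T S 0 b) =
      gramSymbol 𝔮 L n (fun ν => (momentum (period T S) b ν : ℂ)) • latChar L T S 0 b := by
  rw [avgGram, gramSymbol, Matrix.add_mulVec, Matrix.one_mulVec, Matrix.sum_mulVec, add_smul,
    one_smul, Finset.sum_smul]
  refine congrArg (latChar L T S 0 b + ·) (Finset.sum_congr rfl fun j _ => ?_)
  rw [Matrix.smul_mulVec, ← Matrix.mulVec_mulVec, adjoint_avg_mulVec_latChar L T S 𝔮 hL j hb,
    Matrix.mulVec_sum, mul_smul, Finset.sum_smul]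
  refine congrArg _ (Finset.sum_congr rfl fun ℓ _ => ?_)
  rw [Matrix.mulVec_smul, avg_mulVec_latChar L T S 𝔮 hL, momentum_freq (period_pos T S),
    latChar_level_zero_freq, smul_smul, sq]

theorem isUnit_avgGram (𝔮 : ℕ) (hL : Odd L) (n : ℕ) : IsUnit (avgGram 𝔮 L T S n) := by
  refine isUnit_of_latChar_mem_range L T S _ fun b hb ℓ _ => ?_
  rw [latChar_level_zero_freq]
  refine ⟨(gramSymbol 𝔮 L n (fun ν => (momentum (period T S) b ν : ℂ)))⁻¹ • latChar L T S 0 b, ?_⟩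
  rw [map_smul, Matrix.mulVecLin_apply, avgGram_mulVec_latChar L T S 𝔮 hL n hb, smul_smul,
    inv_mul_cancel₀ (gramSymbol_momentum_ne_zero L T S 𝔮 hL n b), one_smul]

theorem frakQ_mulVec_latChar (𝔮 : ℕ) (hL : Odd L) (a : ℝ) (n : ℕ) {b : Fin 4 → ℤ}
    (hb : b ∈ shifts (period T S)) :
    (frakQ 𝔮 L T S a n).mulVec (latChar L T S 0 b) =
      ((a : ℂ) / gramSymbol 𝔮 L n (fun ν => (momentum (period T S) b ν : ℂ))) •
        latChar L T S 0 b := by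
  have h0 := gramSymbol_momentum_ne_zero L T S 𝔮 hL n b
  have hdet := (Matrix.isUnit_iff_isUnit_det _).mp (isUnit_avgGram L T S 𝔮 hL n)
  have h1 : latChar L T S 0 b =
      gramSymbol 𝔮 L n (fun ν => (momentum (period T S) b ν : ℂ)) •
        ((avgGram 𝔮 L T S n)⁻¹).mulVec (latChar L T S 0 b) := by
    rw [← Matrix.mulVec_smul, ← avgGram_mulVec_latChar L T S 𝔮 hL n hb, Matrix.mulVec_mulVec,
      Matrix.nonsing_inv_mul _ hdet, Matrix.one_mulVec]
  rw [frakQ, Matrix.smul_mulVec, div_eq_mul_inv, mul_smul]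
  congr 1
  conv_rhs => rw [h1]
  rw [smul_smul, inv_mul_cancel₀ h0, one_smul]

/-- Diagonal plus rank one: whatever ℓ is, the second term is a multiple of the same vector, the
image of the unit lattice character under `Q_n^*`. -/
theorem greenInv_mulVec_latChar {h : (Fin 3 → ℤ) → ℂ} {hhat : (Fin 3 → ℂ) → ℂ}
    (H : IsHamiltonian h hhat) (𝔮 : ℕ) (hL : Odd L) (a : ℝ) (n : ℕ) {b : Fin 4 → ℤ}
    (hb : b ∈ shifts (period T S)) (ℓ : Fin 4 → ℤ) :
    (greenInv 𝔮 L T S a h n).mulVec (latChar L T S n (freq (period T S) b ℓ)) =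
      diffSymbol (L ^ n) hhat (shift (fun ν => (momentum (period T S) b ν : ℂ)) ℓ) •
        latChar L T S n (freq (period T S) b ℓ) +
      (avgSymbol 𝔮 (scale L n) (shift (fun ν => (momentum (period T S) b ν : ℂ)) ℓ) *
        (a / gramSymbol 𝔮 L n (fun ν => (momentum (period T S) b ν : ℂ)))) •
        (adjoint L T S n 0 (avg 𝔮 L T S n)).mulVec (latChar L T S 0 b) := by
  rw [greenInv, Matrix.add_mulVec, diffOp_mulVec_latChar L T S H, ← Matrix.mulVec_mulVec,
    avg_mulVec_latChar L T S 𝔮 hL, Matrix.mulVec_smul, latChar_level_zero_freq,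
    ← Matrix.mulVec_mulVec, frakQ_mulVec_latChar L T S 𝔮 hL a n hb, Matrix.mulVec_smul, smul_smul,
    momentum_freq (period_pos T S)]

end

/-! ### The Green's function on characters -/

theorem diffSymbol_mul_diffRatio {M : ℕ} {hhat : (Fin 3 → ℂ) → ℂ} {k : Fin 4 → ℂ} {ℓ : Fin 4 → ℤ}
    (h : ℓ ≠ 0 → diffSymbol M hhat (shift k ℓ) ≠ 0) :
    diffSymbol M hhat (shift k ℓ) * diffRatio M hhat k ℓ = diffSymbol M hhat k := by
  rw [diffRatio]
  split_ifs with h0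
  · rw [h0, shift_zero, mul_one]
  · exact mul_div_cancel₀ _ (h h0)

theorem sum_avgSymbol_mul_greenSymbol (𝔮 L n : ℕ) (a : ℝ) (hhat : (Fin 3 → ℂ) → ℂ)
    (k : Fin 4 → ℂ) :
    ∑ ℓ ∈ shifts (scale L n), greenSymbol 𝔮 L n a hhat k ℓ * avgSymbol 𝔮 (scale L n) (shift k ℓ) =
      gramSymbol 𝔮 L n k / a *
        (greenDenom 𝔮 L n a hhat k - diffSymbol (L ^ n) hhat k * (gramSymbol 𝔮 L n k / a)) /
        greenDenom 𝔮 L n a hhat k := by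
  have h1 : greenDenom 𝔮 L n a hhat k - diffSymbol (L ^ n) hhat k * (gramSymbol 𝔮 L n k / a) =
      ∑ ℓ ∈ shifts (scale L n),
        avgSymbol 𝔮 (scale L n) (shift k ℓ) ^ 2 * diffRatio (L ^ n) hhat k ℓ := by
    rw [greenDenom]; ring
  rw [h1, Finset.mul_sum, Finset.sum_div]
  refine Finset.sum_congr rfl fun ℓ _ => ?_
  rw [greenSymbol]
  ring

section

variable (L T S : ℕ) [NeZero L] [NeZero T] [NeZero S]

/-- The Sherman–Morrison formula, verified by substitution. Both the diagonal and the rank one part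
produce a multiple of `Q_n^* e_b`, and the two factors add up to 1. Nothing is divided by D(k), so
momentum zero needs no separate treatment. -/
theorem greenInv_mulVec_sum_greenSymbol {h : (Fin 3 → ℤ) → ℂ} {hhat : (Fin 3 → ℂ) → ℂ}
    (H : IsHamiltonian h hhat) (𝔮 : ℕ) (hL : Odd L) {a : ℝ} (ha : a ≠ 0) (n : ℕ) {b : Fin 4 → ℤ}
    (hb : b ∈ shifts (period T S))
    (hD : ∀ ℓ ∈ shifts (scale L n), ℓ ≠ 0 →
      diffSymbol (L ^ n) hhat (shift (fun ν => (momentum (period T S) b ν : ℂ)) ℓ) ≠ 0)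
    (hΦ : greenDenom 𝔮 L n a hhat (fun ν => (momentum (period T S) b ν : ℂ)) ≠ 0) :
    (greenInv 𝔮 L T S a h n).mulVec (∑ ℓ ∈ shifts (scale L n),
        greenSymbol 𝔮 L n a hhat (fun ν => (momentum (period T S) b ν : ℂ)) ℓ •
          latChar L T S n (freq (period T S) b ℓ)) =
      (adjoint L T S n 0 (avg 𝔮 L T S n)).mulVec (latChar L T S 0 b) := by
  have hg := gramSymbol_momentum_ne_zero L T S 𝔮 hL n b
  have hw := adjoint_avg_mulVec_latChar L T S 𝔮 hL n hb
  have hA := fun ℓ => greenInv_mulVec_latChar L T S H 𝔮 hL a n hb ℓ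
  set k : Fin 4 → ℂ := fun ν => (momentum (period T S) b ν : ℂ)
  set w := (adjoint L T S n 0 (avg 𝔮 L T S n)).mulVec (latChar L T S 0 b)
  set g := gramSymbol 𝔮 L n k
  set Φ := greenDenom 𝔮 L n a hhat k with hΦdef
  have hac : (a : ℂ) ≠ 0 := by exact_mod_cast ha
  have h1 : ∀ ℓ ∈ shifts (scale L n), greenSymbol 𝔮 L n a hhat k ℓ •
      (greenInv 𝔮 L T S a h n).mulVec (latChar L T S n (freq (period T S) b ℓ)) =
      (g / a * diffSymbol (L ^ n) hhat k / Φ) • (avgSymbol 𝔮 (scale L n) (shift k ℓ) •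
        latChar L T S n (freq (period T S) b ℓ)) +
      (greenSymbol 𝔮 L n a hhat k ℓ * avgSymbol 𝔮 (scale L n) (shift k ℓ)) • (a / g) • w := by
    intro ℓ hℓ
    rw [hA, smul_add, smul_smul, smul_smul, smul_smul, smul_smul, ← mul_assoc,
      ← diffSymbol_mul_diffRatio (hD ℓ hℓ), greenSymbol]
    congr 2
    ring
  rw [Matrix.mulVec_sum]
  simp only [Matrix.mulVec_smul]
  rw [Finset.sum_congr rfl h1, Finset.sum_add_distrib, ← Finset.smul_sum, ← hw, ← Finset.sum_smul,
    sum_avgSymbol_mul_greenSymbol, smul_smul, ← add_smul, ← hΦdef]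
  have h2 : g / a * diffSymbol (L ^ n) hhat k / Φ +
      g / a * (Φ - diffSymbol (L ^ n) hhat k * (g / a)) / Φ * (a / g) = 1 := by
    field_simp
    ring
  rw [h2, one_smul]

/-- The range contains `Q_n^* e_b`. Subtracting the rank one part and dividing by D(k + 2πℓ) puts
every character with ℓ ≠ 0 into it. For ℓ = 0 this division may be impossible, and that character is
recovered from `Q_n^* e_b` instead. -/
theorem isUnit_greenInv {h : (Fin 3 → ℤ) → ℂ} {hhat : (Fin 3 → ℂ) → ℂ}
    (H : IsHamiltonian h hhat) (𝔮 : ℕ) (hL : Odd L) {a : ℝ} (ha : a ≠ 0) (n : ℕ)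
    (hD : ∀ b ∈ shifts (period T S), ∀ ℓ ∈ shifts (scale L n), ℓ ≠ 0 →
      diffSymbol (L ^ n) hhat (shift (fun ν => (momentum (period T S) b ν : ℂ)) ℓ) ≠ 0)
    (hΦ : ∀ b ∈ shifts (period T S),
      greenDenom 𝔮 L n a hhat (fun ν => (momentum (period T S) b ν : ℂ)) ≠ 0) :
    IsUnit (greenInv 𝔮 L T S a h n) := by
  refine isUnit_of_latChar_mem_range L T S _ fun b hb => ?_
  have hw := adjoint_avg_mulVec_latChar L T S 𝔮 hL n hb
  have hA := fun ℓ => greenInv_mulVec_latChar L T S H 𝔮 hL a n hb ℓ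
  have hwr : (adjoint L T S n 0 (avg 𝔮 L T S n)).mulVec (latChar L T S 0 b) ∈
      LinearMap.range (greenInv 𝔮 L T S a h n).mulVecLin :=
    ⟨_, greenInv_mulVec_sum_greenSymbol L T S H 𝔮 hL ha n hb (hD b hb) (hΦ b hb)⟩
  have h1 : ∀ ℓ ∈ shifts (scale L n), ℓ ≠ 0 → latChar L T S n (freq (period T S) b ℓ) ∈
      LinearMap.range (greenInv 𝔮 L T S a h n).mulVecLin := by
    intro ℓ hℓ h0
    rw [← Submodule.smul_mem_iff _ (hD b hb ℓ hℓ h0), ← sub_eq_iff_eq_add.mpr (hA ℓ)]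
    exact Submodule.sub_mem _ ⟨_, rfl⟩ (Submodule.smul_mem _ _ hwr)
  intro ℓ hℓ
  rcases eq_or_ne ℓ 0 with rfl | h0
  -- The coefficient of the remaining character in `Q_n^* e_b` is u(k), nonzero because k lies in
  -- the central zone.
  · have hu : avgSymbol 𝔮 (scale L n) (shift (fun ν => (momentum (period T S) b ν : ℂ)) 0) ≠ 0 := by
      rw [shift_zero, ← norm_pos_iff]
      exact lt_of_lt_of_le (by positivity) (le_norm_avgSymbol_ofReal 𝔮 (scale_odd hL n) _
        (abs_momentum_le (period_pos T S) hb))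
    rw [← Submodule.smul_mem_iff _ hu]
    rw [← Finset.add_sum_erase _ _ hℓ] at hw
    rw [← sub_eq_iff_eq_add.mpr hw]
    exact Submodule.sub_mem _ hwr (Submodule.sum_mem _ fun ℓ' h' => Submodule.smul_mem _ _
      (h1 ℓ' (Finset.mem_of_mem_erase h') (Finset.ne_of_mem_erase h')))
  · exact h1 ℓ hℓ h0

/-! ### The kernel of `S_n Q_n^*` -/

theorem single_eq_sum_latChar (x : Lattice L T S 0) :
    (Pi.single x 1 : Lattice L T S 0 → ℂ) = (∏ ν, (period T S ν : ℂ))⁻¹ •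
      ∑ b ∈ shifts (period T S), (starRingEnd ℂ) (latChar L T S 0 b x) • latChar L T S 0 b := by
  have hs : (shifts (scale L 0)).card = 1 := by
    rw [card_shifts]
    refine Finset.prod_eq_one fun ν _ => ?_
    refine Fin.cases ?_ (fun i => ?_) ν <;> simp
  have hp : ∏ ν, ((scale L 0 ν * period T S ν : ℕ) : ℂ) = ∏ ν, (period T S ν : ℂ) := by
    rw [prod_scale_mul_period]; simp
  have h1 := eq_sum_latChar L T S 0 (Pi.single x 1 : Lattice L T S 0 → ℂ)
  rw [hp] at h1
  simpa only [latChar_level_zero_freq, Finset.sum_const, hs, one_smul, Pi.single_apply, ite_mul,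
    one_mul, zero_mul, Finset.sum_ite_eq', Finset.mem_univ, if_true] using h1

theorem wave_sub (p : Fin 4 → ℂ) (y x : Fin 4 → ℝ) : wave p (y - x) = wave p y * wave p (-x) := by
  rw [wave, wave, wave, ← Complex.exp_add, ← mul_add, ← Finset.sum_add_distrib]
  congr 2
  refine Finset.sum_congr rfl fun ν _ => ?_
  simp only [Pi.sub_apply, Pi.neg_apply]
  push_cast
  ring

theorem conj_latChar_eq_wave (j : ℕ) (m : Fin 4 → ℤ) (u : Lattice L T S j) :
    (starRingEnd ℂ) (latChar L T S j m u) = wave (fun ν => (momentum (period T S) m ν : ℂ))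
      (-position (scale L j) (label u)) := by
  rw [latChar_eq_wave, wave, wave, ← Complex.exp_conj]
  congr 1
  simp [Finset.sum_neg_distrib]

theorem latChar_mul_conj_latChar (n : ℕ) (b ℓ : Fin 4 → ℤ) (y : Lattice L T S n)
    (x : Lattice L T S 0) :
    latChar L T S n (freq (period T S) b ℓ) y * (starRingEnd ℂ) (latChar L T S 0 b x) =
      wave (shift (fun ν => (momentum (period T S) b ν : ℂ)) ℓ)
        (position (scale L n) (label y) - position (scale L 0) (label x)) := by
  rw [← latChar_level_zero_freq L T S b ℓ, conj_latChar_eq_wave, latChar_eq_wave,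
    momentum_freq (period_pos T S), wave_sub]

theorem greenAvgAdj_apply {h : (Fin 3 → ℤ) → ℂ} {hhat : (Fin 3 → ℂ) → ℂ}
    (H : IsHamiltonian h hhat) (𝔮 : ℕ) (hL : Odd L) {a : ℝ} (ha : a ≠ 0) (n : ℕ)
    (hD : ∀ b ∈ shifts (period T S), ∀ ℓ ∈ shifts (scale L n), ℓ ≠ 0 →
      diffSymbol (L ^ n) hhat (shift (fun ν => (momentum (period T S) b ν : ℂ)) ℓ) ≠ 0)
    (hΦ : ∀ b ∈ shifts (period T S),
      greenDenom 𝔮 L n a hhat (fun ν => (momentum (period T S) b ν : ℂ)) ≠ 0)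
    (y : Lattice L T S n) (x : Lattice L T S 0) :
    greenAvgAdj 𝔮 L T S a h n y x = greenKernel 𝔮 L n a hhat (period T S)
      (position (scale L n) (label y) - position (scale L 0) (label x)) := by
  have hdet := (Matrix.isUnit_iff_isUnit_det _).mp (isUnit_greenInv L T S H 𝔮 hL ha n hD hΦ)
  have h1 : ∀ b ∈ shifts (period T S), (greenAvgAdj 𝔮 L T S a h n).mulVec (latChar L T S 0 b) =
      ∑ ℓ ∈ shifts (scale L n),
        greenSymbol 𝔮 L n a hhat (fun ν => (momentum (period T S) b ν : ℂ)) ℓ •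
          latChar L T S n (freq (period T S) b ℓ) := by
    intro b hb
    rw [greenAvgAdj, ← Matrix.mulVec_mulVec,
      ← greenInv_mulVec_sum_greenSymbol L T S H 𝔮 hL ha n hb (hD b hb) (hΦ b hb), green,
      Matrix.mulVec_mulVec, Matrix.nonsing_inv_mul _ hdet, Matrix.one_mulVec]
  have h0 : greenAvgAdj 𝔮 L T S a h n y x =
      (greenAvgAdj 𝔮 L T S a h n).mulVec (Pi.single x 1) y := by
    rw [Matrix.mulVec_single_one]; rfl
  rw [h0, single_eq_sum_latChar, Matrix.mulVec_smul, Matrix.mulVec_sum, greenKernel, Pi.smul_apply,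
    smul_eq_mul, Finset.sum_apply]
  refine congrArg _ (Finset.sum_congr rfl fun b hb => ?_)
  rw [Matrix.mulVec_smul, h1 b hb, Pi.smul_apply, Finset.sum_apply, smul_eq_mul, Finset.mul_sum,
    greenFiber]
  refine Finset.sum_congr rfl fun ℓ _ => ?_
  rw [Pi.smul_apply, smul_eq_mul, ← latChar_mul_conj_latChar]
  ring

end

/-! ### Distances on the torus -/

/-- Passing to the ℓ¹ distance makes the exponential weights factor over the four directions. -/
theorem torusDist_le_sum (L T S j k : ℕ) (u : Lattice L T S j) (v : Lattice L T S k) :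
    torusDist L T S j k u v ≤ ∑ ν, ‖((position (scale L j) (label u) ν -
      position (scale L k) (label v) ν : ℝ) : AddCircle (period T S ν : ℝ))‖ := by
  set d : Fin 4 → ℝ := fun ν => ‖((position (scale L j) (label u) ν -
    position (scale L k) (label v) ν : ℝ) : AddCircle (period T S ν : ℝ))‖ with hd
  have h1 : torusDist L T S j k u v = Real.sqrt (∑ ν, d ν ^ 2) := by
    rw [Fin.sum_univ_succ, torusDist]
    congr 4
    · simp only [timePos, position, coords, label, scale_zero, Fin.cons_zero, Int.cast_natCast]
      push_cast
      simp only [← pow_mul, mul_comm 2]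
      rfl
    · funext i
      simp only [hd, spacePos, position, coords, label, scale_succ, Fin.cons_succ, Int.cast_natCast]
      push_cast
      rfl
  rw [h1, Real.sqrt_le_iff]
  exact ⟨Finset.sum_nonneg fun ν _ => norm_nonneg _,
    Finset.sum_sq_le_sq_sum_of_nonneg fun ν _ => norm_nonneg _⟩

/-! ### Sums over the lattices -/

/-- Comparison with the geometric series over ℤ, using e^{-t} ≤ 1/(1 + t). The growth of order 1/t
for small t is what cancels the lattice spacing when t = c/M. -/
theorem sum_exp_neg_mul_abs_le {V : Type*} [Fintype V] {φ : V → ℤ} (hφ : Function.Injective φ)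
    {t : ℝ} (ht : 0 < t) : ∑ v, Real.exp (-(t * |(φ v : ℝ)|)) ≤ 2 * ((1 + t) / t) := by
  have hr : Real.exp (-t) < 1 := Real.exp_lt_one_iff.mpr (by linarith)
  have hr0 : 0 < Real.exp (-t) := Real.exp_pos _
  have h1 : HasSum (fun n : ℕ => Real.exp (-(t * |((n : ℤ) : ℝ)|))) (1 - Real.exp (-t))⁻¹ := by
    refine (hasSum_geometric_of_lt_one hr0.le hr).congr_fun ?_
    intro n
    rw [← Real.exp_nat_mul]
    congr 1
    simp; ring
  have h2 : HasSum (fun n : ℕ => Real.exp (-(t * |((-(n + 1) : ℤ) : ℝ)|)))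
      (Real.exp (-t) * (1 - Real.exp (-t))⁻¹) := by
    refine ((hasSum_geometric_of_lt_one hr0.le hr).mul_left (Real.exp (-t))).congr_fun ?_
    intro n
    rw [← Real.exp_nat_mul, ← Real.exp_add]
    congr 1
    push_cast
    rw [abs_neg, abs_of_nonneg (by positivity)]
    ring
  have h3 := HasSum.of_nat_of_neg_add_one (f := fun x : ℤ => Real.exp (-(t * |(x : ℝ)|))) h1 h2
  have h4 : ∑ v, Real.exp (-(t * |(φ v : ℝ)|)) =
      ∑ x ∈ Finset.univ.map ⟨φ, hφ⟩, Real.exp (-(t * |(x : ℝ)|)) := by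
    rw [Finset.sum_map]; rfl
  rw [h4]
  refine (sum_le_hasSum _ (fun x _ => (Real.exp_pos _).le) h3).trans ?_
  have h5 : (1 - Real.exp (-t))⁻¹ ≤ (1 + t) / t := by
    rw [inv_le_comm₀ (by linarith) (by positivity), inv_div]
    have h6 : Real.exp (-t) ≤ (1 + t)⁻¹ := by
      rw [Real.exp_neg]
      exact inv_anti₀ (by linarith) (by linarith [Real.add_one_le_exp t])
    have h7 : t / (1 + t) = 1 - (1 + t)⁻¹ := by field_simp; ring
    linarith
  have h8 : 0 ≤ (1 - Real.exp (-t))⁻¹ := inv_nonneg.mpr (by linarith)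
  nlinarith

/-- A bound, uniform in the lattice spacing and the period, for the integral of a decaying
exponential over a one dimensional periodic lattice. -/
theorem sum_exp_neg_mul_norm_addCircle_le {c : ℝ} (hc : 0 < c) (M R : ℕ) [NeZero M] [NeZero R]
    (z : ℝ) : (M : ℝ)⁻¹ * ∑ v : ZMod (M * R),
      Real.exp (-(c * ‖((((v.val : ℝ) / M - z : ℝ)) : AddCircle (R : ℝ))‖)) ≤
      Real.exp c * (2 * ((1 + c) / c)) := by
  have hM : (1 : ℝ) ≤ M := by exact_mod_cast NeZero.one_le
  have hM0 : (M : ℝ) ≠ 0 := by linarith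
  have hR : (R : ℝ) ≠ 0 := by exact_mod_cast NeZero.ne R
  -- The integer representative of v for which w/M is nearest to z. Below, zM is replaced by its
  -- floor to reach integers; the error is at most one lattice spacing and costs e^{c/M} ≤ e^c.
  set w : ZMod (M * R) → ℤ := fun v =>
    v.val - (M * R : ℕ) * round ((R : ℝ)⁻¹ * ((v.val : ℝ) / M - z)) with hw
  have hinj : Function.Injective fun v => w v - ⌊z * M⌋ := by
    intro v v' h
    have h1 : w v = w v' := by simpa using h
    have h2 : ((w v : ℤ) : ZMod (M * R)) = (w v' : ℤ) := by rw [h1]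
    simp only [hw, Int.cast_sub, Int.cast_mul, Int.cast_natCast, ZMod.natCast_self, zero_mul,
      sub_zero, ZMod.natCast_zmod_val] at h2
    exact h2
  have h1 : ∀ v : ZMod (M * R),
      Real.exp (-(c * ‖((((v.val : ℝ) / M - z : ℝ)) : AddCircle (R : ℝ))‖)) ≤
        Real.exp c * Real.exp (-(c / M * |((w v - ⌊z * M⌋ : ℤ) : ℝ)|)) := by
    intro v
    rw [← Real.exp_add, Real.exp_le_exp, AddCircle.norm_eq]
    have h2 : (v.val : ℝ) / M - z - round ((R : ℝ)⁻¹ * ((v.val : ℝ) / M - z)) * R =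
        ((w v : ℝ) - z * M) / M := by
      simp only [hw]
      push_cast
      field_simp
      ring
    rw [h2, abs_div, Nat.abs_cast]
    have h3 : |((w v - ⌊z * M⌋ : ℤ) : ℝ)| ≤ |(w v : ℝ) - z * M| + 1 := by
      have h4 := abs_sub_le ((w v : ℝ)) (z * M) (⌊z * M⌋ : ℝ)
      have h5 : |z * M - (⌊z * M⌋ : ℝ)| ≤ 1 := by
        rw [abs_of_nonneg (sub_nonneg.mpr (Int.floor_le _))]
        linarith [Int.lt_floor_add_one (z * M)]
      push_cast
      linarith
    have h6 : c / M * |((w v - ⌊z * M⌋ : ℤ) : ℝ)| ≤ c / M * (|(w v : ℝ) - z * M| + 1) :=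
      mul_le_mul_of_nonneg_left h3 (by positivity)
    have h7 : c / M ≤ c := div_le_self hc.le hM
    have h8 : c / M * (|(w v : ℝ) - z * M| + 1) = c * (|(w v : ℝ) - z * M| / M) + c / M := by ring
    linarith
  have h2 := sum_exp_neg_mul_abs_le hinj (t := c / M) (by positivity)
  have h3 : (1 + c / M) / (c / M) ≤ M * ((1 + c) / c) := by
    have h7 : c / M ≤ c := div_le_self hc.le hM
    rw [div_div_eq_mul_div, mul_comm (M : ℝ), div_mul_eq_mul_div]
    gcongr
  calc (M : ℝ)⁻¹ * ∑ v : ZMod (M * R),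
      Real.exp (-(c * ‖((((v.val : ℝ) / M - z : ℝ)) : AddCircle (R : ℝ))‖))
      ≤ (M : ℝ)⁻¹ * (Real.exp c * (2 * (M * ((1 + c) / c)))) := by
        refine mul_le_mul_of_nonneg_left ?_ (by positivity)
        refine (Finset.sum_le_sum fun v _ => h1 v).trans ?_
        rw [← Finset.mul_sum]
        refine mul_le_mul_of_nonneg_left (h2.trans ?_) (Real.exp_pos _).le
        linarith
    _ = Real.exp c * (2 * ((1 + c) / c)) := by field_simp

section

variable (L T S : ℕ) [NeZero L] [NeZero T] [NeZero S]

theorem sum_lattice_exp_le {c : ℝ} (hc : 0 < c) (j : ℕ) (z : Fin 4 → ℝ) :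
    ((L : ℝ) ^ (5 * j))⁻¹ * ∑ u : Lattice L T S j, Real.exp (-(c * ∑ ν,
      ‖((position (scale L j) (label u) ν - z ν : ℝ) : AddCircle (period T S ν : ℝ))‖)) ≤
      (Real.exp c * (2 * ((1 + c) / c))) ^ 4 := by
  set B := Real.exp c * (2 * ((1 + c) / c))
  have hB : 0 ≤ B := by positivity
  set f : ZMod (L ^ (2 * j) * T) → ℝ := fun v => Real.exp (-(c *
    ‖((((v.val : ℝ) / (L ^ (2 * j) : ℕ) - z 0 : ℝ)) : AddCircle (T : ℝ))‖)) with hf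
  set g : Fin 3 → ZMod (L ^ j * S) → ℝ := fun i v => Real.exp (-(c *
    ‖((((v.val : ℝ) / (L ^ j : ℕ) - z i.succ : ℝ)) : AddCircle (S : ℝ))‖)) with hg
  have h1 : ∀ u : Lattice L T S j, Real.exp (-(c * ∑ ν,
      ‖((position (scale L j) (label u) ν - z ν : ℝ) : AddCircle (period T S ν : ℝ))‖)) =
      f u.1 * ∏ i, g i (u.2 i) := by
    intro u
    rw [Fin.sum_univ_succ, mul_add, neg_add, Real.exp_add, Finset.mul_sum,
      ← Finset.sum_neg_distrib, Real.exp_sum]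
    rfl
  have h2 : ∑ u : Lattice L T S j, f u.1 * ∏ i, g i (u.2 i) = (∑ v, f v) * ∏ i, ∑ v, g i v := by
    rw [Fintype.sum_prod_type, Finset.sum_mul]
    refine Finset.sum_congr rfl fun v _ => ?_
    rw [Finset.prod_univ_sum, Fintype.piFinset_univ, Finset.mul_sum]
  have hf1 : ((L ^ (2 * j) : ℕ) : ℝ)⁻¹ * ∑ v, f v ≤ B :=
    sum_exp_neg_mul_norm_addCircle_le hc (L ^ (2 * j)) T (z 0)
  have hg1 : ∀ i, ((L ^ j : ℕ) : ℝ)⁻¹ * ∑ v, g i v ≤ B := fun i =>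
    sum_exp_neg_mul_norm_addCircle_le hc (L ^ j) S (z i.succ)
  have hg0 : ∀ i, 0 ≤ ((L ^ j : ℕ) : ℝ)⁻¹ * ∑ v, g i v := fun i =>
    mul_nonneg (by positivity) (Finset.sum_nonneg fun v _ => (Real.exp_pos _).le)
  have h3 : ((L : ℝ) ^ (5 * j))⁻¹ * ((∑ v, f v) * ∏ i, ∑ v, g i v) =
      (((L ^ (2 * j) : ℕ) : ℝ)⁻¹ * ∑ v, f v) * ∏ i, (((L ^ j : ℕ) : ℝ)⁻¹ * ∑ v, g i v) := by
    rw [Finset.prod_mul_distrib]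
    have : ((L : ℝ) ^ (5 * j))⁻¹ = ((L ^ (2 * j) : ℕ) : ℝ)⁻¹ *
        ∏ _i : Fin 3, ((L ^ j : ℕ) : ℝ)⁻¹ := by
      simp only [Finset.prod_const, Finset.card_univ, Fintype.card_fin]
      push_cast
      rw [inv_pow, ← mul_inv, ← pow_mul, ← pow_add]
      congr 2
      ring
    rw [this]
    ring
  rw [Finset.sum_congr rfl fun u _ => h1 u, h2, h3]
  calc _ ≤ B * ∏ _i : Fin 3, B :=
        mul_le_mul hf1 (Finset.prod_le_prod (fun i _ => hg0 i) fun i _ => hg1 i)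
          (Finset.prod_nonneg fun i _ => hg0 i) hB
    _ = B ^ 4 := by simp; ring

end

/-! ### Decay of `S_n Q_n^*` -/

theorem scale_level_zero (L : ℕ) (ν : Fin 4) : scale L 0 ν = 1 := by
  refine Fin.cases ?_ (fun i => ?_) ν <;> simp

theorem position_sub_mul_scale {L T S n : ℕ} (hL : 0 < L) (y : Lattice L T S n)
    (x : Lattice L T S 0) (ν : Fin 4) :
    (position (scale L n) (label y) - position (scale L 0) (label x)) ν * (scale L n ν : ℕ) =
      ((coords (label y) ν - coords (label x) ν * scale L n ν : ℤ) : ℝ) := by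
  have hs : ((scale L n ν : ℕ) : ℝ) ≠ 0 := by exact_mod_cast (scale_pos hL n ν).ne'
  simp only [Pi.sub_apply, position, scale_level_zero]
  push_cast
  field_simp

/-- The one-direction estimate is used in the direction where the displacement is largest. The sum
of the four distances is at most four times the maximum, hence the rate m/4. -/
theorem exists_greenAvgAdj_bound {𝔮 : ℕ} (h𝔮 : 2 ≤ 𝔮) {a : ℝ} (ha : 0 < a)
    {h : (Fin 3 → ℤ) → ℂ} {hhat : (Fin 3 → ℂ) → ℂ} (H : IsHamiltonian h hhat) :
    ∃ m : ℝ, 0 < m ∧ ∃ C : ℝ, 0 < C ∧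
      ∀ (L T S n : ℕ) [NeZero L] [NeZero T] [NeZero S], Odd L → 1 < L →
        IsUnit (greenInv 𝔮 L T S a h n) ∧
        ∀ (y : Lattice L T S n) (x : Lattice L T S 0),
          ‖greenAvgAdj 𝔮 L T S a h n y x‖ ≤ C * Real.exp (-(m * ∑ ν,
            ‖((position (scale L n) (label y) ν - position (scale L 0) (label x) ν : ℝ) :
              AddCircle (period T S ν : ℝ))‖)) := by
  obtain ⟨m, hm, C, hC, hG⟩ := exists_greenKernel_bound h𝔮 ha H
  obtain ⟨m', hm', -, C', -, hX⟩ := exists_greenSymbol_bounds h𝔮 ha H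
  refine ⟨m / 4, by positivity, C, hC, fun L T S n _ _ _ hL hL1 => ?_⟩
  have hb : ∀ b ∈ shifts (period T S), _ := fun b hb => hX L n hL hL1 (momentum (period T S) b)
    (abs_momentum_le (period_pos T S) hb) (fun ν => (momentum (period T S) b ν : ℂ))
    fun ν => by rw [sub_self, norm_zero]; exact hm'.le
  have hD := fun b h1 ℓ hℓ (h0 : ℓ ≠ 0) => (hb b h1).1 ℓ hℓ (Or.inl h0)
  have hΦ := fun b h1 => (hb b h1).2.1
  refine ⟨isUnit_greenInv L T S H 𝔮 hL ha.ne' n hD hΦ, fun y x => ?_⟩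
  rw [greenAvgAdj_apply L T S H 𝔮 hL ha.ne' n hD hΦ]
  obtain ⟨ν, hν⟩ := Finite.exists_max fun ν => ‖((position (scale L n) (label y) ν -
    position (scale L 0) (label x) ν : ℝ) : AddCircle (period T S ν : ℝ))‖
  refine (hG L n hL hL1 (period T S) (period_pos T S) _ ν _
    (position_sub_mul_scale hL.pos y x ν)).trans ?_
  gcongr ?_ * Real.exp ?_
  have h1 := Finset.sum_le_card_nsmul Finset.univ _ _ fun μ _ => hν μ
  simp only [Finset.card_univ, Fintype.card_fin, nsmul_eq_mul] at h1
  push_cast at h1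
  have h2 := mul_le_mul_of_nonneg_left h1 hm.le
  simp only [Pi.sub_apply]
  linarith

section

variable (L T S : ℕ) [NeZero L] [NeZero T] [NeZero S]

/-- Of the pointwise rate 2m, one half cancels the weight e^{m|u-u'|} and the other makes the sums
converge, uniformly in lattice spacing and periods. -/
theorem massNorm_le {n : ℕ} {A : Operator L T S 0 n} {m C : ℝ} (hm : 0 < m) (hC : 0 ≤ C)
    (hA : ∀ (y : Lattice L T S n) (x : Lattice L T S 0),
      ‖A y x‖ ≤ C * Real.exp (-(2 * m * ∑ ν,
        ‖((position (scale L n) (label y) ν - position (scale L 0) (label x) ν : ℝ) :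
          AddCircle (period T S ν : ℝ))‖))) :
    massNorm L T S 0 n m A ≤ C * (Real.exp m * (2 * ((1 + m) / m))) ^ 4 := by
  have h1 : ∀ (y : Lattice L T S n) (x : Lattice L T S 0),
      Real.exp (m * torusDist L T S n 0 y x) * ‖kernel L T S 0 n A y x‖ ≤
        C * Real.exp (-(m * ∑ ν,
          ‖((position (scale L n) (label y) ν - position (scale L 0) (label x) ν : ℝ) :
            AddCircle (period T S ν : ℝ))‖)) := by
    intro y x
    have h2 := mul_le_mul_of_nonneg_left (torusDist_le_sum L T S n 0 y x) hm.le
    rw [kernel, mul_zero, pow_zero, one_mul]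
    refine (mul_le_mul (Real.exp_le_exp.mpr h2) (hA y x) (norm_nonneg _)
      (Real.exp_pos _).le).trans_eq ?_
    rw [mul_left_comm, ← Real.exp_add]
    congr 2
    ring
  refine max_le (ciSup_le fun y => ?_) (ciSup_le fun x => ?_)
  · refine (mul_le_mul_of_nonneg_left (Finset.sum_le_sum fun x _ => h1 y x)
      (by positivity)).trans ?_
    rw [← Finset.mul_sum, mul_left_comm]
    refine mul_le_mul_of_nonneg_left ?_ hC
    refine le_trans (le_of_eq ?_)
      (sum_lattice_exp_le L T S hm 0 (position (scale L n) (label y)))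
    refine congrArg _ (Finset.sum_congr rfl fun x _ => ?_)
    refine congrArg (fun r => Real.exp (-(m * r))) (Finset.sum_congr rfl fun ν _ => ?_)
    rw [← norm_neg, ← AddCircle.coe_neg, neg_sub]
  · refine (mul_le_mul_of_nonneg_left (Finset.sum_le_sum fun y _ => h1 y x)
      (by positivity)).trans ?_
    rw [← Finset.mul_sum, mul_left_comm]
    exact mul_le_mul_of_nonneg_left
      (sum_lattice_exp_le L T S hm n (position (scale L 0) (label x))) hC

end

end ParabolicBlockSpin

end

/-! ### The decay theorem -/

theorem mainTheorem10 (𝔮 : ℕ) (h𝔮 : 4 ≤ 𝔮) (h𝔮even : Even 𝔮) :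
    ∃ Γ₂ : ℝ, ∀ (a : ℝ), 0 < a →
      ∀ (h : (Fin 3 → ℤ) → ℂ) (hhat : (Fin 3 → ℂ) → ℂ),
        ParabolicBlockSpin.IsHamiltonian h hhat →
      ∃ m₆ : ℝ, 0 < m₆ ∧ ∃ Γ₁₄ : ℝ,
        ∀ (L T S n : ℕ) [NeZero L] [NeZero T] [NeZero S],
          Odd L → Γ₂ < (L : ℝ) → 1 ≤ n →
          IsUnit (ParabolicBlockSpin.avgGram 𝔮 L T S n) ∧
          IsUnit (ParabolicBlockSpin.greenInv 𝔮 L T S a h n) ∧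
          (∀ (y : ParabolicBlockSpin.Lattice L T S n) (x : ParabolicBlockSpin.Lattice L T S 0),
            ‖ParabolicBlockSpin.kernel L T S 0 n
                (ParabolicBlockSpin.greenAvgAdj 𝔮 L T S a h n) y x‖ ≤
              Γ₁₄ * Real.exp (-2 * m₆ * ParabolicBlockSpin.torusDist L T S n 0 y x)) ∧
          ParabolicBlockSpin.massNorm L T S 0 n m₆
            (ParabolicBlockSpin.greenAvgAdj 𝔮 L T S a h n) ≤ Γ₁₄ := by
  -- All estimates hold as soon as L > 1, so this threshold works for every 𝔮.
  refine ⟨1, fun a ha h hhat H => ?_⟩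
  obtain ⟨m, hm, C, hC, hG⟩ :=
    ParabolicBlockSpin.exists_greenAvgAdj_bound (show 2 ≤ 𝔮 by omega) ha H
  -- With m₆ = m/2 the pointwise rate 2m₆ is the full rate m, and the weighted norm uses half of it.
  refine ⟨m / 2, by positivity,
    max C (C * (Real.exp (m / 2) * (2 * ((1 + m / 2) / (m / 2)))) ^ 4),
    fun L T S n _ _ _ hL hL1 _ => ?_⟩
  obtain ⟨hu, hb⟩ := hG L T S n hL (by exact_mod_cast hL1)
  refine ⟨ParabolicBlockSpin.isUnit_avgGram L T S 𝔮 hL n, hu, fun y x => ?_, ?_⟩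
  · rw [ParabolicBlockSpin.kernel, mul_zero, pow_zero, one_mul]
    refine (hb y x).trans (mul_le_mul (le_max_left _ _) (Real.exp_le_exp.mpr ?_)
      (Real.exp_pos _).le (hC.le.trans (le_max_left _ _)))
    have h2 := mul_le_mul_of_nonneg_left (ParabolicBlockSpin.torusDist_le_sum L T S n 0 y x) hm.le
    linarith
  · refine (ParabolicBlockSpin.massNorm_le L T S (by positivity) hC.le fun y x => ?_).trans
      (le_max_right _ _)
    rw [mul_div_cancel₀ m two_ne_zero]
    exact hb y x
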